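/- Let $a_n = 4^{-n}$ for $n \in \{1,2,3,\dots\}$, let $\Omega_0 = (-1,1)\times(-1,0)$ and \[ \Omega_n = \{(x,y)\in\mathbb R^2 : 0<y<a_n \text{ and } |x-2^{-n}| < a_n^2 - a_n\,y\} \qquad (n\ge 1), \] and let $\Omega$ be the interior of the closure of $\bigcup_{n=0}^\infty \Omega_n$. Let $\Gamma=\partial\Omega$, let $\sigma$ be the one-dimensional Hausdorff measure on $\Gamma$, and let all function spaces be real, with $\|u\|_{H^1(\Omega)}^2=\int_\Omega|u|^2+\int_\Omega|\nabla u|^2$. A function $\varphi\in L_2(\Gamma)=L_2(\Gamma,\sigma)$ is a trace of $u\in H^1(\Omega)$ if there are $u_k\in H^1(\Omega)\cap C(\overline\Omega)$ with $u_k\to u$ in $H^1(\Omega)$ and $u_k|_\Gamma\to\varphi$ in $L_2(\Gamma)$. A function $u\in H^1(\Omega)$ with distributional Laplacian $\Delta u\in L_2(\Omega)$ has normal derivative $\psi\in L_2(\Gamma)$ if $\int_\Omega(\Delta u)\,v+\int_\Omega\nabla u\cdot\nabla v=\int_\Gamma\psi\,v\,d\sigma$ for all $v\in H^1(\Omega)\cap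 C(\overline\Omega)$. The Dirichlet-to-Neumann operator $D_0$ on $L_2(\Gamma)$ is defined by: $\varphi\in D(D_0)$ and $D_0\varphi=\psi$ if and only if there is $u\in H^1(\Omega)$ such that $\Delta u=0$, $\varphi$ is a trace of $u$, and $\psi$ is the normal derivative of $u$. Then: 1. $\Omega$ is bounded, open and connected, $\Omega$ has continuous boundary (locally, in suitable Cartesian coordinates, $\Omega$ is the part of a box strictly below the graph of a continuous function, and $\Gamma$ is that graph), and $\sigma(\Gamma)<\infty$. 2. There is $c>0$ such that $\int_\Gamma|u|^2\,d\sigma\le c\big(\int_\Omega|\nabla u|^2+\int_\Omega|u|^2\big)$ for all $u\in H^1(\Omega)\cap C(\overline\Omega)$. 3. Every $u\in H^1(\Omega)$ has a unique trace $\operatorname{Tr}u$. 4. The embedding $H^1(\Omega)\hookrightarrow L_2(\Omega)$ is compact. 5. The map $\operatorname{Tr}\colon H^1(\Omega)\to L_2(\Gamma)$ is linear and bounded, but not compact. 6. $D_0$ is a well-defined (single-valued) positive self-adjoint operator on $L_2(\Gamma)$, and it does not have compact resolvent. -/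

import Mathlib

open MeasureTheory Set Filter Topology
open scoped ContDiff InnerProductSpace

noncomputable section

namespace RoughDtN

/-- The Euclidean plane. -/
abbrev Plane : Type := EuclideanSpace ℝ (Fin 2)

/-! ### The domain -/

/-- The height `a n = 4 ^ (-n)` of the `n`-th spike. -/
def spikeHeight (n : ℕ) : ℝ := 1 / 4 ^ n

/-- The open rectangle `(-1, 1) × (-1, 0)`. -/
def rectangle : Set Plane := {p | p 0 ∈ Ioo (-1 : ℝ) 1 ∧ p 1 ∈ Ioo (-1 : ℝ) 0}

/-- The `n`-th open triangle: `0 < y < a n` and `|x - 2 ^ (-n)| < (a n) ^ 2 - (a n) * y`. -/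
def spike (n : ℕ) : Set Plane :=
  {p | p 1 ∈ Ioo (0 : ℝ) (spikeHeight n) ∧
    |p 0 - 1 / 2 ^ n| < spikeHeight n ^ 2 - spikeHeight n * p 1}

/-- The interior of the closure of the union of the rectangle and of the spikes
with index `n = 1, 2, 3, …`. -/
def spikyDomain : Set Plane := interior (closure (rectangle ∪ ⋃ n ∈ Ici (1 : ℕ), spike n))

/-- `Ω` has a continuous boundary: near every boundary point, in suitable Cartesian coordinates
(an isometric change of coordinates `T` that sends the point to the origin), `Ω` is the part of a
box `(-r, r) × (-s, s)` strictly below the graph of a continuous function, and the boundary of `Ω`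
is that graph. -/
def HasContinuousBoundary (Ω : Set Plane) : Prop :=
  ∀ p ∈ frontier Ω, ∃ (T : Plane ≃ᵃⁱ[ℝ] Plane) (r s : ℝ) (h : ℝ → ℝ),
    T p = 0 ∧ 0 < r ∧ 0 < s ∧ ContinuousOn h (Ioo (-r) r) ∧ MapsTo h (Ioo (-r) r) (Ioo (-s) s) ∧
    ∀ q : Plane, T q 0 ∈ Ioo (-r) r → T q 1 ∈ Ioo (-s) s →
      (q ∈ Ω ↔ T q 1 < h (T q 0)) ∧ (q ∈ frontier Ω ↔ T q 1 = h (T q 0))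

/-! ### Function spaces -/

/-- The real space `L₂(Ω)`, for Lebesgue measure. -/
abbrev L2 (Ω : Set Plane) : Type := Lp ℝ 2 (volume.restrict Ω)

/-- The square integrable vector fields on `Ω`. -/
abbrev L2Field (Ω : Set Plane) : Type := Lp Plane 2 (volume.restrict Ω)

/-- The measure `σ`: the one-dimensional Hausdorff measure on the boundary of `Ω`. -/
abbrev bdryMeasure (Ω : Set Plane) : Measure Plane := (μH[1]).restrict (frontier Ω)

/-- The real space `L₂(Γ)`, where `Γ` is the boundary of `Ω`, with respect to `σ`. -/
abbrev L2Bdry (Ω : Set Plane) : Type := Lp ℝ 2 (bdryMeasure Ω)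

/-- Test functions: smooth, with compact support contained in `Ω`. -/
def IsTest (Ω : Set Plane) (η : Plane → ℝ) : Prop :=
  ContDiff ℝ ∞ η ∧ HasCompactSupport η ∧ tsupport η ⊆ Ω

/-- `g` is the weak gradient of `u` on `Ω`. -/
def IsWeakGradient (Ω : Set Plane) (u : L2 Ω) (g : L2Field Ω) : Prop :=
  ∀ η : Plane → ℝ, IsTest Ω η → ∀ e : Plane,
    ∫ x in Ω, u x * fderiv ℝ η x e = -∫ x in Ω, ⟪g x, e⟫_ℝ * η x

/-- An `L₂` function times a continuous function with compact support is integrable. -/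
theorem integrable_mul_of_hasCompactSupport {μ : Measure Plane} [IsLocallyFiniteMeasure μ]
    {f : Plane → ℝ} (hf : MemLp f 2 μ) {η : Plane → ℝ} (hη : Continuous η)
    (hc : HasCompactSupport η) : Integrable (fun x => f x * η x) μ :=
  ((hf.locallyIntegrable (by norm_num)).integrable_smul_right_of_hasCompactSupport hη hc :)

theorem IsTest.integrable_fderiv {Ω : Set Plane} {η : Plane → ℝ} (h : IsTest Ω η) (u : L2 Ω)
    (e : Plane) : Integrable (fun x => u x * fderiv ℝ η x e) (volume.restrict Ω) := by
  refine integrable_mul_of_hasCompactSupport (Lp.memLp u)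
    (η := fun x => fderiv ℝ η x e) ?_ ?_
  · exact (h.1.continuous_fderiv (by simp)).clm_apply continuous_const
  · exact h.2.1.fderiv_apply ℝ e

theorem IsTest.integrable_inner {Ω : Set Plane} {η : Plane → ℝ} (h : IsTest Ω η) (g : L2Field Ω)
    (e : Plane) : Integrable (fun x => ⟪g x, e⟫_ℝ * η x) (volume.restrict Ω) :=
  integrable_mul_of_hasCompactSupport ((Lp.memLp g).inner_const e) h.1.continuous h.2.1

/-- The Sobolev space `H¹(Ω)`, as the Hilbert space of pairs `(u, ∇u)` with `u ∈ L₂(Ω)` whose weak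
gradient `∇u` is in `L₂(Ω)`. It carries the norm `(‖u‖² + ‖∇u‖²) ^ (1/2)`. -/
def sobolevSubmodule (Ω : Set Plane) : Submodule ℝ (WithLp 2 (L2 Ω × L2Field Ω)) where
  carrier := {w | IsWeakGradient Ω w.fst w.snd}
  zero_mem' := by
    intro η hη e
    have h1 : (fun x => (0 : L2 Ω) x * fderiv ℝ η x e) =ᵐ[volume.restrict Ω] 0 := by
      filter_upwards [Lp.coeFn_zero ℝ 2 (volume.restrict Ω)] with x hx
      rw [hx]; simp
    have h2 : (fun x => ⟪(0 : L2Field Ω) x, e⟫_ℝ * η x) =ᵐ[volume.restrict Ω] 0 := by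
      filter_upwards [Lp.coeFn_zero Plane 2 (volume.restrict Ω)] with x hx
      rw [hx]; simp
    simp only [WithLp.zero_fst, WithLp.zero_snd]
    rw [integral_congr_ae h1, integral_congr_ae h2]
    simp
  add_mem' := by
    intro v w hv hw η hη e
    have h1 : (fun x => (v.fst + w.fst : L2 Ω) x * fderiv ℝ η x e) =ᵐ[volume.restrict Ω]
        fun x => v.fst x * fderiv ℝ η x e + w.fst x * fderiv ℝ η x e := by
      filter_upwards [Lp.coeFn_add v.fst w.fst] with x hx
      simp only [hx, Pi.add_apply, add_mul]
    have h2 : (fun x => ⟪(v.snd + w.snd : L2Field Ω) x, e⟫_ℝ * η x) =ᵐ[volume.restrict Ω]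
        fun x => ⟪v.snd x, e⟫_ℝ * η x + ⟪w.snd x, e⟫_ℝ * η x := by
      filter_upwards [Lp.coeFn_add v.snd w.snd] with x hx
      simp only [hx, Pi.add_apply, inner_add_left, add_mul]
    simp only [WithLp.add_fst, WithLp.add_snd]
    rw [integral_congr_ae h1, integral_congr_ae h2,
      integral_add (hη.integrable_fderiv _ _) (hη.integrable_fderiv _ _),
      integral_add (hη.integrable_inner _ _) (hη.integrable_inner _ _), hv η hη e, hw η hη e]
    ring
  smul_mem' := by
    intro c w hw η hη e
    have h1 : (fun x => (c • w.fst : L2 Ω) x * fderiv ℝ η x e) =ᵐ[volume.restrict Ω]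
        fun x => c * (w.fst x * fderiv ℝ η x e) := by
      filter_upwards [Lp.coeFn_smul c w.fst] with x hx
      simp only [hx, Pi.smul_apply, smul_eq_mul, mul_assoc]
    have h2 : (fun x => ⟪(c • w.snd : L2Field Ω) x, e⟫_ℝ * η x) =ᵐ[volume.restrict Ω]
        fun x => c * (⟪w.snd x, e⟫_ℝ * η x) := by
      filter_upwards [Lp.coeFn_smul c w.snd] with x hx
      simp only [hx, Pi.smul_apply, real_inner_smul_left, mul_assoc]
    simp only [WithLp.smul_fst, WithLp.smul_snd]
    rw [integral_congr_ae h1, integral_congr_ae h2, integral_const_mul, integral_const_mul,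
      hw η hη e]
    ring

/-- The Sobolev space `H¹(Ω)`. -/
abbrev H1 (Ω : Set Plane) : Type := sobolevSubmodule Ω

/-- The function underlying an element of `H¹(Ω)`. -/
abbrev H1.fn {Ω : Set Plane} (u : H1 Ω) : L2 Ω := u.1.fst

/-- The weak gradient of an element of `H¹(Ω)`. -/
abbrev H1.grad {Ω : Set Plane} (u : H1 Ω) : L2Field Ω := u.1.snd

/-- The embedding of `H¹(Ω)` into `L₂(Ω)`. -/
def H1.embedding (Ω : Set Plane) : H1 Ω →L[ℝ] L2 Ω :=
  (WithLp.fstL 2 ℝ (L2 Ω) (L2Field Ω)).comp (sobolevSubmodule Ω).subtypeL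

/-! ### Traces, normal derivatives and the Dirichlet-to-Neumann operator -/

/-- `u` is in `H¹(Ω) ∩ C(closure Ω)`, and `f` is its continuous representative
(only the values of `f` on the closure of `Ω` matter). -/
def H1.IsContRep {Ω : Set Plane} (u : H1 Ω) (f : Plane → ℝ) : Prop :=
  ContinuousOn f (closure Ω) ∧ u.fn =ᵐ[volume.restrict Ω] f

/-- `φ ∈ L₂(Γ)` is a trace of `u ∈ H¹(Ω)`: there are `u₀, u₁, …` in `H¹(Ω) ∩ C(closure Ω)` that
converge to `u` in `H¹(Ω)` and whose restrictions to `Γ` converge to `φ` in `L₂(Γ)`. -/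
def IsTrace {Ω : Set Plane} (u : H1 Ω) (φ : L2Bdry Ω) : Prop :=
  ∃ (U : ℕ → H1 Ω) (f : ℕ → Plane → ℝ) (Φ : ℕ → L2Bdry Ω),
    (∀ n, (U n).IsContRep (f n)) ∧ (∀ n, Φ n =ᵐ[bdryMeasure Ω] f n) ∧
    Tendsto U atTop (𝓝 u) ∧ Tendsto Φ atTop (𝓝 φ)

/-- `Δ u = h` in the sense of distributions on `Ω`. -/
def HasDistribLaplacian {Ω : Set Plane} (u : H1 Ω) (h : L2 Ω) : Prop :=
  ∀ η : Plane → ℝ, IsTest Ω η →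
    ∫ x in Ω, u.fn x * Laplacian.laplacian η x = ∫ x in Ω, h x * η x

/-- `Δ u ∈ L₂(Ω)`, and `ψ ∈ L₂(Γ)` is the normal derivative of `u`, by Green's formula. -/
def HasNormalDerivative {Ω : Set Plane} (u : H1 Ω) (ψ : L2Bdry Ω) : Prop :=
  ∃ h : L2 Ω, HasDistribLaplacian u h ∧
    ∀ (v : H1 Ω) (f : Plane → ℝ), v.IsContRep f →
      (∫ x in Ω, h x * v.fn x) + ∫ x in Ω, ⟪u.grad x, v.grad x⟫_ℝ
        = ∫ x, ψ x * f x ∂(bdryMeasure Ω)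

/-- The Dirichlet-to-Neumann relation: some harmonic `u ∈ H¹(Ω)` has `φ` as a trace and `ψ` as
its normal derivative. -/
def DtNRel (Ω : Set Plane) (φ ψ : L2Bdry Ω) : Prop :=
  ∃ u : H1 Ω, HasDistribLaplacian u 0 ∧ IsTrace u φ ∧ HasNormalDerivative u ψ

/-- The (unbounded) operator `A` is the Dirichlet-to-Neumann operator `D₀` of `Ω`. -/
def IsDtNOperator (Ω : Set Plane) (A : L2Bdry Ω →ₗ.[ℝ] L2Bdry Ω) : Prop :=
  ∀ φ ψ : L2Bdry Ω, (φ, ψ) ∈ A.graph ↔ DtNRel Ω φ ψ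

/-- `R` is the resolvent of the unbounded operator `A` at `z`, that is, the bounded two-sided
inverse of `z - A`. -/
def IsResolventAt {H : Type*} [NormedAddCommGroup H] [NormedSpace ℝ H] (A : H →ₗ.[ℝ] H) (z : ℝ)
    (R : H →L[ℝ] H) : Prop :=
  (∀ y : H, ∃ x : A.domain, (x : H) = R y ∧ z • (x : H) - A x = y) ∧
    ∀ x : A.domain, R (z • (x : H) - A x) = x

/-- The unbounded operator `A` has compact resolvent: the resolvent at some point of the resolvent
set exists and is a compact operator. -/
def HasCompactResolvent {H : Type*} [NormedAddCommGroup H] [NormedSpace ℝ H]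
    (A : H →ₗ.[ℝ] H) : Prop :=
  ∃ (z : ℝ) (R : H →L[ℝ] H), IsResolventAt A z R ∧ IsCompactOperator R

end RoughDtN

end

open RoughDtN

/-! The domain is the part of a strip between `y = -1` and the graph of `roof`, a uniformly
convergent sum of tents with disjoint bases (`spikyDomain_eq`). The roof is continuous but not
Lipschitz: near `x = 0` the sides of the spikes have slopes `± 1 / a_n`. Each spike has height `a_n`
and half-width `a_n²`, so its sides have length comparable to `a_n`, which is summable, while its
area is of order `a_n³`.

The exponents are critical for the trace. A function equal to `a_n^(-1/2)` on the upper part of the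
`n`-th spike, and falling to zero at its base, has energy of order `a_n³ · a_n⁻¹ · a_n⁻² = 1` and
boundary mass of order `a_n · a_n⁻¹ = 1`. These functions have disjoint supports, so their traces
are orthogonal and do not become small, although the functions are bounded in `H¹`
(`exists_spike_functions`); hence the trace is not compact. It is nevertheless bounded: values on
the sides of a spike are controlled by vertical averaging over depth `a_n` below the base, and those
averages by horizontal averaging over a window of width `2^(-n) / 2`. The constants are independent
of `n` and the windows are disjoint, so the estimates add up (`lintegral_spike_le`,
`lintegral_frontier_sq_le`).

Smooth functions of the plane are dense in `H¹`: a contraction much stronger vertically than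
horizontally pushes the closed region into the open one, and then a mollification is possible
(`exists_smooth_approx`). Every estimate is therefore proved for smooth functions. Compactness of
`H¹` in `L₂` uses only continuity of the roof: a layer of thickness `ε` below it carries mass `O(ε)`
times the energy, and the rest is covered by finitely many small squares on which Poincaré's
inequality applies (`exists_step_approx`).

Finally `D₀` is the operator of the Dirichlet form with respect to the trace map `j`. The form plus
`‖j u‖²` is coercive on `H¹` (`H1_norm_sq_le`), so `(1 + D₀)⁻¹` exists as a bounded, injective,
symmetric operator, and `D₀` is self-adjoint. If some resolvent were compact, so would be the
solution operator, then `j* j`, and then `j`; this contradicts the noncompactness of the trace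
(`exists_form_operator`). -/

/-! ### Operators associated with a form -/

section FormOperator

/-- If `R` is compact and `S` is dominated by `R` in the sense that
`‖S f‖² ≤ C ‖R f‖ ‖f‖`, then `S` is compact. -/
theorem IsCompactOperator.of_norm_sq_le {E F G : Type*} [NormedAddCommGroup E] [NormedSpace ℝ E]
    [NormedAddCommGroup F] [NormedSpace ℝ F] [CompleteSpace F]
    [NormedAddCommGroup G] [NormedSpace ℝ G]
    {R : E →L[ℝ] G} (hR : IsCompactOperator R) (S : E →L[ℝ] F) {C : ℝ}
    (h : ∀ f, ‖S f‖ ^ 2 ≤ C * (‖R f‖ * ‖f‖)) : IsCompactOperator S := by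
  refine (isCompactOperator_iff_isCompact_closure_image_closedBall (𝕜₁ := ℝ)
    S.toLinearMap one_pos).2 ?_
  refine TotallyBounded.isCompact_of_isClosed (TotallyBounded.closure ?_) isClosed_closure
  have hRt : TotallyBounded (R '' Metric.closedBall 0 1) :=
    (IsCompactOperator.isCompact_closure_image_closedBall (𝕜₁ := ℝ)
      (f := R.toLinearMap) hR 1).totallyBounded.subset subset_closure
  rw [Metric.totallyBounded_iff]
  intro ε hε
  -- Differences of points of the unit ball have norm at most `2`, so this radius gives `|C| * δ * 2
  -- < ε ^ 2`; the summand `1` covers `C = 0`.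
  have hδ : 0 < ε ^ 2 / (2 * (|C| + 1)) := by positivity
  obtain ⟨s, hs, hsf, htc⟩ := exists_subset_image_finite_and.1
    (Metric.finite_approx_of_totallyBounded hRt _ hδ)
  refine ⟨S '' s, hsf.image S, ?_⟩
  rintro _ ⟨f, hf, rfl⟩
  obtain ⟨_, ⟨g, hg, rfl⟩, hfy⟩ := mem_iUnion₂.1 (htc ⟨f, hf, rfl⟩)
  refine mem_iUnion₂.2 ⟨S g, ⟨g, hg, rfl⟩, ?_⟩
  have hg1 := hs hg
  have hfy' : ‖R (f - g)‖ < ε ^ 2 / (2 * (|C| + 1)) := by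
    simpa [dist_eq_norm] using hfy
  have hg1 := hs hg
  simp only [Metric.mem_closedBall, dist_zero_right] at hf hg1
  change dist (S f) (S g) < ε
  rw [dist_eq_norm, ← map_sub]
  have hfg : ‖f - g‖ ≤ 2 := (norm_sub_le _ _).trans (by linarith)
  refine lt_of_pow_lt_pow_left₀ 2 hε.le ((h _).trans_lt ?_)
  calc C * (‖R (f - g)‖ * ‖f - g‖) ≤ |C| * (‖R (f - g)‖ * 2) :=
        mul_le_mul (le_abs_self C) (by gcongr) (by positivity) (abs_nonneg _)
    _ ≤ |C| * (ε ^ 2 / (2 * (|C| + 1)) * 2) := by gcongr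
    _ = ε ^ 2 * (|C| / (|C| + 1)) := by field_simp
    _ < ε ^ 2 * 1 := by
        gcongr
        rw [div_lt_one (by positivity)]
        linarith
    _ = ε ^ 2 := mul_one _

variable {V G H : Type*} [NormedAddCommGroup V] [InnerProductSpace ℝ V] [CompleteSpace V]
  [NormedAddCommGroup G] [InnerProductSpace ℝ G] [CompleteSpace G]
  [NormedAddCommGroup H] [InnerProductSpace ℝ H] [CompleteSpace H]

/-- The solution operator of the problem `⟪T u, T v⟫ + ⟪j u, j v⟫ = ⟪f, j v⟫`. -/
theorem exists_form_solution (T : V →L[ℝ] G) (j : V →L[ℝ] H) {c : ℝ} (hc : 0 < c)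
    (hcoer : ∀ u, ‖u‖ ^ 2 ≤ c * (‖T u‖ ^ 2 + ‖j u‖ ^ 2)) :
    ∃ (B : V →L[ℝ] V) (S : H →L[ℝ] V), B ∘L S = ContinuousLinearMap.adjoint j ∧
      ∀ f u, S f = u ↔ ∀ v, ⟪T u, T v⟫_ℝ + ⟪j u, j v⟫_ℝ = ⟪f, j v⟫_ℝ := by
  let B : V →L[ℝ] V := (ContinuousLinearMap.adjoint T) ∘L T + (ContinuousLinearMap.adjoint j) ∘L j
  have hB : ∀ u v, ⟪B u, v⟫_ℝ = ⟪T u, T v⟫_ℝ + ⟪j u, j v⟫_ℝ := fun u v => by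
    simp [B, inner_add_left, ContinuousLinearMap.adjoint_inner_left]
  let b : V →L[ℝ] V →L[ℝ] ℝ := (innerSL ℝ) ∘L B
  have hb : IsCoercive b := by
    refine ⟨c⁻¹, by positivity, fun u => ?_⟩
    have h1 : b u u = ‖T u‖ ^ 2 + ‖j u‖ ^ 2 := by
      change ⟪B u, u⟫_ℝ = _
      rw [hB]; simp
    rw [h1, mul_assoc, ← sq, inv_mul_le_iff₀ hc]
    exact hcoer u
  let e := hb.continuousLinearEquivOfBilin
  have he : ∀ u, e u = B u := fun u => by
    refine ext_inner_right ℝ fun w => ?_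
    rw [hb.continuousLinearEquivOfBilin_apply]; rfl
  -- Lax–Milgram inverts `B = T* T + j* j`, and `S = B⁻¹ j*`. The factorisation `B S = j*` is kept
  -- because it transfers compactness from `S` to `j*`.
  refine ⟨B, (e.symm : V →L[ℝ] V) ∘L ContinuousLinearMap.adjoint j, ?_, ?_⟩
  · ext1 f
    simp [← he]
  · intro f u
    have : ((e.symm : V →L[ℝ] V) ∘L ContinuousLinearMap.adjoint j) f = u ↔
        ContinuousLinearMap.adjoint j f = B u := by
      rw [← he]; simp [ContinuousLinearEquiv.symm_apply_eq]
    rw [this]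
    constructor
    · intro h v
      rw [← hB, ← h, ContinuousLinearMap.adjoint_inner_left]
    · intro h
      refine ext_inner_right ℝ fun v => ?_
      rw [hB, h, ContinuousLinearMap.adjoint_inner_left]

/-- The operator on `H` associated with the form `⟪T u, T v⟫` and the map `j`. -/
theorem exists_form_operator (T : V →L[ℝ] G) (j : V →L[ℝ] H) {c : ℝ} (hc : 0 < c)
    (hcoer : ∀ u, ‖u‖ ^ 2 ≤ c * (‖T u‖ ^ 2 + ‖j u‖ ^ 2))
    (hdense : ∀ f : H, (∀ u, ⟪f, j u⟫_ℝ = 0) → f = 0) :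
    ∃ A : H →ₗ.[ℝ] H,
      (∀ φ ψ : H, (φ, ψ) ∈ A.graph ↔ ∃ u, j u = φ ∧ ∀ v, ⟪T u, T v⟫_ℝ = ⟪ψ, j v⟫_ℝ) ∧
      IsSelfAdjoint A ∧ (∀ φ : A.domain, 0 ≤ ⟪A φ, (φ : H)⟫_ℝ) ∧
      (HasCompactResolvent A → IsCompactOperator j) := by
  obtain ⟨B, S, hBS, hS⟩ := exists_form_solution T j hc hcoer
  have hS' : ∀ f v, ⟪T (S f), T v⟫_ℝ + ⟪j (S f), j v⟫_ℝ = ⟪f, j v⟫_ℝ := fun f => (hS f _).1 rfl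
  set R : H →L[ℝ] H := j ∘L S with hRdef
  have hRapp : ∀ f, R f = j (S f) := fun f => rfl
  have hRsymm : ∀ f g, ⟪R f, g⟫_ℝ = ⟪f, R g⟫_ℝ := fun f g => by
    rw [real_inner_comm, hRapp, hRapp, ← hS' g, ← hS' f, real_inner_comm (T _),
      real_inner_comm (j _)]
  -- If `R f = 0`, testing with `S f` gives `T (S f) = 0`, and coercivity gives `S f = 0`; then `f`
  -- is orthogonal to the range of `j`.
  have hRinj : ∀ f, R f = 0 → f = 0 := fun f hf => by
    have h0 := hS' f (S f)
    rw [← hRapp, hf] at h0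
    simp only [inner_zero_right, add_zero] at h0
    have h2 : S f = 0 := by
      have h3 := hcoer (S f)
      rw [← hRapp, hf, ← real_inner_self_eq_norm_sq (T (S f)), h0] at h3
      simpa using h3
    refine hdense f fun u => ?_
    rw [← hS' f u, h2]
    simp
  -- `R` is to be `(1 + A)⁻¹`, so the graph of `A` consists of the pairs with `φ = R (φ + ψ)`;
  -- equivalently, of the pairs `(R f, f - R f)`.
  let g : Submodule ℝ (H × H) := LinearMap.ker
    (LinearMap.fst ℝ H H - R.toLinearMap ∘ₗ (LinearMap.fst ℝ H H + LinearMap.snd ℝ H H))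
  have hg : ∀ φ ψ, (φ, ψ) ∈ g ↔ φ = R (φ + ψ) := fun φ ψ => by
    simp [g, sub_eq_zero]
  have hg0 : ∀ x ∈ g, x.1 = 0 → x.2 = 0 := by
    rintro ⟨φ, ψ⟩ hx (rfl : φ = 0)
    rw [hg] at hx
    simpa using hRinj _ hx.symm
  let A := g.toLinearPMap
  have hA : A.graph = g := Submodule.toLinearPMap_graph_eq g hg0
  have hRg : ∀ f, (R f, f - R f) ∈ g := fun f => by rw [hg]; simp
  -- The domain contains the range of `R`, whose orthogonal complement is the kernel of the
  -- symmetric operator `R`, which is trivial.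
  have hdom : Dense (A.domain : Set H) := by
    have hsub : (R.range : Set H) ⊆ A.domain := by
      rintro _ ⟨f, rfl⟩
      have := hRg f
      rw [← hA] at this
      exact LinearPMap.mem_domain_of_mem_graph this
    refine Dense.mono hsub ?_
    rw [Submodule.dense_iff_topologicalClosure_eq_top, Submodule.topologicalClosure_eq_top_iff,
      Submodule.eq_bot_iff]
    intro f hf
    refine hRinj f (ext_inner_right ℝ fun w => ?_)
    rw [hRsymm, inner_zero_left, real_inner_comm]
    exact (Submodule.mem_orthogonal _ _).1 hf (R w) ⟨w, rfl⟩
  have hchar : ∀ φ ψ : H, (φ, ψ) ∈ A.graph ↔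
      ∃ u, j u = φ ∧ ∀ v, ⟪T u, T v⟫_ℝ = ⟪ψ, j v⟫_ℝ := by
    intro φ ψ
    rw [hA, hg]
    constructor
    · intro h
      refine ⟨S (φ + ψ), h.symm, fun v => ?_⟩
      have := hS' (φ + ψ) v
      rw [← hRapp, ← h, inner_add_left] at this
      linarith
    · rintro ⟨u, rfl, hu⟩
      have : S (j u + ψ) = u := (hS _ _).2 fun v => by rw [inner_add_left, hu]; ring
      rw [hRapp, this]
  refine ⟨A, hchar, ?_, ?_, ?_⟩
  · rw [LinearPMap.isSelfAdjoint_def]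
    refine LinearPMap.eq_of_eq_graph ?_
    rw [LinearPMap.adjoint_graph_eq_graph_adjoint hdom, hA]
    ext ⟨φ, ψ⟩
    rw [Submodule.mem_adjoint_iff, hg]
    constructor
    · intro h
      refine ext_inner_left ℝ fun f => ?_
      have := h _ _ (hRg f)
      simp only [inner_sub_left] at this
      rw [← hRsymm, inner_add_right]
      linarith
    · intro h a b hab
      rw [hg] at hab
      have h1 : ⟪a + b, φ⟫_ℝ = ⟪a, φ + ψ⟫_ℝ := by
        rw [h, ← hRsymm, ← hab, ← h]
      rw [inner_add_left, inner_add_right] at h1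
      simp only
      linarith
  · intro φ
    obtain ⟨u, hu, huv⟩ := (hchar _ _).1 (A.mem_graph φ)
    rw [← hu, ← huv]
    exact real_inner_self_nonneg
  · rintro ⟨z, Q, ⟨hQ1, hQ2⟩, hQc⟩
    -- Resolvent identity between the points `-1` and `z`: apply `Q (z - A) x = x` to `x = R f`, for
    -- which `A x = f - R f`.
    have hRQ : R = (1 + z) • (Q ∘L R) - Q := by
      ext1 f
      have hf := hRg f
      rw [← hA, LinearPMap.mem_graph_iff] at hf
      obtain ⟨x, hx1, hx2⟩ := hf
      simp only at hx1 hx2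
      have := hQ2 x
      rw [hx2, hx1] at this
      simp only [map_sub, map_smul] at this
      simp only [sub_apply, smul_apply,
        ContinuousLinearMap.comp_apply]
      rw [add_smul, one_smul]
      nth_rw 1 [← this]
      abel
    have hRc : IsCompactOperator R := by
      rw [hRQ]
      exact ((hQc.comp_clm R).smul (1 + z)).sub hQc
    -- Testing the equation of `S f` with `S f` itself gives `‖S f‖² ≤ c ⟪f, R f⟫`.
    have hSc : IsCompactOperator S := by
      refine hRc.of_norm_sq_le S (C := c) fun f => ?_
      refine (hcoer _).trans (mul_le_mul_of_nonneg_left ?_ hc.le)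
      rw [← real_inner_self_eq_norm_sq, ← real_inner_self_eq_norm_sq, hS', ← hRapp, mul_comm]
      exact real_inner_le_norm _ _
    have hadj : IsCompactOperator (ContinuousLinearMap.adjoint j ∘L j) := by
      rw [← hBS]
      exact (hSc.clm_comp B).comp_clm j
    refine hadj.of_norm_sq_le j (C := 1) fun u => ?_
    rw [one_mul, ← real_inner_self_eq_norm_sq, ← ContinuousLinearMap.adjoint_inner_left]
    exact real_inner_le_norm _ _

end FormOperator

/-! ### The shape of the domain -/

section Geometry

/-- The point of the plane with coordinates `x`, `y`. -/
def planePt (x y : ℝ) : Plane := !₂[x, y]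

@[simp] theorem planePt_apply_zero (x y : ℝ) : planePt x y 0 = x := rfl
@[simp] theorem planePt_apply_one (x y : ℝ) : planePt x y 1 = y := rfl

theorem plane_ext {p q : Plane} (h0 : p 0 = q 0) (h1 : p 1 = q 1) : p = q := by
  ext i; fin_cases i <;> assumption

@[simp] theorem planePt_eta (p : Plane) : planePt (p 0) (p 1) = p := plane_ext rfl rfl

@[fun_prop]
theorem Continuous.planePt {α : Type*} [TopologicalSpace α] {f g : α → ℝ}
    (hf : Continuous f) (hg : Continuous g) : Continuous fun a => planePt (f a) (g a) := by
  refine (PiLp.continuous_toLp 2 _).comp (continuous_pi fun i => ?_)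
  fin_cases i <;> simpa

theorem plane_norm_sq (p : Plane) : ‖p‖ ^ 2 = p 0 ^ 2 + p 1 ^ 2 := by
  simp [EuclideanSpace.norm_sq_eq, Fin.sum_univ_two]

theorem abs_apply_le_norm (p : Plane) (i : Fin 2) : |p i| ≤ ‖p‖ := by
  simpa using PiLp.norm_apply_le p i

theorem norm_plane_le (p : Plane) : ‖p‖ ≤ |p 0| + |p 1| := by
  refine abs_le_of_sq_le_sq' ?_ (by positivity) |>.2
  rw [plane_norm_sq, add_sq, sq_abs, sq_abs]
  nlinarith [mul_nonneg (abs_nonneg (p 0)) (abs_nonneg (p 1))]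

theorem spikeHeight_pos (n : ℕ) : 0 < spikeHeight n := by unfold spikeHeight; positivity

/-- With `r = 2^(-n)` the height is `r²` and the half-width `r⁴`, so comparisons between a spike and
the distance to its neighbours become polynomial inequalities in `r ≤ 1/2`. -/
theorem spikeHeight_eq (n : ℕ) : spikeHeight n = (1 / 2 ^ n) ^ 2 := by
  rw [spikeHeight, div_pow, one_pow, ← pow_mul, mul_comm, pow_mul]
  norm_num

theorem spikeCentre_le {n : ℕ} (hn : 1 ≤ n) : (1 : ℝ) / 2 ^ n ≤ 1 / 2 := by
  have : (2 : ℝ) ^ 1 ≤ 2 ^ n := pow_le_pow_right₀ (by norm_num) hn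
  exact one_div_le_one_div_of_le (by norm_num) (by simpa using this)

theorem spikeHeight_le {n : ℕ} (hn : 1 ≤ n) : spikeHeight n ≤ 1 / 4 := by
  rw [spikeHeight_eq]
  have h := spikeCentre_le hn
  have h0 : (0 : ℝ) < 1 / 2 ^ n := by positivity
  nlinarith

/-- The half-width is `r⁴` with `r³ ≤ 1/8`. The base thus fits well inside the window of half-width
`r / 4`, with room for a cut-off function in between. -/
theorem spikeHeight_sq_le {n : ℕ} (hn : 1 ≤ n) : spikeHeight n ^ 2 ≤ 1 / 2 ^ n / 8 := by
  rw [spikeHeight_eq]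
  have h := spikeCentre_le hn
  have h0 : (0 : ℝ) < 1 / 2 ^ n := by positivity
  generalize (1 : ℝ) / 2 ^ n = r at *
  have : r ^ 3 ≤ (1 / 2) ^ 3 := pow_le_pow_left₀ h0.le h 3
  nlinarith

theorem summable_spikeHeight : Summable spikeHeight := by
  have := summable_geometric_of_lt_one (r := 1 / 4) (by norm_num) (by norm_num)
  refine this.congr fun n => ?_
  simp [spikeHeight]

/-- The height of the `n`-th spike above `x`, or `0`. -/
noncomputable def tent (n : ℕ) (x : ℝ) : ℝ := max 0 (spikeHeight n - |x - 1 / 2 ^ n| / spikeHeight n)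

theorem continuous_tent (n : ℕ) : Continuous (tent n) := by unfold tent; fun_prop

theorem tent_nonneg (n : ℕ) (x : ℝ) : 0 ≤ tent n x := le_max_left _ _

theorem tent_le (n : ℕ) (x : ℝ) : tent n x ≤ spikeHeight n :=
  max_le (spikeHeight_pos n).le (sub_le_self _ (by have := spikeHeight_pos n; positivity))

/-- At heights `y ≥ 0` the truncation of the tent at `0` plays no role, so its subgraph is the set
described by the inequality in `spike`. -/
theorem lt_tent_iff {n : ℕ} {x y : ℝ} (hy : 0 ≤ y) :
    y < tent n x ↔ |x - 1 / 2 ^ n| < spikeHeight n ^ 2 - spikeHeight n * y := by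
  have := spikeHeight_pos n
  rw [tent, lt_max_iff, or_iff_right hy.not_gt, lt_sub_iff_add_lt, ← lt_sub_iff_add_lt',
    div_lt_iff₀ this]
  constructor <;> intro h <;> nlinarith

theorem tent_eq_zero {n : ℕ} {x : ℝ} (h : spikeHeight n ^ 2 ≤ |x - 1 / 2 ^ n|) :
    tent n x = 0 := by
  refine le_antisymm (not_lt.1 fun h' => ?_) (tent_nonneg n x)
  have := (lt_tent_iff le_rfl).1 h'
  linarith

/-- An interval around the base of the `n`-th spike; these intervals are pairwise disjoint. -/
def window (n : ℕ) : Set ℝ := Ioo (1 / 2 ^ n * (3 / 4)) (1 / 2 ^ n * (5 / 4))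

theorem window_disjoint {n m : ℕ} (h : n ≠ m) : Disjoint (window n) (window m) := by
  wlog hnm : n < m generalizing n m
  · exact (this h.symm (by omega)).symm
  rw [Set.disjoint_left]
  rintro x ⟨h1, -⟩ ⟨-, h2⟩
  have : (1 : ℝ) / 2 ^ m ≤ 1 / 2 ^ n / 2 := by
    rw [div_div, ← pow_succ]
    exact one_div_le_one_div_of_le (by positivity) (pow_le_pow_right₀ (by norm_num) hnm)
  have h0 : (0 : ℝ) < 1 / 2 ^ n := by positivity
  linarith

theorem mem_window_of_abs_le {n : ℕ} (hn : 1 ≤ n) {x : ℝ}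
    (h : |x - 1 / 2 ^ n| ≤ spikeHeight n ^ 2) : x ∈ window n := by
  have h1 := spikeHeight_sq_le hn
  have h0 : (0 : ℝ) < 1 / 2 ^ n := by positivity
  rw [abs_le] at h
  constructor <;> linarith

theorem window_subset {n : ℕ} (hn : 1 ≤ n) : window n ⊆ Ioo (-1) 1 := by
  rintro x ⟨h1, h2⟩
  have h0 : (0 : ℝ) < 1 / 2 ^ n := by positivity
  have := spikeCentre_le hn
  constructor <;> linarith

theorem tent_eq_zero_of_mem_window {n m : ℕ} (hm : 1 ≤ m) (h : n ≠ m) {x : ℝ}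
    (hx : x ∈ window n) : tent m x = 0 := by
  refine tent_eq_zero (not_lt.1 fun h' => ?_)
  exact Set.disjoint_left.1 (window_disjoint h) hx (mem_window_of_abs_le hm h'.le)

/-- The function whose graph is the upper part of the boundary of the domain. -/
noncomputable def roof (x : ℝ) : ℝ := ∑' n, tent (n + 1) x

/-- Weierstrass test with the summable heights. The content is continuity at `0`, where the spikes
accumulate with unbounded slopes. -/
theorem continuous_roof : Continuous roof := by
  refine continuous_tsum (fun n => continuous_tent (n + 1))
    ((summable_nat_add_iff 1).2 summable_spikeHeight) fun n x => ?_
  rw [Real.norm_of_nonneg (tent_nonneg _ _)]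
  exact tent_le _ _

theorem roof_eq_tent {n : ℕ} (hn : 1 ≤ n) {x : ℝ} (hx : x ∈ window n) : roof x = tent n x := by
  obtain ⟨m, rfl⟩ := Nat.exists_eq_add_of_le' hn
  refine tsum_eq_single m fun k hk => ?_
  exact tent_eq_zero_of_mem_window (by omega) (by omega) hx

theorem roof_nonneg (x : ℝ) : 0 ≤ roof x := tsum_nonneg fun _ => tent_nonneg _ _

theorem exists_mem_window_of_roof_ne_zero {x : ℝ} (h : roof x ≠ 0) :
    ∃ n, 1 ≤ n ∧ x ∈ window n ∧ |x - 1 / 2 ^ n| < spikeHeight n ^ 2 := by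
  by_contra! hc
  refine h ?_
  rw [roof, ← tsum_zero (α := ℝ) (β := ℕ)]
  refine tsum_congr fun n => tent_eq_zero (not_lt.1 fun h' => ?_)
  have := hc (n + 1) (by omega) (mem_window_of_abs_le (by omega) h'.le)
  linarith

theorem roof_le (x : ℝ) : roof x ≤ 1 / 4 := by
  by_cases h : roof x = 0
  · rw [h]; norm_num
  · obtain ⟨n, hn, hx, -⟩ := exists_mem_window_of_roof_ne_zero h
    rw [roof_eq_tent hn hx]
    exact (tent_le _ _).trans (spikeHeight_le hn)

/-- All windows of index at least `1` lie in `(0, 5/8)`, so the boundary is flat near the two upper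
corners; the corner charts rely on this. -/
theorem roof_eq_zero {x : ℝ} (h : 3 / 4 < |x|) : roof x = 0 := by
  by_contra hc
  obtain ⟨n, hn, ⟨h1, h2⟩, -⟩ := exists_mem_window_of_roof_ne_zero hc
  have h0 : (0 : ℝ) < 1 / 2 ^ n := by positivity
  have := spikeCentre_le hn
  rw [lt_abs] at h
  rcases h with h | h <;> linarith

/-- The part of the strip `|x| < 1` strictly between `y = -1` and the roof. -/
def openRegion : Set Plane := {p | |p 0| < 1 ∧ -1 < p 1 ∧ p 1 < roof (p 0)}

/-- The part of the strip `|x| ≤ 1` between `y = -1` and the roof. -/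
def closedRegion : Set Plane := {p | |p 0| ≤ 1 ∧ -1 ≤ p 1 ∧ p 1 ≤ roof (p 0)}

theorem continuous_roof_apply : Continuous fun p : Plane => roof (p 0) :=
  continuous_roof.comp (by fun_prop)

theorem isOpen_openRegion : IsOpen openRegion := by
  have h0 : Continuous fun p : Plane => |p 0| := by fun_prop
  have h1 : Continuous fun p : Plane => p 1 := by fun_prop
  exact (isOpen_lt h0 continuous_const).inter
    ((isOpen_lt continuous_const h1).inter (isOpen_lt h1 continuous_roof_apply))

theorem isClosed_closedRegion : IsClosed closedRegion := by
  have h0 : Continuous fun p : Plane => |p 0| := by fun_prop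
  have h1 : Continuous fun p : Plane => p 1 := by fun_prop
  exact (isClosed_le h0 continuous_const).inter
    ((isClosed_le continuous_const h1).inter (isClosed_le h1 continuous_roof_apply))

theorem openRegion_subset_closedRegion : openRegion ⊆ closedRegion :=
  fun _ h => ⟨h.1.le, h.2.1.le, h.2.2.le⟩

theorem closedRegion_subset_closedBall : closedRegion ⊆ Metric.closedBall 0 2 := by
  rintro p ⟨h0, h1, h2⟩
  rw [mem_closedBall_zero_iff]
  have := roof_le (p 0)
  have h3 : |p 1| ≤ 1 := abs_le.2 ⟨h1, by linarith⟩
  exact (norm_plane_le p).trans (by linarith)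

theorem isCompact_closedRegion : IsCompact closedRegion :=
  (isCompact_closedBall _ _).of_isClosed_subset isClosed_closedRegion
    closedRegion_subset_closedBall

/-- A contraction towards `(0, -1/2)` with different factors in the two directions. -/
noncomputable def contract (δ τ : ℝ) (p : Plane) : Plane := planePt ((1 - δ) * p 0) ((1 - τ) * p 1 - τ / 2)

/-- Contractions that are much stronger in the vertical direction push the closed region into
the open one. -/
theorem exists_contract_mem {τ : ℝ} (h0 : 0 < τ) (h1 : τ < 1) :
    ∃ δ, 0 < δ ∧ δ < τ ∧ ∀ p ∈ closedRegion, contract δ τ p ∈ openRegion := by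
  have huc := (isCompact_Icc (a := (-1 : ℝ)) (b := 1)).uniformContinuousOn_of_continuous
    continuous_roof.continuousOn
  -- A horizontal displacement smaller than `η` lowers the roof by less than `τ / 2`, which is the
  -- downward shift contained in `contract`.
  obtain ⟨η, hη, h⟩ := Metric.uniformContinuousOn_iff.1 huc (τ / 2) (by positivity)
  refine ⟨min η τ / 2, by positivity, by have := min_le_right η τ; linarith, ?_⟩
  set δ := min η τ / 2 with hδ
  have hδ0 : 0 < δ := by positivity
  have hδη : δ < η := by have := min_le_left η τ; linarith
  have hδ1 : δ < 1 := by have := min_le_right η τ; linarith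
  rintro p ⟨hp0, hp1, hp2⟩
  have hq : |(1 - δ) * p 0| < 1 := by
    rw [abs_mul, abs_of_pos (by linarith)]
    nlinarith [abs_nonneg (p 0)]
  refine ⟨hq, ?_, ?_⟩
  · simp only [contract, planePt_apply_one]
    nlinarith
  · simp only [contract, planePt_apply_one, planePt_apply_zero]
    have hd : dist ((1 - δ) * p 0) (p 0) < η := by
      rw [Real.dist_eq, show (1 - δ) * p 0 - p 0 = -(δ * p 0) by ring, abs_neg, abs_mul,
        abs_of_pos hδ0]
      nlinarith [abs_nonneg (p 0)]
    have := h _ (abs_le.1 hq.le) _ (abs_le.1 hp0) hd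
    rw [Real.dist_eq, abs_lt] at this
    have := roof_nonneg (p 0)
    nlinarith

/-- Parameters of contractions that tend to the identity. -/
theorem exists_contract_seq : ∃ δ τ : ℕ → ℝ, (∀ k, 0 < δ k ∧ δ k < τ k ∧ τ k < 1) ∧
    Tendsto δ atTop (𝓝 0) ∧ Tendsto τ atTop (𝓝 0) ∧
    ∀ k, ∀ p ∈ closedRegion, contract (δ k) (τ k) p ∈ openRegion := by
  have hτ : ∀ k : ℕ, (0 : ℝ) < 1 / (k + 2) ∧ (1 : ℝ) / (k + 2) < 1 := fun k => by
    refine ⟨by positivity, ?_⟩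
    rw [div_lt_one (by positivity)]
    linarith [(Nat.cast_nonneg k : (0 : ℝ) ≤ k)]
  choose δ h0 h1 h2 using fun k : ℕ => exists_contract_mem (hτ k).1 (hτ k).2
  have hlim : Tendsto (fun k : ℕ => (1 : ℝ) / (k + 2)) atTop (𝓝 0) :=
    tendsto_const_nhds.div_atTop (tendsto_atTop_add_const_right _ _ tendsto_natCast_atTop_atTop)
  exact ⟨δ, fun k => 1 / (k + 2), fun k => ⟨h0 k, h1 k, (hτ k).2⟩,
    squeeze_zero (fun k => (h0 k).le) (fun k => (h1 k).le) hlim, hlim, h2⟩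

theorem continuous_contract : Continuous fun z : (ℝ × ℝ) × Plane => contract z.1.1 z.1.2 z.2 := by
  unfold contract; fun_prop

@[simp] theorem contract_zero (p : Plane) : contract 0 0 p = p := by
  refine plane_ext ?_ ?_ <;> simp [contract]

/-- Each point of the closed region is the limit of its own contractions, which lie in the open
region. -/
theorem closure_openRegion : closure openRegion = closedRegion := by
  refine (closure_minimal openRegion_subset_closedRegion isClosed_closedRegion).antisymm
    fun p hp => ?_
  obtain ⟨δ, τ, -, hδ, hτ, h⟩ := exists_contract_seq
  refine mem_closure_of_tendsto (b := atTop) (f := fun k => contract (δ k) (τ k) p) ?_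
    (Eventually.of_forall fun k => h k p hp)
  have := (continuous_contract.tendsto ((0, 0), p)).comp
    ((hδ.prodMk_nhds hτ).prodMk_nhds (tendsto_const_nhds (x := p) (f := atTop)))
  simpa [Function.comp_def] using this

theorem rectangle_union_spikes_subset :
    (rectangle ∪ ⋃ n ∈ Ici (1 : ℕ), spike n) ⊆ closedRegion := by
  rintro p (hp | hp)
  · obtain ⟨h0, h1⟩ := hp
    exact ⟨(abs_lt.2 h0).le, h1.1.le, h1.2.le.trans (roof_nonneg _)⟩
  · obtain ⟨n, hn, hp1, hp⟩ := mem_iUnion₂.1 hp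
    have ht := (lt_tent_iff hp1.1.le).2 hp
    have hw : p 0 ∈ window n := mem_window_of_abs_le hn
      (((lt_tent_iff le_rfl).1 (hp1.1.trans ht)).le.trans (by simp))
    refine ⟨(abs_lt.2 (window_subset hn hw)).le, by linarith [hp1.1], ?_⟩
    rw [roof_eq_tent hn hw]
    exact ht.le

theorem openRegion_subset_closure :
    openRegion ⊆ closure (rectangle ∪ ⋃ n ∈ Ici (1 : ℕ), spike n) := by
  rintro p ⟨h0, h1, h2⟩
  rcases lt_trichotomy (p 1) 0 with h | h | h
  · exact subset_closure (Or.inl ⟨abs_lt.1 h0, h1, h⟩)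
  -- Points at height `0` below the roof lie neither in the open rectangle nor in an open spike;
  -- they are limits of points of the rectangle from below.
  · refine closure_mono subset_union_left ?_
    refine mem_closure_of_tendsto (b := 𝓝[<] (0 : ℝ)) (f := fun t => planePt (p 0) t) ?_ ?_
    · have : Continuous fun t => planePt (p 0) t := by fun_prop
      have := (this.tendsto 0).mono_left (nhdsWithin_le_nhds (s := Iio 0))
      rwa [← h, planePt_eta, h] at this
    · filter_upwards [Ioo_mem_nhdsLT (show (-1 : ℝ) < 0 by norm_num)] with t ht
      exact ⟨abs_lt.1 h0, ht⟩
  · obtain ⟨n, hn, hx, -⟩ := exists_mem_window_of_roof_ne_zero (x := p 0) (by linarith)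
    rw [roof_eq_tent hn hx] at h2
    refine subset_closure (Or.inr (mem_iUnion₂.2 ⟨n, hn, ⟨h, h2.trans_le (tent_le _ _)⟩, ?_⟩))
    exact (lt_tent_iff h.le).1 h2

/-- An interior point can be moved a little in each of the four coordinate directions within the
closed region; this makes every defining inequality strict. A vertical move does not change the
value of the roof. -/
theorem interior_closedRegion_subset : interior closedRegion ⊆ openRegion := by
  intro p hp
  have key : ∀ v : Plane, ∃ t : ℝ, 0 < t ∧ p + t • v ∈ closedRegion := by
    intro v
    have hc : Continuous fun t : ℝ => p + t • v := by fun_prop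
    have : ∀ᶠ t in 𝓝[>] (0 : ℝ), p + t • v ∈ closedRegion := by
      refine nhdsWithin_le_nhds ?_
      refine hc.continuousAt ?_
      simpa using mem_interior_iff_mem_nhds.1 hp
    obtain ⟨t, ht, h⟩ := (this.and self_mem_nhdsWithin).exists
    exact ⟨t, h, ht⟩
  obtain ⟨t1, ht1, h1, -⟩ := key (planePt 1 0)
  obtain ⟨t2, ht2, h2, -⟩ := key (planePt (-1) 0)
  obtain ⟨t3, ht3, -, -, h3⟩ := key (planePt 0 1)
  obtain ⟨t4, ht4, -, h4, -⟩ := key (planePt 0 (-1))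
  simp only [PiLp.add_apply, PiLp.smul_apply, planePt_apply_zero, planePt_apply_one, smul_eq_mul,
    mul_one, mul_zero, add_zero, mul_neg] at h1 h2 h3 h4
  rw [abs_le] at h1 h2
  refine ⟨abs_lt.2 ⟨by linarith, by linarith⟩, by linarith, by linarith⟩

theorem spikyDomain_eq : spikyDomain = openRegion := by
  have h : closure (rectangle ∪ ⋃ n ∈ Ici (1 : ℕ), spike n) = closedRegion := by
    refine (closure_minimal rectangle_union_spikes_subset isClosed_closedRegion).antisymm ?_
    rw [← closure_openRegion]
    exact closure_minimal openRegion_subset_closure isClosed_closure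
  rw [spikyDomain, h]
  exact interior_closedRegion_subset.antisymm
    (interior_maximal openRegion_subset_closedRegion isOpen_openRegion)

theorem frontier_openRegion : frontier openRegion = closedRegion \ openRegion := by
  rw [isOpen_openRegion.frontier_eq, closure_openRegion]

theorem isBounded_openRegion : Bornology.IsBounded openRegion :=
  isCompact_closedRegion.isBounded.subset openRegion_subset_closedRegion

/-- Rescaling every vertical fibre to `(0, 1)` shows that the domain is a continuous image of an
open rectangle. -/
theorem isConnected_openRegion : IsConnected openRegion := by
  have hc : IsConnected (Ioo (-1 : ℝ) 1 ×ˢ Ioo (0 : ℝ) 1) :=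
    (isConnected_Ioo (by norm_num)).prod (isConnected_Ioo (by norm_num))
  have hf : Continuous fun z : ℝ × ℝ => planePt z.1 (-1 + z.2 * (1 + roof z.1)) := by
    have := continuous_roof
    fun_prop
  convert hc.image _ hf.continuousOn
  ext p
  have hr := roof_nonneg (p 0)
  constructor
  · rintro ⟨h0, h1, h2⟩
    refine ⟨(p 0, (p 1 + 1) / (1 + roof (p 0))), ⟨abs_lt.1 h0, ?_, ?_⟩, ?_⟩
    · exact div_pos (by linarith) (by linarith)
    · rw [div_lt_one (by linarith)]; linarith
    · refine plane_ext rfl ?_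
      simp only [planePt_apply_one]
      rw [div_mul_cancel₀ _ (by linarith)]
      ring
  · rintro ⟨⟨x, t⟩, ⟨hx, ht0, ht1⟩, rfl⟩
    have hr := roof_nonneg x
    simp only at ht0 ht1
    refine ⟨abs_lt.2 hx, ?_, ?_⟩
    · simp only [planePt_apply_one]; nlinarith
    · simp only [planePt_apply_one, planePt_apply_zero]; nlinarith

end Geometry

/-! ### Boundary charts and length measure on segments -/

section Boundary

/-- Rotated Cartesian coordinates centred at `p`. -/
theorem exists_frame {c s : ℝ} (h : c ^ 2 + s ^ 2 = 1) (p : Plane) :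
    ∃ T : Plane ≃ᵃⁱ[ℝ] Plane, T p = 0 ∧ ∀ q,
      q 0 = p 0 + (c * T q 0 + s * T q 1) ∧ q 1 = p 1 + (c * T q 1 - s * T q 0) := by
  let L : Plane ≃ₗ[ℝ] Plane :=
    { toFun := fun q => planePt (c * q 0 - s * q 1) (s * q 0 + c * q 1)
      invFun := fun q => planePt (c * q 0 + s * q 1) (c * q 1 - s * q 0)
      map_add' := fun x y => plane_ext (by simp; ring) (by simp; ring)
      map_smul' := fun a x => plane_ext (by simp; ring) (by simp; ring)
      left_inv := fun q => plane_ext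
        (by simp only [planePt_apply_zero, planePt_apply_one]; linear_combination q 0 * h)
        (by simp only [planePt_apply_zero, planePt_apply_one]; linear_combination q 1 * h)
      right_inv := fun q => plane_ext
        (by simp only [planePt_apply_zero, planePt_apply_one]; linear_combination q 0 * h)
        (by simp only [planePt_apply_zero, planePt_apply_one]; linear_combination q 1 * h) }
  have hL : ∀ q, ‖L q‖ = ‖q‖ := fun q => by
    rw [← sq_eq_sq₀ (norm_nonneg _) (norm_nonneg _), plane_norm_sq, plane_norm_sq]
    change (c * q 0 - s * q 1) ^ 2 + (s * q 0 + c * q 1) ^ 2 = _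
    linear_combination (q 0 ^ 2 + q 1 ^ 2) * h
  let M : Plane ≃ₗᵢ[ℝ] Plane := ⟨L, hL⟩
  refine ⟨(AffineIsometryEquiv.constVAdd ℝ Plane (-p)).trans M.toAffineIsometryEquiv, ?_, ?_⟩
  · simp
  · intro q
    have h0 : ((AffineIsometryEquiv.constVAdd ℝ Plane (-p)).trans M.toAffineIsometryEquiv) q 0
        = c * (q 0 - p 0) - s * (q 1 - p 1) := by
      change c * (-p +ᵥ q) 0 - s * (-p +ᵥ q) 1 = _
      simp; ring
    have h1 : ((AffineIsometryEquiv.constVAdd ℝ Plane (-p)).trans M.toAffineIsometryEquiv) q 1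
        = s * (q 0 - p 0) + c * (q 1 - p 1) := by
      change s * (-p +ᵥ q) 0 + c * (-p +ᵥ q) 1 = _
      simp; ring
    rw [h0, h1]
    constructor
    · linear_combination (p 0 - q 0) * h
    · linear_combination (p 1 - q 1) * h

/-- At a corner the domain is locally a quarter plane, which a rotation puts below the graph of
`-|x|`. The sign `a` selects the right or left side, and `b` the top (`y = 0`) or the bottom (`y =
-1`). -/
theorem exists_corner_chart {p : Plane} {a b : ℝ} (ha : a = 1 ∨ a = -1) (hb : b = 1 ∨ b = -1)
    (h0 : p 0 = a) (h1 : p 1 = (b - 1) / 2) :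
    ∃ T : Plane ≃ᵃⁱ[ℝ] Plane, T p = 0 ∧ ∀ q, T q 0 ∈ Ioo (-(1 / 8) : ℝ) (1 / 8) →
      T q 1 ∈ Ioo (-(1 / 8) : ℝ) (1 / 8) →
      (q ∈ openRegion ↔ T q 1 < -|T q 0|) ∧ (q ∈ closedRegion ↔ T q 1 ≤ -|T q 0|) := by
  -- `k` is the cosine of 45 degrees.
  obtain ⟨k, hk0, hk⟩ : ∃ k : ℝ, 0 < k ∧ k ^ 2 = 1 / 2 :=
    ⟨√(1 / 2), by positivity, Real.sq_sqrt (by norm_num)⟩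
  have hk1 : k ≤ 1 := by nlinarith
  have hcs : (b * k) ^ 2 + (a * k) ^ 2 = 1 := by
    rcases ha with rfl | rfl <;> rcases hb with rfl | rfl <;> linear_combination 2 * hk
  obtain ⟨T, hT, hq⟩ := exists_frame hcs p
  refine ⟨T, hT, fun q hX hY => ?_⟩
  obtain ⟨e0, e1⟩ := hq q
  rw [h0] at e0
  rw [h1] at e1
  generalize T q 0 = X at *
  generalize T q 1 = Y at *
  have hX' : |k * X| < 1 / 8 := by
    rw [abs_mul, abs_of_pos hk0]
    have := abs_lt.2 hX
    nlinarith [abs_nonneg X]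
  have hY' : |k * Y| < 1 / 8 := by
    rw [abs_mul, abs_of_pos hk0]
    have := abs_lt.2 hY
    nlinarith [abs_nonneg Y]
  have hl : Y < -|X| ↔ k * Y < -|k * X| := by
    rw [abs_mul, abs_of_pos hk0, ← mul_neg, mul_lt_mul_iff_right₀ hk0]
  have hle : Y ≤ -|X| ↔ k * Y ≤ -|k * X| := by
    rw [abs_mul, abs_of_pos hk0, ← mul_neg, mul_le_mul_iff_right₀ hk0]
  rw [hl, hle]
  have e0' : q 0 = a + (b * (k * X) + a * (k * Y)) := by rw [e0]; ring
  have e1' : q 1 = (b - 1) / 2 + (b * (k * Y) - a * (k * X)) := by rw [e1]; ring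
  generalize k * X = x at *
  generalize k * Y = y at *
  rw [abs_lt] at hX' hY'
  have hroof : roof (q 0) = 0 := by
    refine roof_eq_zero ?_
    rw [e0', lt_abs]
    rcases ha with rfl | rfl
    · left; rcases hb with rfl | rfl <;> linarith
    · right; rcases hb with rfl | rfl <;> linarith
  change (|q 0| < 1 ∧ -1 < q 1 ∧ q 1 < roof (q 0) ↔ _) ∧
    (|q 0| ≤ 1 ∧ -1 ≤ q 1 ∧ q 1 ≤ roof (q 0) ↔ _)
  rw [hroof, e0', e1', lt_neg, le_neg, abs_lt, abs_lt, abs_le, abs_le]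
  rcases ha with rfl | rfl <;> rcases hb with rfl | rfl <;> constructor <;> constructor <;>
    intro h <;> (try obtain ⟨⟨_, _⟩, _, _⟩ := h) <;> (try obtain ⟨_, _⟩ := h) <;>
    refine ⟨?_, ?_⟩ <;> (try refine ⟨?_, ?_⟩) <;> linarith

theorem hasContinuousBoundary_openRegion : HasContinuousBoundary openRegion := by
  intro p hp
  rw [frontier_openRegion] at hp ⊢
  -- The frontier is the closed region minus the open one, so it suffices to describe these two by
  -- `<` and `≤` below the graph.
  suffices H : ∃ (T : Plane ≃ᵃⁱ[ℝ] Plane) (r s : ℝ) (h : ℝ → ℝ),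
      T p = 0 ∧ 0 < r ∧ 0 < s ∧ ContinuousOn h (Ioo (-r) r) ∧
      MapsTo h (Ioo (-r) r) (Ioo (-s) s) ∧ ∀ q : Plane, T q 0 ∈ Ioo (-r) r → T q 1 ∈ Ioo (-s) s →
        (q ∈ openRegion ↔ T q 1 < h (T q 0)) ∧ (q ∈ closedRegion ↔ T q 1 ≤ h (T q 0)) by
    obtain ⟨T, r, s, h, h1, h2, h3, h4, h5, h6⟩ := H
    refine ⟨T, r, s, h, h1, h2, h3, h4, h5, fun q hq0 hq1 => ?_⟩
    obtain ⟨ho, hc⟩ := h6 q hq0 hq1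
    refine ⟨ho, ?_⟩
    rw [Set.mem_sdiff, ho, hc, not_lt]
    exact ⟨fun h => le_antisymm h.1 h.2, fun h => ⟨h.le, h.ge⟩⟩
  obtain ⟨⟨h0, h1, h2⟩, hno⟩ := hp
  rcases h0.lt_or_eq with h0 | h0
  · rcases h1.lt_or_eq with h1 | h1
    · have h2 : p 1 = roof (p 0) := le_antisymm h2 (not_lt.1 fun h => hno ⟨h0, h1, h⟩)
      -- Points on the graph of the roof need no rotation. The radius keeps away from the vertical
      -- sides; the half-height `1/2` exceeds the oscillation of the roof and stays above the
      -- bottom.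
      obtain ⟨T, hT, hq⟩ := exists_frame (c := 1) (s := 0) (by norm_num) p
      refine ⟨T, 1 - |p 0|, 1 / 2, fun x => roof (p 0 + x) - roof (p 0), hT, by linarith,
        by norm_num, ?_, ?_, ?_⟩
      · exact ((continuous_roof.comp (by fun_prop)).sub continuous_const).continuousOn
      · intro x _
        have := roof_le (p 0 + x)
        have := roof_nonneg (p 0 + x)
        have := roof_le (p 0)
        have := roof_nonneg (p 0)
        constructor <;> linarith
      · intro q hX hY
        obtain ⟨e0, e1⟩ := hq q
        simp only [one_mul, zero_mul, add_zero, sub_zero] at e0 e1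
        have hq0 : |q 0| < 1 := by
          rw [e0]
          exact (abs_add_le _ _).trans_lt (by linarith [abs_lt.2 hX])
        have hq1 : -1 < q 1 := by
          rw [e1, h2]
          linarith [hY.1, roof_nonneg (p 0)]
        have e2 : roof (p 0 + T q 0) = roof (q 0) := by rw [e0]
        beta_reduce
        rw [e2]
        constructor
        · exact ⟨fun h => by linarith [h.2.2], fun h => ⟨hq0, hq1, by linarith⟩⟩
        · exact ⟨fun h => by linarith [h.2.2], fun h => ⟨hq0.le, hq1.le, by linarith⟩⟩
    -- On the bottom side a half-turn puts the domain below the graph.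
    · obtain ⟨T, hT, hq⟩ := exists_frame (c := -1) (s := 0) (by norm_num) p
      refine ⟨T, 1 - |p 0|, 1, fun _ => 0, hT, by linarith, one_pos, continuousOn_const,
        fun x _ => by simp, ?_⟩
      intro q hX hY
      obtain ⟨e0, e1⟩ := hq q
      have hq0 : |q 0| < 1 := by
        rw [e0]
        refine (abs_add_le _ _).trans_lt ?_
        have := abs_lt.2 hX
        simp only [neg_mul, one_mul, zero_mul, add_zero, abs_neg]
        linarith
      have hr := roof_nonneg (q 0)
      have := hY.1
      constructor
      · exact ⟨fun h => by linarith [h.2.1], fun h => ⟨hq0, by linarith, by linarith⟩⟩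
      · exact ⟨fun h => by linarith [h.2.1], fun h => ⟨hq0.le, by linarith, by linarith⟩⟩
  · obtain ⟨a, ha, ha'⟩ : ∃ a : ℝ, (a = 1 ∨ a = -1) ∧ p 0 = a :=
      ⟨p 0, eq_or_eq_neg_of_abs_eq h0, rfl⟩
    have hr : roof (p 0) = 0 := roof_eq_zero (by rw [h0]; norm_num)
    rw [hr] at h2
    have hcorner : ∀ b : ℝ, (b = 1 ∨ b = -1) → p 1 = (b - 1) / 2 →
        ∃ (T : Plane ≃ᵃⁱ[ℝ] Plane) (r s : ℝ) (h : ℝ → ℝ),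
        T p = 0 ∧ 0 < r ∧ 0 < s ∧ ContinuousOn h (Ioo (-r) r) ∧
        MapsTo h (Ioo (-r) r) (Ioo (-s) s) ∧ ∀ q : Plane, T q 0 ∈ Ioo (-r) r →
          T q 1 ∈ Ioo (-s) s → (q ∈ openRegion ↔ T q 1 < h (T q 0)) ∧
            (q ∈ closedRegion ↔ T q 1 ≤ h (T q 0)) := by
      intro b hb hb'
      obtain ⟨T, hT, h⟩ := exists_corner_chart ha hb ha' hb'
      refine ⟨T, 1 / 8, 1 / 8, fun x => -|x|, hT, by norm_num, by norm_num, by fun_prop, ?_, h⟩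
      intro x hx
      have := abs_lt.2 hx
      constructor
      · linarith
      · linarith [abs_nonneg x]
    rcases h1.lt_or_eq with h1 | h1
    · rcases h2.lt_or_eq with h2 | h2
      -- On the vertical sides a quarter-turn is used; the radius stays away from both corners.
      · obtain ⟨T, hT, hq⟩ := exists_frame (c := 0) (s := a)
          (by rcases ha with rfl | rfl <;> norm_num) p
        refine ⟨T, min (p 1 + 1) (-p 1), 1, fun _ => 0, hT, lt_min (by linarith) (by linarith),
          one_pos, continuousOn_const, fun x _ => by simp, ?_⟩
        intro q hX hY
        obtain ⟨e0, e1⟩ := hq q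
        simp only [zero_mul, zero_add, zero_sub] at e0 e1
        have hX1 := abs_lt.2 hX
        have m1 := min_le_left (p 1 + 1) (-p 1)
        have m2 := min_le_right (p 1 + 1) (-p 1)
        have hX2 : |a * T q 0| = |T q 0| := by
          rcases ha with rfl | rfl <;> simp
        have hX3 := abs_lt.1 ((hX2.trans_lt hX1).trans_le m1)
        have hX4 := abs_lt.1 ((hX2.trans_lt hX1).trans_le m2)
        have hq0 : |q 0| = 1 + T q 1 := by
          have : 0 < 1 + T q 1 := by linarith [hY.1]
          rw [e0, ha', show a + a * T q 1 = a * (1 + T q 1) by ring, abs_mul, abs_of_pos this]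
          rcases ha with rfl | rfl <;> simp
        have hr := roof_nonneg (q 0)
        constructor
        · exact ⟨fun h => by linarith [h.1], fun h => ⟨by linarith, by linarith, by linarith⟩⟩
        · exact ⟨fun h => by linarith [h.1], fun h => ⟨by linarith, by linarith, by linarith⟩⟩
      · exact hcorner 1 (Or.inl rfl) (by rw [h2]; norm_num)
    · exact hcorner (-1) (Or.inr rfl) (by rw [← h1]; norm_num)

/-! ### Hausdorff measure on lines -/

theorem measurableEmbedding_line (p : Plane) {d : Plane} (hd : d ≠ 0) :
    MeasurableEmbedding fun t : ℝ => p + t • d := by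
  refine Continuous.measurableEmbedding (by fun_prop) fun s t h => ?_
  exact smul_left_injective ℝ hd (add_left_cancel h)

/-- The parametrisation with unit speed is an isometry, which carries Lebesgue measure to Hausdorff
measure on its range; passing to speed `‖d‖` scales by that factor. -/
theorem map_line_volume (p : Plane) {d : Plane} (hd : d ≠ 0) :
    (ENNReal.ofReal ‖d‖) • Measure.map (fun t : ℝ => p + t • d) volume
      = (μH[1]).restrict (range fun t : ℝ => p + t • d) := by
  have hd' : ‖d‖ ≠ 0 := norm_ne_zero_iff.2 hd
  have hγ : Isometry fun t : ℝ => p + t • (‖d‖⁻¹ • d) := by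
    refine Isometry.of_dist_eq fun s t => ?_
    rw [dist_add_left, dist_eq_norm, ← sub_smul, norm_smul, norm_smul, norm_inv, norm_norm,
      inv_mul_cancel₀ hd', mul_one, Real.dist_eq, Real.norm_eq_abs]
  have hcomp : (fun t : ℝ => p + t • d) = (fun t : ℝ => p + t • (‖d‖⁻¹ • d)) ∘ (· * ‖d‖) := by
    ext1 t
    simp only [Function.comp_apply, smul_smul]
    rw [mul_assoc, mul_inv_cancel₀ hd', mul_one]
  have hrange : range (fun t : ℝ => p + t • d) = range fun t : ℝ => p + t • (‖d‖⁻¹ • d) := by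
    rw [hcomp]
    exact (mul_right_surjective₀ hd').range_comp _
  rw [hrange, ← hγ.map_hausdorffMeasure (Or.inl zero_le_one), hausdorffMeasure_real, hcomp,
    ← Measure.map_map hγ.continuous.measurable (measurable_mul_const _), ← Measure.map_smul]
  congr 1
  rw [Real.map_volume_mul_right hd', smul_smul, abs_inv, abs_norm,
    ← ENNReal.ofReal_mul (norm_nonneg _), mul_inv_cancel₀ hd', ENNReal.ofReal_one, one_smul]

/-- The parametrisation is a measurable embedding, so neither `E` nor `F` has to be measurable. -/
theorem lintegral_hausdorff_line (p : Plane) {d : Plane} (hd : d ≠ 0) (E : Set ℝ)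
    (F : Plane → ENNReal) :
    ∫⁻ x in (fun t : ℝ => p + t • d) '' E, F x ∂μH[1]
      = ENNReal.ofReal ‖d‖ * ∫⁻ t in E, F (p + t • d) := by
  have hm := measurableEmbedding_line p hd
  have h1 : (μH[1]).restrict ((fun t : ℝ => p + t • d) '' E)
      = (ENNReal.ofReal ‖d‖) • Measure.map (fun t : ℝ => p + t • d) (volume.restrict E) := by
    have : E = (fun t : ℝ => p + t • d) ⁻¹' ((fun t : ℝ => p + t • d) '' E) :=
      (hm.injective.preimage_image E).symm
    conv_rhs => rw [this, ← hm.restrict_map, ← Measure.restrict_smul, map_line_volume p hd]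
    rw [Measure.restrict_restrict_of_subset (image_subset_range _ _)]
  rw [h1, lintegral_smul_measure, hm.lintegral_map, smul_eq_mul]

end Boundary

/-! ### Covering the boundary by segments; finite length -/

section BoundaryCover

theorem lintegral_hausdorff_vertical (c : ℝ) (E : Set ℝ) (F : Plane → ENNReal) :
    ∫⁻ x in (fun t : ℝ => planePt c t) '' E, F x ∂μH[1] = ∫⁻ t in E, F (planePt c t) := by
  have hd : ‖planePt 0 1‖ = 1 := by
    rw [← sq_eq_sq₀ (norm_nonneg _) zero_le_one, plane_norm_sq]; simp
  have h := lintegral_hausdorff_line (planePt c 0) (d := planePt 0 1)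
    (norm_ne_zero_iff.1 (by rw [hd]; exact one_ne_zero)) E F
  have e : ∀ t : ℝ, planePt c 0 + t • planePt 0 1 = planePt c t := fun t =>
    plane_ext (by simp) (by simp)
  simpa [e, hd] using h

theorem lintegral_hausdorff_graph {g : ℝ → ℝ} {α β : ℝ} {E : Set ℝ} (hE : MeasurableSet E)
    (hg : ∀ x ∈ E, g x = α + β * x) (F : Plane → ENNReal) :
    ∫⁻ p in (fun x => planePt x (g x)) '' E, F p ∂μH[1]
      = ENNReal.ofReal √(1 + β ^ 2) * ∫⁻ x in E, F (planePt x (g x)) := by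
  have hd : ‖planePt 1 β‖ = √(1 + β ^ 2) := by
    rw [eq_comm, Real.sqrt_eq_iff_mul_self_eq (by positivity) (norm_nonneg _), ← sq,
      plane_norm_sq]
    simp
  have hne : planePt 1 β ≠ 0 := fun h => by
    simpa using congrArg (fun p : Plane => p 0) h
  have e : ∀ x ∈ E, planePt x (g x) = planePt 0 α + x • planePt 1 β := fun x hx =>
    plane_ext (by simp) (by simp [hg x hx, mul_comm])
  rw [image_congr e, lintegral_hausdorff_line _ hne, hd]
  congr 1
  exact setLIntegral_congr_fun hE fun x hx => by rw [e x hx]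

theorem lintegral_hausdorff_horizontal (c : ℝ) {E : Set ℝ} (hE : MeasurableSet E)
    (F : Plane → ENNReal) :
    ∫⁻ x in (fun t : ℝ => planePt t c) '' E, F x ∂μH[1] = ∫⁻ t in E, F (planePt t c) := by
  simpa using lintegral_hausdorff_graph (g := fun _ => c) (α := c) (β := 0) hE (by simp) F

theorem tent_eq {n : ℕ} {x : ℝ} (h : |x - 1 / 2 ^ n| ≤ spikeHeight n ^ 2) :
    tent n x = spikeHeight n - |x - 1 / 2 ^ n| / spikeHeight n := by
  refine max_eq_right (sub_nonneg.2 ?_)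
  rw [div_le_iff₀ (spikeHeight_pos n), ← sq]
  exact h

/-- The length of the graph of the `n`-th tent per unit length of the base. -/
noncomputable def sideFactor (n : ℕ) : ℝ := √(1 + (1 / spikeHeight n) ^ 2)

theorem le_sideFactor (n : ℕ) : 1 / spikeHeight n ≤ sideFactor n :=
  Real.le_sqrt_of_sq_le (by linarith)

/-- The slope `1 / a` is at least `1`, so the length factor has the same order as the slope. This
bound serves the trace inequality; `le_sideFactor` serves the lower bound for the traces of the
spike functions. -/
theorem sideFactor_le {n : ℕ} (hn : 1 ≤ n) : sideFactor n ≤ 2 / spikeHeight n := by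
  have h := spikeHeight_pos n
  refine Real.sqrt_le_iff.2 ⟨by positivity, ?_⟩
  have : 1 ≤ 1 / spikeHeight n := by
    rw [le_div_iff₀ h]; linarith [spikeHeight_le hn]
  rw [show (2 : ℝ) / spikeHeight n = 2 * (1 / spikeHeight n) by ring]
  nlinarith

theorem lintegral_spike_right (n : ℕ) {E : Set ℝ} (hE : MeasurableSet E)
    (hsub : E ⊆ Icc (1 / 2 ^ n) (1 / 2 ^ n + spikeHeight n ^ 2)) (F : Plane → ENNReal) :
    ∫⁻ p in (fun x => planePt x (tent n x)) '' E, F p ∂μH[1]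
      = ENNReal.ofReal (sideFactor n) * ∫⁻ x in E, F (planePt x (tent n x)) := by
  rw [lintegral_hausdorff_graph (α := spikeHeight n + 1 / 2 ^ n / spikeHeight n)
    (β := -(1 / spikeHeight n)) hE, neg_sq, sideFactor]
  intro x hx
  have h1 := hsub hx
  have h2 : |x - 1 / 2 ^ n| = x - 1 / 2 ^ n := abs_of_nonneg (by linarith [h1.1])
  rw [tent_eq (by rw [h2]; linarith [h1.2]), h2]
  ring

theorem lintegral_spike_left (n : ℕ) {E : Set ℝ} (hE : MeasurableSet E)
    (hsub : E ⊆ Icc (1 / 2 ^ n - spikeHeight n ^ 2) (1 / 2 ^ n)) (F : Plane → ENNReal) :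
    ∫⁻ p in (fun x => planePt x (tent n x)) '' E, F p ∂μH[1]
      = ENNReal.ofReal (sideFactor n) * ∫⁻ x in E, F (planePt x (tent n x)) := by
  rw [lintegral_hausdorff_graph (α := spikeHeight n - 1 / 2 ^ n / spikeHeight n)
    (β := 1 / spikeHeight n) hE, sideFactor]
  intro x hx
  have h1 := hsub hx
  have h2 : |x - 1 / 2 ^ n| = -(x - 1 / 2 ^ n) := abs_of_nonpos (by linarith [h1.2])
  rw [tent_eq (by rw [h2]; linarith [h1.1]), h2]
  ring

/-- The base of the `n`-th spike. -/
def spikeBase (n : ℕ) : Set ℝ :=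
  Icc (1 / 2 ^ n - spikeHeight n ^ 2) (1 / 2 ^ n + spikeHeight n ^ 2)

theorem mem_spikeBase {n : ℕ} {x : ℝ} : x ∈ spikeBase n ↔ |x - 1 / 2 ^ n| ≤ spikeHeight n ^ 2 := by
  rw [spikeBase, mem_Icc, abs_le]
  constructor <;> rintro ⟨h1, h2⟩ <;> constructor <;> linarith

theorem measurableSet_spikeBase (n : ℕ) : MeasurableSet (spikeBase n) := measurableSet_Icc

theorem spikeBase_subset_window {n : ℕ} (hn : 1 ≤ n) : spikeBase n ⊆ window n := fun _ hx =>
  mem_window_of_abs_le hn (mem_spikeBase.1 hx)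

theorem volume_spikeBase (n : ℕ) :
    volume (spikeBase n) = ENNReal.ofReal (2 * spikeHeight n ^ 2) := by
  rw [spikeBase, Real.volume_Icc]
  congr 1
  ring

/-- The two sides of the `n`-th spike. -/
def spikeSides (n : ℕ) : Set Plane := (fun x => planePt x (tent n x)) '' spikeBase n

/-- The base is cut at its centre, below the kink of the tent, so that the graph is affine over each
piece. -/
theorem lintegral_spikeSides_le {n : ℕ} (hn : 1 ≤ n) (F : Plane → ENNReal) :
    ∫⁻ p in spikeSides n, F p ∂μH[1]
      ≤ ENNReal.ofReal (2 / spikeHeight n) * ∫⁻ x in spikeBase n, F (planePt x (tent n x)) := by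
  have h := sq_nonneg (spikeHeight n)
  have hu : spikeBase n = Ico (1 / 2 ^ n - spikeHeight n ^ 2) (1 / 2 ^ n) ∪
      Icc (1 / 2 ^ n) (1 / 2 ^ n + spikeHeight n ^ 2) :=
    (Ico_union_Icc_eq_Icc (by linarith) (by linarith)).symm
  have hdisj : Disjoint (Ico (1 / 2 ^ n - spikeHeight n ^ 2) (1 / 2 ^ n))
      (Icc (1 / 2 ^ n : ℝ) (1 / 2 ^ n + spikeHeight n ^ 2)) :=
    Set.disjoint_left.2 fun x hx hx' => hx.2.not_ge hx'.1
  rw [spikeSides, hu, image_union, lintegral_union measurableSet_Icc hdisj]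
  refine (lintegral_union_le _ _ _).trans ?_
  rw [lintegral_spike_left n measurableSet_Ico Ico_subset_Icc_self,
    lintegral_spike_right n measurableSet_Icc subset_rfl, ← mul_add]
  gcongr
  exact sideFactor_le hn

/-- A countable family of segments that covers the boundary. -/
theorem frontier_openRegion_subset : frontier openRegion ⊆
    ((fun x => planePt x (-1)) '' Icc (-1) 1 ∪ (fun x => planePt x 0) '' Icc (-1) 1) ∪
    ((fun y => planePt (-1) y) '' Icc (-1) 0 ∪ (fun y => planePt 1 y) '' Icc (-1) 0) ∪
    ⋃ n : ℕ, spikeSides (n + 1) := by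
  rw [frontier_openRegion]
  rintro p ⟨⟨h0, h1, h2⟩, hno⟩
  rcases h0.lt_or_eq with h0' | h0'
  · rcases h1.lt_or_eq with h1 | h1
    · have h2 : p 1 = roof (p 0) := le_antisymm h2 (not_lt.1 fun h => hno ⟨h0', h1, h⟩)
      by_cases hr : roof (p 0) = 0
      · exact Or.inl (Or.inl (Or.inr ⟨p 0, abs_le.1 h0, plane_ext rfl (by simp [h2, hr])⟩))
      · obtain ⟨n, hn, hw, hx⟩ := exists_mem_window_of_roof_ne_zero hr
        obtain ⟨m, rfl⟩ := Nat.exists_eq_add_of_le' hn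
        refine Or.inr (mem_iUnion.2 ⟨m, p 0, mem_spikeBase.2 hx.le, plane_ext rfl ?_⟩)
        simp [h2, roof_eq_tent hn hw]
    · exact Or.inl (Or.inl (Or.inl ⟨p 0, abs_le.1 h0, plane_ext rfl (by simp [h1])⟩))
  · rw [roof_eq_zero (by rw [h0']; norm_num)] at h2
    rcases eq_or_eq_neg_of_abs_eq h0' with h | h
    · exact Or.inl (Or.inr (Or.inr ⟨p 1, ⟨h1, h2⟩, plane_ext (by simp [h]) rfl⟩))
    · exact Or.inl (Or.inr (Or.inl ⟨p 1, ⟨h1, h2⟩, plane_ext (by simp [h]) rfl⟩))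

/-- This reduces boundary integrals to integrals in one variable; `F = 1` yields the finite length
and `F = |v|²` the trace inequality. The cover uses all of the segment `y = 0`, including the bases
of the spikes, which is harmless for an upper bound. -/
theorem lintegral_frontier_le (F : Plane → ENNReal) :
    ∫⁻ p in frontier openRegion, F p ∂μH[1] ≤
      ((∫⁻ x in Icc (-1) 1, F (planePt x (-1))) + ∫⁻ x in Icc (-1) 1, F (planePt x 0)) +
      ((∫⁻ y in Icc (-1) 0, F (planePt (-1) y)) + ∫⁻ y in Icc (-1) 0, F (planePt 1 y)) +
      ∑' n : ℕ, ENNReal.ofReal (2 / spikeHeight (n + 1)) *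
        ∫⁻ x in spikeBase (n + 1), F (planePt x (tent (n + 1) x)) := by
  refine (lintegral_mono_set frontier_openRegion_subset).trans ?_
  refine (lintegral_union_le _ _ _).trans (add_le_add ?_ ?_)
  · refine (lintegral_union_le _ _ _).trans (add_le_add ?_ ?_)
    · refine (lintegral_union_le _ _ _).trans (add_le_add ?_ ?_)
      · rw [lintegral_hausdorff_horizontal _ measurableSet_Icc]
      · rw [lintegral_hausdorff_horizontal _ measurableSet_Icc]
    · refine (lintegral_union_le _ _ _).trans (add_le_add ?_ ?_)
      · rw [lintegral_hausdorff_vertical]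
      · rw [lintegral_hausdorff_vertical]
  · exact (lintegral_iUnion_le _ _).trans
      (ENNReal.tsum_le_tsum fun n => lintegral_spikeSides_le (by omega) F)

theorem hausdorffMeasure_frontier_lt_top : μH[1] (frontier openRegion) < ⊤ := by
  have h := lintegral_frontier_le fun _ => 1
  simp only [setLIntegral_one, Real.volume_Icc, volume_spikeBase] at h
  refine h.trans_lt (ENNReal.add_lt_top.2 ⟨by simp [← ENNReal.ofReal_add], ?_⟩)
  -- Length factor times width of the base: `(2 / a) * (2 * a ^ 2) = 4 * a`, which is summable.
  have e : ∀ n : ℕ, ENNReal.ofReal (2 / spikeHeight (n + 1)) *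
      ENNReal.ofReal (2 * spikeHeight (n + 1) ^ 2) = ENNReal.ofReal (4 * spikeHeight (n + 1)) := by
    intro n
    have h := spikeHeight_pos (n + 1)
    rw [← ENNReal.ofReal_mul (by positivity)]
    congr 1
    field_simp
    ring
  simp_rw [e]
  rw [← ENNReal.ofReal_tsum_of_nonneg (fun n => by have := spikeHeight_pos (n + 1); positivity)
    (((summable_nat_add_iff 1).2 summable_spikeHeight).mul_left 4)]
  exact ENNReal.ofReal_lt_top

end BoundaryCover

/-! ### Elementary inequalities for square integrals -/

section SquareIntegrals

theorem ennreal_add_sq_le (a b : ENNReal) : (a + b) ^ 2 ≤ 2 * (a ^ 2 + b ^ 2) := by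
  rcases eq_or_ne a ⊤ with rfl | ha
  · simp
  rcases eq_or_ne b ⊤ with rfl | hb
  · simp
  lift a to NNReal using ha
  lift b to NNReal using hb
  have h : (a + b) ^ 2 ≤ 2 * (a ^ 2 + b ^ 2) := add_sq_le
  exact_mod_cast h

theorem enorm_add_sq_le {E : Type*} [NormedAddCommGroup E] (x y : E) :
    ‖x + y‖ₑ ^ 2 ≤ 2 * (‖x‖ₑ ^ 2 + ‖y‖ₑ ^ 2) :=
  (pow_le_pow_left' (enorm_add_le x y) 2).trans (ennreal_add_sq_le _ _)

theorem enorm_sub_sq_le {E : Type*} [NormedAddCommGroup E] (x y : E) :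
    ‖x - y‖ₑ ^ 2 ≤ 2 * (‖x‖ₑ ^ 2 + ‖y‖ₑ ^ 2) :=
  (pow_le_pow_left' (enorm_sub_le (a := x) (b := y)) 2).trans (ennreal_add_sq_le _ _)

theorem eLpNorm_two_sq {α E : Type*} [MeasurableSpace α] [NormedAddCommGroup E] (μ : Measure α)
    (f : α → E) : eLpNorm f 2 μ ^ 2 = ∫⁻ x, ‖f x‖ₑ ^ 2 ∂μ := by
  have := eLpNorm_nnreal_pow_eq_lintegral (μ := μ) (f := f) (p := 2) (by norm_num)
  simpa using this

theorem sq_lintegral_le {α : Type*} [MeasurableSpace α] (μ : Measure α) {g : α → ENNReal}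
    (hg : AEMeasurable g μ) : (∫⁻ x, g x ∂μ) ^ 2 ≤ μ univ * ∫⁻ x, g x ^ 2 ∂μ := by
  have h := ENNReal.lintegral_mul_le_Lp_mul_Lq μ Real.HolderConjugate.two_two hg
    (aemeasurable_const (b := (1 : ENNReal)))
  simp only [Pi.mul_apply, mul_one, ENNReal.rpow_two, one_pow, lintegral_one] at h
  calc (∫⁻ x, g x ∂μ) ^ 2 ≤ ((∫⁻ x, g x ^ 2 ∂μ) ^ (1 / 2 : ℝ) * μ univ ^ (1 / 2 : ℝ)) ^ 2 := by
        gcongr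
    _ = μ univ * ∫⁻ x, g x ^ 2 ∂μ := by
        rw [mul_pow, ← ENNReal.rpow_natCast, ← ENNReal.rpow_natCast, ← ENNReal.rpow_mul,
          ← ENNReal.rpow_mul]
        norm_num
        rw [mul_comm]

/-- Cauchy–Schwarz against the constant `1` for the probability measure with density `w`; it is
applied with `w` a mollifying kernel. -/
theorem sq_lintegral_mul_le {α : Type*} [MeasurableSpace α] (μ : Measure α) {w g : α → ENNReal}
    (hw : Measurable w) (hg : Measurable g) (h1 : ∫⁻ x, w x ∂μ = 1) :
    (∫⁻ x, w x * g x ∂μ) ^ 2 ≤ ∫⁻ x, w x * g x ^ 2 ∂μ := by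
  have h := sq_lintegral_le (μ.withDensity w) hg.aemeasurable
  rwa [lintegral_withDensity_eq_lintegral_mul _ hw hg,
    lintegral_withDensity_eq_lintegral_mul _ hw (hg.pow_const 2), withDensity_apply _ .univ,
    Measure.restrict_univ, h1, one_mul] at h

end SquareIntegrals

/-! ### Continuity in `L₂` under contractions and translations -/

section AffineContinuity

theorem contract_sub (δ τ : ℝ) (t p : Plane) : contract δ τ p - t =
    Matrix.toEuclideanLin (Matrix.diagonal ![1 - δ, 1 - τ]) p + (planePt 0 (-(τ / 2)) - t) := by
  refine plane_ext ?_ ?_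
  · simp [contract, Matrix.toLpLin_apply]; ring
  · simp [contract, Matrix.toLpLin_apply]; ring

theorem map_contract_sub {δ τ : ℝ} (hδ : δ < 1) (hτ : τ < 1) (t : Plane) :
    Measure.map (fun p => contract δ τ p - t) volume
      = ENNReal.ofReal (((1 - δ) * (1 - τ))⁻¹) • volume := by
  have hdet : LinearMap.det (Matrix.toEuclideanLin (Matrix.diagonal ![1 - δ, 1 - τ]))
      = (1 - δ) * (1 - τ) := by
    change LinearMap.det (Matrix.toLpLin 2 2 _) = _
    rw [Matrix.toLpLin_eq_toLin, LinearMap.det_toLin, Matrix.det_diagonal]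
    simp
  have hpos : 0 < (1 - δ) * (1 - τ) := mul_pos (by linarith) (by linarith)
  have hlin := Measure.map_linearMap_addHaar_eq_smul_addHaar (volume : Measure Plane)
    (f := Matrix.toEuclideanLin (Matrix.diagonal ![1 - δ, 1 - τ])) (by rw [hdet]; exact hpos.ne')
  have hc : Continuous (Matrix.toEuclideanLin (Matrix.diagonal ![1 - δ, 1 - τ])) :=
    LinearMap.continuous_of_finiteDimensional _
  rw [show (fun p => contract δ τ p - t) = (fun q => q + (planePt 0 (-(τ / 2)) - t)) ∘
      (Matrix.toEuclideanLin (Matrix.diagonal ![1 - δ, 1 - τ])) from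
      funext fun p => contract_sub δ τ t p,
    ← Measure.map_map (measurable_add_const _) hc.measurable, hlin, Measure.map_smul,
    map_add_right_eq_self, hdet, abs_of_pos (inv_pos.2 hpos)]

theorem measurable_contract_sub (δ τ : ℝ) (t : Plane) :
    Measurable fun p => contract δ τ p - t := by
  have : Continuous fun p => contract δ τ p - t := by unfold contract; fun_prop
  exact this.measurable

/-- The Jacobian factor `1 / ((1 - δ) (1 - τ))` is at most `4` when both parameters are at most
`1/2`. -/
theorem lintegral_contract_sub_le {δ τ : ℝ} (hδ : δ ≤ 1 / 2) (hτ : τ ≤ 1 / 2) (t : Plane)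
    {g : Plane → ENNReal} (hg : Measurable g) :
    ∫⁻ p, g (contract δ τ p - t) ≤ 4 * ∫⁻ p, g p := by
  rw [← lintegral_map hg (measurable_contract_sub δ τ t),
    map_contract_sub (by linarith) (by linarith), lintegral_smul_measure, smul_eq_mul]
  gcongr
  rw [← ENNReal.ofReal_ofNat]
  refine ENNReal.ofReal_le_ofReal ?_
  rw [inv_le_comm₀ (mul_pos (by linarith) (by linarith)) (by norm_num)]
  nlinarith

/-- Continuity in `L₂` of the composition with affine maps, for compactly supported continuous
functions. -/
theorem tendsto_lintegral_contract_of_continuous {G : Plane → ℝ} (hG : Continuous G)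
    (hc : HasCompactSupport G) :
    Tendsto (fun z : (ℝ × ℝ) × Plane =>
      ∫⁻ p, ‖G (contract z.1.1 z.1.2 p - z.2) - G p‖ₑ ^ 2) (𝓝 0) (𝓝 0) := by
  obtain ⟨M, hM⟩ := hc.exists_bound_of_continuous hG
  obtain ⟨R, hR0, hR⟩ : ∃ R : ℝ, 0 < R ∧ tsupport G ⊆ Metric.ball 0 R :=
    hc.isBounded.subset_ball_lt 0 0
  have hz : ∀ᶠ z : (ℝ × ℝ) × Plane in 𝓝 0, z.1.1 ≤ 1 / 2 ∧ |z.1.2| ≤ 1 / 2 ∧ ‖z.2‖ ≤ 1 := by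
    have h1 : Continuous fun z : (ℝ × ℝ) × Plane => z.1.1 := by fun_prop
    have h2 : Continuous fun z : (ℝ × ℝ) × Plane => |z.1.2| := by fun_prop
    have h3 : Continuous fun z : (ℝ × ℝ) × Plane => ‖z.2‖ := by fun_prop
    have e1 := h1.tendsto 0
    have e2 := h2.tendsto 0
    have e3 := h3.tendsto 0
    simp only [Prod.fst_zero, Prod.snd_zero, abs_zero, norm_zero] at e1 e2 e3
    filter_upwards [e1.eventually_le_const (show (0 : ℝ) < 1 / 2 by norm_num),
      e2.eventually_le_const (show (0 : ℝ) < 1 / 2 by norm_num),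
      e3.eventually_le_const one_pos] with z a b c using ⟨a, b, c⟩
  have hzero : ∀ q : Plane, R ≤ ‖q‖ → G q = 0 := fun q hq => by
    by_contra h
    have := hR (subset_tsupport _ h)
    rw [mem_ball_zero_iff] at this
    linarith
  have hlim := tendsto_lintegral_filter_of_dominated_convergence (μ := (volume : Measure Plane))
    (l := 𝓝 (0 : (ℝ × ℝ) × Plane))
    (F := fun z p => ‖G (contract z.1.1 z.1.2 p - z.2) - G p‖ₑ ^ 2) (f := fun _ => 0)
    -- If the transformed point lies in the ball of radius `R`, then `|p 0| ≤ 2 (R + 1)` and `|p 1|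
    -- ≤ 2 (R + 2)`, because the contraction factors are at least `1/2`. Outside the ball of radius
    -- `4 (R + 2)` both terms therefore vanish.
    ((Metric.closedBall (0 : Plane) (4 * (R + 2))).indicator
      fun _ => ENNReal.ofReal (2 * M) ^ 2) ?_ ?_ ?_ ?_
  · simpa using hlim
  · refine Eventually.of_forall fun z => ?_
    have : Continuous fun p => G (contract z.1.1 z.1.2 p - z.2) - G p := by
      unfold contract; fun_prop
    exact ((ENNReal.continuous_pow 2).comp this.enorm).measurable
  · filter_upwards [hz] with z hz
    refine Eventually.of_forall fun p => ?_
    by_cases hp : p ∈ Metric.closedBall (0 : Plane) (4 * (R + 2))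
    · rw [indicator_of_mem hp]
      gcongr
      rw [← ofReal_norm]
      refine ENNReal.ofReal_le_ofReal ((norm_sub_le _ _).trans ?_)
      linarith [hM (contract z.1.1 z.1.2 p - z.2), hM p]
    · rw [indicator_of_notMem hp]
      rw [mem_closedBall_zero_iff, not_le] at hp
      have h1 : G p = 0 := hzero p (by linarith)
      have h2 : G (contract z.1.1 z.1.2 p - z.2) = 0 := by
        refine hzero _ (not_lt.1 fun hlt => ?_)
        obtain ⟨a, b, c⟩ := hz
        rw [abs_le] at b
        have i0 := (abs_apply_le_norm (contract z.1.1 z.1.2 p - z.2) 0).trans hlt.le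
        have i1 := (abs_apply_le_norm (contract z.1.1 z.1.2 p - z.2) 1).trans hlt.le
        have j0 := (abs_apply_le_norm z.2 0).trans c
        have j1 := (abs_apply_le_norm z.2 1).trans c
        simp only [contract, PiLp.sub_apply, planePt_apply_zero, planePt_apply_one] at i0 i1
        rw [abs_le] at i0 i1 j0 j1
        have k0 : |p 0| ≤ 2 * (R + 1) := by
          rw [abs_le]; constructor <;> nlinarith
        have k1 : |p 1| ≤ 2 * (R + 2) := by
          rw [abs_le]; constructor <;> nlinarith
        linarith [norm_plane_le p]
      simp [h1, h2]
  · rw [lintegral_indicator measurableSet_closedBall, setLIntegral_const]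
    exact (ENNReal.mul_lt_top (ENNReal.pow_lt_top ENNReal.ofReal_lt_top) (isCompact_closedBall _ _).measure_lt_top).ne
  · refine Eventually.of_forall fun p => ?_
    have hcont : Continuous fun z : (ℝ × ℝ) × Plane =>
        ‖G (contract z.1.1 z.1.2 p - z.2) - G p‖ₑ ^ 2 := by
      unfold contract
      exact ENNReal.continuous_pow 2 |>.comp (by fun_prop)
    simpa using hcont.tendsto 0

/-- Continuity in `L₂` of the composition with affine maps. -/
theorem tendsto_lintegral_contract {F : Plane → ℝ} (hF : Measurable F)
    (hF2 : MemLp F 2 volume) :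
    Tendsto (fun z : (ℝ × ℝ) × Plane =>
      ∫⁻ p, ‖F (contract z.1.1 z.1.2 p - z.2) - F p‖ₑ ^ 2) (𝓝 0) (𝓝 0) := by
  rw [ENNReal.tendsto_nhds_zero]
  intro ε hε
  wlog hεt : ε ≠ ⊤ generalizing ε
  · filter_upwards with z
    rw [not_not.1 hεt]
    exact le_top
  -- `22 = 2 * (2 * (4 + 1) + 1)`: three errors of size `η²` are combined by the inequality for
  -- squares of sums, and the transformed one costs the Jacobian factor `4`.
  obtain ⟨η, hη, hηε⟩ : ∃ η : ENNReal, η ≠ 0 ∧ 22 * η ^ 2 ≤ ε := by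
    have hcont : Continuous fun η : ENNReal => 22 * η ^ 2 :=
      (ENNReal.continuous_const_mul (by simp)).comp (ENNReal.continuous_pow 2)
    have h0 := hcont.tendsto 0
    simp only [ne_eq, OfNat.ofNat_ne_zero, not_false_eq_true, zero_pow, mul_zero] at h0
    have := (h0.mono_left (nhdsWithin_le_nhds (s := Ioi 0))).eventually_le_const
      (pos_iff_ne_zero.2 hε.ne')
    obtain ⟨η, h1, h2⟩ := (this.and self_mem_nhdsWithin).exists
    exact ⟨η, (show (0 : ENNReal) < η from h2).ne', h1⟩
  obtain ⟨G, hGc, hG, hGcont, -⟩ := hF2.exists_hasCompactSupport_eLpNorm_sub_le (by simp) hη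
  have hFG : ∫⁻ p, ‖F p - G p‖ₑ ^ 2 ≤ η ^ 2 := by
    rw [← eLpNorm_two_sq]
    exact pow_le_pow_left' hG 2
  have hFGm : Measurable fun p => ‖F p - G p‖ₑ ^ 2 :=
    ((hF.sub hGcont.measurable).enorm).pow_const 2
  have hz1 : ∀ᶠ z : (ℝ × ℝ) × Plane in 𝓝 0, z.1.1 < 1 / 2 ∧ z.1.2 < 1 / 2 := by
    have h1 : Continuous fun z : (ℝ × ℝ) × Plane => z.1.1 := by fun_prop
    have h2 : Continuous fun z : (ℝ × ℝ) × Plane => z.1.2 := by fun_prop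
    exact ((h1.tendsto 0).eventually_lt_const (by norm_num)).and
      ((h2.tendsto 0).eventually_lt_const (by norm_num))
  filter_upwards [hz1, ENNReal.tendsto_nhds_zero.1
    (tendsto_lintegral_contract_of_continuous hGcont hGc) (η ^ 2)
      (pos_iff_ne_zero.2 (pow_ne_zero 2 hη))] with z hz hzG
  set B : Plane → Plane := fun p => contract z.1.1 z.1.2 p - z.2 with hB
  have hBm : Measurable B := measurable_contract_sub _ _ _
  calc ∫⁻ p, ‖F (B p) - F p‖ₑ ^ 2
      ≤ ∫⁻ p, (2 * (2 * (‖F (B p) - G (B p)‖ₑ ^ 2 + ‖G (B p) - G p‖ₑ ^ 2)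
          + ‖F p - G p‖ₑ ^ 2)) := by
        refine lintegral_mono fun p => ?_
        have e : F (B p) - F p = ((F (B p) - G (B p)) + (G (B p) - G p)) - (F p - G p) := by ring
        rw [e]
        refine (enorm_sub_sq_le _ _).trans ?_
        gcongr
        exact enorm_add_sq_le _ _
    _ = 2 * (2 * ((∫⁻ p, ‖F (B p) - G (B p)‖ₑ ^ 2) + ∫⁻ p, ‖G (B p) - G p‖ₑ ^ 2)
          + ∫⁻ p, ‖F p - G p‖ₑ ^ 2) := by
        have m1 : Measurable fun p => ‖F (B p) - G (B p)‖ₑ ^ 2 := hFGm.comp hBm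
        rw [lintegral_const_mul' _ _ (by simp), lintegral_add_right _ hFGm,
          lintegral_const_mul' _ _ (by simp), lintegral_add_left m1]
    _ ≤ 2 * (2 * (4 * η ^ 2 + η ^ 2) + η ^ 2) := by
        gcongr
        refine (lintegral_contract_sub_le hz.1.le hz.2.le z.2 hFGm).trans ?_
        gcongr
    _ = 22 * η ^ 2 := by ring
    _ ≤ ε := hηε

end AffineContinuity

/-! ### Mollification and weak derivatives -/

section Mollification

/-- The convolution with a normalized bump function. -/
noncomputable def mollify (φ : ContDiffBump (0 : Plane)) (F : Plane → ℝ) : Plane → ℝ :=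
  convolution (φ.normed volume) F (ContinuousLinearMap.lsmul ℝ ℝ) volume

theorem mollify_apply (φ : ContDiffBump (0 : Plane)) (F : Plane → ℝ) (q : Plane) :
    mollify φ F q = ∫ t, φ.normed volume t * F (q - t) := rfl

theorem mollify_apply' (φ : ContDiffBump (0 : Plane)) (F : Plane → ℝ) (q : Plane) :
    mollify φ F q = ∫ s, φ.normed volume (q - s) * F s := by
  rw [mollify_apply, ← integral_sub_left_eq_self _ _ q]
  simp

theorem contDiff_mollify (φ : ContDiffBump (0 : Plane)) {F : Plane → ℝ}
    (hF : LocallyIntegrable F volume) : ContDiff ℝ ∞ (mollify φ F) :=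
  φ.hasCompactSupport_normed.contDiff_convolution_left _ φ.contDiff_normed hF

theorem integrable_mollify (φ : ContDiffBump (0 : Plane)) {F : Plane → ℝ}
    (hF : LocallyIntegrable F volume) (q : Plane) :
    Integrable (fun t => φ.normed volume t * F (q - t)) :=
  φ.hasCompactSupport_normed.convolutionExists_left (ContinuousLinearMap.lsmul ℝ ℝ)
    φ.continuous_normed hF q

theorem lintegral_bump (φ : ContDiffBump (0 : Plane)) :
    ∫⁻ t, ‖φ.normed volume t‖ₑ = 1 := by
  have h := ofReal_integral_eq_lintegral_ofReal (φ.integrable_normed (μ := volume))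
    (Eventually.of_forall φ.nonneg_normed)
  rw [φ.integral_normed, ENNReal.ofReal_one] at h
  rw [h]
  refine lintegral_congr fun t => ?_
  rw [← ofReal_norm, Real.norm_of_nonneg (φ.nonneg_normed t)]

/-- The `L₂` distance between a function and the mollification of its composition with a
contraction. -/
theorem lintegral_mollify_contract_sub_le (φ : ContDiffBump (0 : Plane)) {F : Plane → ℝ}
    (hF : Measurable F) (hFl : LocallyIntegrable F volume) (δ τ : ℝ) {η : ENNReal}
    (h : ∀ t : Plane, ‖t‖ ≤ φ.rOut → ∫⁻ p, ‖F (contract δ τ p - t) - F p‖ₑ ^ 2 ≤ η) :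
    ∫⁻ p, ‖mollify φ F (contract δ τ p) - F p‖ₑ ^ 2 ≤ η := by
  have hw : Measurable fun t => ‖φ.normed volume t‖ₑ := φ.continuous_normed.measurable.enorm
  have hcm : Measurable fun z : Plane × Plane => contract δ τ z.1 - z.2 := by
    have : Continuous fun z : Plane × Plane => contract δ τ z.1 - z.2 := by
      unfold contract; fun_prop
    exact this.measurable
  have hm : Measurable fun z : Plane × Plane =>
      ‖φ.normed volume z.2‖ₑ * ‖F (contract δ τ z.1 - z.2) - F z.1‖ₑ ^ 2 :=
    (hw.comp measurable_snd).mul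
      ((((hF.comp hcm).sub (hF.comp measurable_fst)).enorm).pow_const 2)
  calc ∫⁻ p, ‖mollify φ F (contract δ τ p) - F p‖ₑ ^ 2
      ≤ ∫⁻ p, ∫⁻ t, ‖φ.normed volume t‖ₑ * ‖F (contract δ τ p - t) - F p‖ₑ ^ 2 := by
        refine lintegral_mono fun p => ?_
        -- Since the kernel has integral one, `F p` can be put under the integral. Jensen's
        -- inequality and Tonelli then reduce the claim to single translations `t`.
        have e : mollify φ F (contract δ τ p) - F p
            = ∫ t, φ.normed volume t * (F (contract δ τ p - t) - F p) := by
          simp_rw [mul_sub]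
          rw [integral_sub (integrable_mollify φ hFl _) (φ.integrable_normed.mul_const _),
            integral_mul_const, φ.integral_normed, one_mul, mollify_apply]
        rw [e]
        refine le_trans (pow_le_pow_left' (enorm_integral_le_lintegral_enorm _) 2) ?_
        simp_rw [enorm_mul]
        refine sq_lintegral_mul_le _ hw ?_ (lintegral_bump φ)
        exact ((hF.comp (measurable_const.sub measurable_id)).sub_const _).enorm
    _ = ∫⁻ t, ∫⁻ p, ‖φ.normed volume t‖ₑ * ‖F (contract δ τ p - t) - F p‖ₑ ^ 2 :=
        lintegral_lintegral_swap hm.aemeasurable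
    _ ≤ ∫⁻ t, ‖φ.normed volume t‖ₑ * η := by
        refine lintegral_mono fun t => ?_
        rw [lintegral_const_mul' _ _ (by simp)]
        by_cases ht : ‖t‖ ≤ φ.rOut
        · gcongr
          exact h t ht
        · have : φ.normed volume t = 0 := by
            by_contra hne
            have hmem : t ∈ Function.support (φ.normed volume) := hne
            rw [φ.support_normed_eq, mem_ball_zero_iff] at hmem
            exact ht hmem.le
          simp [this]
    _ = η := by rw [lintegral_mul_const _ hw, lintegral_bump, one_mul]

/-- The derivative of a mollification, at points whose distance to the complement of `Ω` is
larger than the radius of the mollifier. -/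
theorem fderiv_mollify_apply {Ω : Set Plane} (hΩ : MeasurableSet Ω) (u : H1 Ω)
    (φ : ContDiffBump (0 : Plane)) {F G : Plane → ℝ} (e : Plane)
    (hF : F = Ω.indicator u.fn) (hG : G = Ω.indicator fun x => ⟪u.grad x, e⟫_ℝ)
    (hFl : LocallyIntegrable F volume) {q : Plane} (hq : Metric.closedBall q φ.rOut ⊆ Ω) :
    fderiv ℝ (mollify φ F) q e = mollify φ G q := by
  have hρ : ContDiff ℝ 1 (φ.normed volume) := φ.contDiff_normed (n := 1)
  have hder := φ.hasCompactSupport_normed.hasFDerivAt_convolution_left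
    (ContinuousLinearMap.lsmul ℝ ℝ) hρ hFl q
  -- The kernel reflected about `q` is supported in the closed ball around `q`, so it is an
  -- admissible test function. Its derivative in `s` has the opposite sign, which cancels the sign
  -- in the weak gradient.
  let η : Plane → ℝ := fun s => φ.normed volume (q - s)
  have hηd : ∀ s, fderiv ℝ η s e = -fderiv ℝ (φ.normed volume) (q - s) e := fun s => by
    have h1 : HasFDerivAt η ((fderiv ℝ (φ.normed volume) (q - s)).comp
        (-(ContinuousLinearMap.id ℝ Plane))) s :=
      ((hρ.differentiable one_ne_zero (q - s)).hasFDerivAt).comp s ((hasFDerivAt_id s).const_sub q)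
    rw [h1.fderiv]
    simp
  have hη : IsTest Ω η := by
    have hsupp : tsupport η ⊆ Metric.closedBall q φ.rOut := by
      refine closure_minimal (fun s hs => ?_) Metric.isClosed_closedBall
      have hmem : q - s ∈ Function.support (φ.normed volume) := hs
      rw [φ.support_normed_eq, mem_ball_zero_iff] at hmem
      rw [Metric.mem_closedBall, dist_comm, dist_eq_norm]
      exact hmem.le
    refine ⟨?_, ?_, hsupp.trans hq⟩
    · exact (φ.contDiff_normed (n := ⊤)).comp (contDiff_const.sub contDiff_id)
    · exact HasCompactSupport.of_support_subset_isCompact (isCompact_closedBall q φ.rOut)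
        ((subset_tsupport _).trans hsupp)
  have hweak := u.2 η hη e
  have e1 : fderiv ℝ (mollify φ F) q e
      = ∫ t, fderiv ℝ (φ.normed volume) t e * F (q - t) := by
    have hex : ConvolutionExistsAt (fderiv ℝ (φ.normed volume)) F q
        ((ContinuousLinearMap.lsmul ℝ ℝ).precompL Plane) volume :=
      HasCompactSupport.convolutionExists_left _ (φ.hasCompactSupport_normed.fderiv ℝ)
        (hρ.continuous_fderiv one_ne_zero) hFl q
    rw [mollify, hder.fderiv, convolution_def, ContinuousLinearMap.integral_apply hex]
    rfl
  have e2 : ∫ t, fderiv ℝ (φ.normed volume) t e * F (q - t)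
      = -∫ s in Ω, u.fn s * fderiv ℝ η s e := by
    rw [← integral_sub_left_eq_self _ _ q, ← integral_indicator hΩ, ← integral_neg]
    refine integral_congr_ae (Eventually.of_forall fun s => ?_)
    simp only [sub_sub_cancel, hF]
    by_cases hs : s ∈ Ω
    · simp only [indicator_of_mem hs, hηd]; ring
    · simp [indicator_of_notMem hs]
  rw [e1, e2, mollify_apply']
  change -(∫ s in Ω, u.fn s * fderiv ℝ η s e) = _
  rw [hweak, neg_neg, ← integral_indicator hΩ]
  refine integral_congr_ae (Eventually.of_forall fun s => ?_)
  simp only [hG]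
  by_cases hs : s ∈ Ω
  · simp only [indicator_of_mem hs, η]; ring
  · simp [indicator_of_notMem hs]

/-- The mollification depends only on the class of `F` almost everywhere, so measurability can be
taken from `F` and the pointwise oscillation from `f`. -/
theorem dist_mollify_le (φ : ContDiffBump (0 : Plane)) {F f : Plane → ℝ} (hFf : F =ᵐ[volume] f)
    (hF : Measurable F) {q : Plane} {ε : ℝ}
    (h : ∀ s ∈ Metric.ball q φ.rOut, dist (f s) (f q) ≤ ε) :
    dist (mollify φ F q) (f q) ≤ ε := by
  have e : mollify φ F q = mollify φ f q := by
    rw [mollify_apply', mollify_apply']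
    exact integral_congr_ae (hFf.mono fun s hs => by simp only [hs])
  rw [e]
  exact ContDiffBump.dist_normed_convolution_le
    ⟨F, hF.stronglyMeasurable, hFf.symm⟩ h

end Mollification

/-! ### Density of smooth functions in `H¹` -/

section Density

/-- The classical gradient, in coordinates. -/
noncomputable def planeGrad (v : Plane → ℝ) (p : Plane) : Plane :=
  planePt (fderiv ℝ v p (planePt 1 0)) (fderiv ℝ v p (planePt 0 1))

theorem plane_enorm_sq (p : Plane) : ‖p‖ₑ ^ 2 = ‖p 0‖ₑ ^ 2 + ‖p 1‖ₑ ^ 2 := by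
  have h := plane_norm_sq p
  rw [← ofReal_norm, ← ofReal_norm, ← ofReal_norm, ← ENNReal.ofReal_pow (norm_nonneg _),
    ← ENNReal.ofReal_pow (norm_nonneg _), ← ENNReal.ofReal_pow (norm_nonneg _),
    ← ENNReal.ofReal_add (by positivity) (by positivity), h]
  simp

theorem inner_planePt (p : Plane) (a b : ℝ) : ⟪p, planePt a b⟫_ℝ = a * p 0 + b * p 1 := by
  simp [PiLp.inner_apply, Fin.sum_univ_two, planePt]

theorem hasFDerivAt_contract (δ τ : ℝ) (p : Plane) : ∃ D : Plane →L[ℝ] Plane,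
    HasFDerivAt (contract δ τ) D p ∧ D (planePt 1 0) = (1 - δ) • planePt 1 0 ∧
      D (planePt 0 1) = (1 - τ) • planePt 0 1 := by
  refine ⟨LinearMap.toContinuousLinearMap
    (Matrix.toEuclideanLin (Matrix.diagonal ![1 - δ, 1 - τ])), ?_, ?_, ?_⟩
  · have e : contract δ τ = fun p => LinearMap.toContinuousLinearMap
        (Matrix.toEuclideanLin (Matrix.diagonal ![1 - δ, 1 - τ])) p + planePt 0 (-(τ / 2)) := by
      funext p
      simpa using contract_sub δ τ 0 p
    rw [e]
    exact (ContinuousLinearMap.hasFDerivAt _).add_const _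
  · refine plane_ext ?_ ?_ <;> simp [Matrix.toLpLin_apply]
  · refine plane_ext ?_ ?_ <;> simp [Matrix.toLpLin_apply]

theorem planeGrad_comp_contract {w : Plane → ℝ} (hw : Differentiable ℝ w) (δ τ : ℝ) (p : Plane) :
    planeGrad (fun p => w (contract δ τ p)) p =
      planePt ((1 - δ) * fderiv ℝ w (contract δ τ p) (planePt 1 0))
        ((1 - τ) * fderiv ℝ w (contract δ τ p) (planePt 0 1)) := by
  obtain ⟨D, hD, h0, h1⟩ := hasFDerivAt_contract δ τ p
  have h := (hw (contract δ τ p)).hasFDerivAt.comp p hD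
  have e : fderiv ℝ (fun p => w (contract δ τ p)) p = _ := h.fderiv
  rw [planeGrad, e]
  simp only [ContinuousLinearMap.comp_apply, h0, h1, map_smul, smul_eq_mul]

theorem contDiff_contract (δ τ : ℝ) : ContDiff ℝ ∞ (contract δ τ) := by
  have e : contract δ τ = fun p => LinearMap.toContinuousLinearMap
      (Matrix.toEuclideanLin (Matrix.diagonal ![1 - δ, 1 - τ])) p + planePt 0 (-(τ / 2)) := by
    funext p
    simpa using contract_sub δ τ 0 p
  rw [e]
  exact (ContinuousLinearMap.contDiff _).add contDiff_const

/-- Contractions and mollifiers that tend to the identity and whose composition only sees the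
values of a function in the open region. -/
theorem exists_mollifier_seq : ∃ (δ τ : ℕ → ℝ) (φ : ℕ → ContDiffBump (0 : Plane)),
    (∀ k, 0 < δ k ∧ δ k < τ k ∧ τ k < 1) ∧
    Tendsto δ atTop (𝓝 0) ∧ Tendsto τ atTop (𝓝 0) ∧ Tendsto (fun k => (φ k).rOut) atTop (𝓝 0) ∧
    ∀ k, ∀ p ∈ closedRegion,
      Metric.closedBall (contract (δ k) (τ k) p) (φ k).rOut ⊆ openRegion := by
  obtain ⟨δ, τ, h0, hδ, hτ, h⟩ := exists_contract_seq
  have hr : ∀ k : ℕ, ∃ r : ℝ, 0 < r ∧ r ≤ 1 / (k + 1) ∧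
      ∀ p ∈ closedRegion, Metric.closedBall (contract (δ k) (τ k) p) r ⊆ openRegion := by
    intro k
    have hK : IsCompact (contract (δ k) (τ k) '' closedRegion) :=
      isCompact_closedRegion.image (contDiff_contract _ _).continuous
    -- The contracted closed region is a compact subset of the open region, so a whole neighbourhood
    -- of it still lies inside.
    obtain ⟨ε, hε, hsub⟩ := hK.exists_cthickening_subset_open isOpen_openRegion
      (image_subset_iff.2 (h k))
    refine ⟨min ε (1 / (k + 1)), lt_min hε (by positivity), min_le_right _ _, fun p hp => ?_⟩
    refine Subset.trans ?_ hsub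
    exact (Metric.closedBall_subset_closedBall (min_le_left _ _)).trans
      (Metric.closedBall_subset_cthickening (mem_image_of_mem _ hp) ε)
  choose r hr0 hr1 hr2 using hr
  refine ⟨δ, τ, fun k => ⟨r k / 2, r k, half_pos (hr0 k), half_lt_self (hr0 k)⟩, h0, hδ, hτ,
    ?_, hr2⟩
  exact squeeze_zero (fun k => (hr0 k).le) hr1 tendsto_one_div_add_atTop_nhds_zero_nat

theorem tendsto_lintegral_mollify {δ τ : ℕ → ℝ} {φ : ℕ → ContDiffBump (0 : Plane)}
    (hδ : Tendsto δ atTop (𝓝 0)) (hτ : Tendsto τ atTop (𝓝 0))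
    (hφ : Tendsto (fun k => (φ k).rOut) atTop (𝓝 0)) {F : Plane → ℝ} (hF : Measurable F)
    (hF2 : MemLp F 2 volume) :
    Tendsto (fun k => ∫⁻ p, ‖mollify (φ k) F (contract (δ k) (τ k) p) - F p‖ₑ ^ 2)
      atTop (𝓝 0) := by
  rw [ENNReal.tendsto_nhds_zero]
  intro η hη
  obtain ⟨r, hr, h⟩ := Metric.eventually_nhds_iff.1
    (ENNReal.tendsto_nhds_zero.1 (tendsto_lintegral_contract hF hF2) η hη)
  have hδ' := Metric.tendsto_nhds.1 hδ r hr
  have hτ' := Metric.tendsto_nhds.1 hτ r hr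
  filter_upwards [hδ', hτ', hφ.eventually_lt_const hr] with k h1 h2 h3
  refine lintegral_mollify_contract_sub_le (φ k) hF (hF2.locallyIntegrable (by norm_num)) _ _
    fun t ht => ?_
  refine h (y := ((δ k, τ k), t)) ?_
  rw [Prod.dist_eq, Prod.dist_eq]
  refine max_lt (max_lt h1 h2) ?_
  simpa using ht.trans_lt h3

theorem memLp_indicator_fn {E : Type*} [NormedAddCommGroup E] {f : Plane → E}
    (hf : MemLp f 2 (volume.restrict openRegion)) : MemLp (openRegion.indicator f) 2 volume :=
  (memLp_indicator_iff_restrict isOpen_openRegion.measurableSet).2 hf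

/-- Approximation of `H¹` functions by smooth functions of the plane; the approximations of a
function that is continuous up to the boundary converge pointwise up to the boundary. -/
theorem exists_smooth_approx (u : H1 openRegion) : ∃ v : ℕ → Plane → ℝ,
    (∀ k, ContDiff ℝ ∞ (v k)) ∧
    Tendsto (fun k => ∫⁻ p in openRegion, ‖v k p - u.fn p‖ₑ ^ 2) atTop (𝓝 0) ∧
    Tendsto (fun k => ∫⁻ p in openRegion, ‖planeGrad (v k) p - u.grad p‖ₑ ^ 2) atTop (𝓝 0) ∧
    ∀ f, u.IsContRep f → ∀ p ∈ closedRegion, Tendsto (fun k => v k p) atTop (𝓝 (f p)) := by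
  obtain ⟨δ, τ, φ, h01, hδ, hτ, hφ, hsub⟩ := exists_mollifier_seq
  have hΩ := isOpen_openRegion.measurableSet
  have hfnm : Measurable u.fn := (Lp.stronglyMeasurable u.fn).measurable
  have hgm : Measurable u.grad := (Lp.stronglyMeasurable u.grad).measurable
  -- The extension by zero need not be in `H¹` of the plane. This does no harm: the mollifier is
  -- evaluated only at contracted points, whose balls lie in the domain.
  set F : Plane → ℝ := openRegion.indicator u.fn with hFdef
  have hF : Measurable F := hfnm.indicator hΩ
  have hF2 : MemLp F 2 volume := memLp_indicator_fn (Lp.memLp u.fn)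
  have hFl : LocallyIntegrable F volume := hF2.locallyIntegrable (by norm_num)
  set G : Plane → Plane → ℝ := fun e => openRegion.indicator fun x => ⟪u.grad x, e⟫_ℝ with hGdef
  have hG : ∀ e, Measurable (G e) := fun e =>
    (Measurable.inner hgm measurable_const).indicator hΩ
  have hG2 : ∀ e, MemLp (G e) 2 volume := fun e =>
    memLp_indicator_fn ((Lp.memLp u.grad).inner_const e)
  set V : ℕ → Plane → ℝ := fun k => mollify (φ k) F with hVdef
  have hV : ∀ k, ContDiff ℝ ∞ (V k) := fun k => contDiff_mollify _ hFl
  refine ⟨fun k p => V k (contract (δ k) (τ k) p), fun k => (hV k).comp (contDiff_contract _ _),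
    ?_, ?_, ?_⟩
  · refine tendsto_of_tendsto_of_tendsto_of_le_of_le tendsto_const_nhds
      (tendsto_lintegral_mollify hδ hτ hφ hF hF2) (fun _ => zero_le) fun k => ?_
    refine le_trans (le_of_eq ?_) (setLIntegral_le_lintegral openRegion _)
    refine setLIntegral_congr_fun hΩ fun p hp => ?_
    simp only [hFdef, indicator_of_mem hp, hVdef]
  · have hb : ∀ k, ∫⁻ p in openRegion,
        ‖planeGrad (fun p => V k (contract (δ k) (τ k) p)) p - u.grad p‖ₑ ^ 2 ≤
        2 * ((∫⁻ p, ‖mollify (φ k) (G (planePt 1 0)) (contract (δ k) (τ k) p)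
            - G (planePt 1 0) p‖ₑ ^ 2) + ‖δ k‖ₑ ^ 2 * ∫⁻ p, ‖G (planePt 1 0) p‖ₑ ^ 2) +
        2 * ((∫⁻ p, ‖mollify (φ k) (G (planePt 0 1)) (contract (δ k) (τ k) p)
            - G (planePt 0 1) p‖ₑ ^ 2) + ‖τ k‖ₑ ^ 2 * ∫⁻ p, ‖G (planePt 0 1) p‖ₑ ^ 2) := by
      intro k
      have key : ∀ (lam : ℝ) (a b : ℝ), 0 ≤ lam → lam ≤ 1 →
          ‖(1 - lam) * a - b‖ₑ ^ 2 ≤ 2 * (‖a - b‖ₑ ^ 2 + ‖lam‖ₑ ^ 2 * ‖b‖ₑ ^ 2) := by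
        intro lam a b h0 h1
        -- This splits off the factor that the chain rule introduces: `a` is the mollified
        -- derivative, `b` the derivative, and `lam` tends to zero.
        have e : (1 - lam) * a - b = (1 - lam) * (a - b) - lam * b := by ring
        rw [e]
        refine (enorm_sub_sq_le _ _).trans ?_
        rw [enorm_mul, enorm_mul, mul_pow, mul_pow]
        gcongr
        refine mul_le_of_le_one_left zero_le (pow_le_one' ?_ 2)
        rw [← ofReal_norm, ENNReal.ofReal_le_one, Real.norm_of_nonneg (by linarith)]
        linarith
      have mG : ∀ e, Measurable fun p => ‖mollify (φ k) (G e) (contract (δ k) (τ k) p)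
          - G e p‖ₑ ^ 2 := fun e => by
        refine (Measurable.sub ?_ (hG e)).enorm.pow_const 2
        exact ((contDiff_mollify (φ k) ((hG2 e).locallyIntegrable (by norm_num))).continuous.comp
          (contDiff_contract _ _).continuous).measurable
      have mG' : ∀ e, Measurable fun p => ‖G e p‖ₑ ^ 2 := fun e => (hG e).enorm.pow_const 2
      have mA : ∀ (c : ENNReal) e, Measurable fun p => 2 *
          (‖mollify (φ k) (G e) (contract (δ k) (τ k) p) - G e p‖ₑ ^ 2 + c * ‖G e p‖ₑ ^ 2) :=
        fun c e => ((mG e).add ((mG' e).const_mul c)).const_mul 2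
      rw [← lintegral_const_mul _ (mG' _), ← lintegral_const_mul _ (mG' _),
        ← lintegral_add_left (mG _), ← lintegral_add_left (mG _),
        ← lintegral_const_mul' _ _ ENNReal.ofNat_ne_top,
        ← lintegral_const_mul' _ _ ENNReal.ofNat_ne_top, ← lintegral_add_left (mA _ _)]
      refine le_trans ?_ (setLIntegral_le_lintegral openRegion _)
      refine setLIntegral_mono' hΩ fun p hp => ?_
      have hbp := hsub k p (openRegion_subset_closedRegion hp)
      rw [planeGrad_comp_contract ((hV k).differentiable (by simp)),
        fderiv_mollify_apply hΩ u (φ k) (planePt 1 0) hFdef rfl hFl hbp,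
        fderiv_mollify_apply hΩ u (φ k) (planePt 0 1) hFdef rfl hFl hbp, plane_enorm_sq]
      have g0 : G (planePt 1 0) p = u.grad p 0 := by
        simp [hGdef, indicator_of_mem hp, inner_planePt]
      have g1 : G (planePt 0 1) p = u.grad p 1 := by
        simp [hGdef, indicator_of_mem hp, inner_planePt]
      simp only [PiLp.sub_apply, planePt_apply_zero, planePt_apply_one]
      rw [g0, g1]
      obtain ⟨a, b, c⟩ := h01 k
      exact add_le_add (key _ _ _ a.le (b.trans c).le) (key _ _ _ (a.trans b).le c.le)
    refine tendsto_of_tendsto_of_tendsto_of_le_of_le tendsto_const_nhds ?_ (fun _ => zero_le) hb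
    have hfin : ∀ e, ∫⁻ p, ‖G e p‖ₑ ^ 2 ≠ ⊤ := fun e => by
      rw [← eLpNorm_two_sq]
      exact ENNReal.pow_ne_top (hG2 e).2.ne
    have hsq : ∀ {s : ℕ → ℝ}, Tendsto s atTop (𝓝 0) → ∀ e,
        Tendsto (fun k => ‖s k‖ₑ ^ 2 * ∫⁻ p, ‖G e p‖ₑ ^ 2) atTop (𝓝 0) := by
      intro s hs e
      have h1 : Tendsto (fun k => ‖s k‖ₑ ^ 2) atTop (𝓝 0) := by
        simpa [Function.comp_def] using ((ENNReal.continuous_pow 2).tendsto _).comp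
          ((continuous_enorm.tendsto 0).comp hs)
      simpa using ENNReal.Tendsto.mul_const h1 (Or.inr (hfin e))
    have hall : ∀ {s : ℕ → ℝ}, Tendsto s atTop (𝓝 0) → ∀ e, Tendsto (fun k =>
        2 * ((∫⁻ p, ‖mollify (φ k) (G e) (contract (δ k) (τ k) p) - G e p‖ₑ ^ 2) +
          ‖s k‖ₑ ^ 2 * ∫⁻ p, ‖G e p‖ₑ ^ 2)) atTop (𝓝 0) := by
      intro s hs e
      have := ENNReal.Tendsto.const_mul (a := 2)
        ((tendsto_lintegral_mollify hδ hτ hφ (hG e) (hG2 e)).add (hsq hs e)) (Or.inr (by simp))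
      simpa using this
    simpa using (hall hδ (planePt 1 0)).add (hall hτ (planePt 0 1))
  · rintro f ⟨hfc, hfe⟩ p hp
    rw [closure_openRegion] at hfc
    have hFf : F =ᵐ[volume] openRegion.indicator f := by
      have h := (ae_restrict_iff' hΩ).1 hfe
      filter_upwards [h] with x hx
      by_cases hxΩ : x ∈ openRegion
      · simp only [hFdef, indicator_of_mem hxΩ, hx hxΩ]
      · simp only [hFdef, indicator_of_notMem hxΩ]
    rw [Metric.tendsto_atTop']
    intro ε hε
    obtain ⟨r, hr, h⟩ := Metric.continuousOn_iff.1 hfc p hp (ε / 4) (by positivity)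
    have hcp : Tendsto (fun k => contract (δ k) (τ k) p) atTop (𝓝 p) := by
      have := (continuous_contract.tendsto ((0, 0), p)).comp
        ((hδ.prodMk_nhds hτ).prodMk_nhds (tendsto_const_nhds (x := p) (f := atTop)))
      simpa [Function.comp_def] using this
    have hev := (Metric.tendsto_nhds.1 hcp (r / 2) (by positivity)).and
      (hφ.eventually_lt_const (show (0 : ℝ) < r / 2 by positivity))
    obtain ⟨N, hN⟩ := eventually_atTop.1 hev
    refine ⟨N, fun k hk => ?_⟩
    obtain ⟨h1, h2⟩ := hN k hk.le
    set q := contract (δ k) (τ k) p with hq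
    -- The mollified value at `q` averages `f` over points of the domain that are close to `p`;
    -- continuity of `f` up to the boundary is used here.
    have hball : ∀ s ∈ Metric.closedBall q (φ k).rOut,
        s ∈ openRegion ∧ dist (f s) (f p) < ε / 4 := by
      intro s hs
      have hs' := hsub k p hp hs
      refine ⟨hs', h s (openRegion_subset_closedRegion hs') ?_⟩
      calc dist s p ≤ dist s q + dist q p := dist_triangle _ _ _
        _ < r / 2 + r / 2 := add_lt_add ((Metric.mem_closedBall.1 hs).trans_lt h2) h1
        _ = r := add_halves r
    have hqm := hball q (Metric.mem_closedBall_self (φ k).rOut_pos.le)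
    have hd : dist (mollify (φ k) F q) (openRegion.indicator f q) ≤ ε / 2 := by
      refine dist_mollify_le (φ k) hFf hF fun s hs => ?_
      have hsm := hball s (Metric.ball_subset_closedBall hs)
      rw [indicator_of_mem hsm.1, indicator_of_mem hqm.1]
      refine (dist_triangle_right _ _ (f p)).trans ?_
      linarith [hsm.2, hqm.2]
    rw [indicator_of_mem hqm.1] at hd
    calc dist (V k q) (f p) ≤ dist (V k q) (f q) + dist (f q) (f p) := dist_triangle _ _ _
      _ < ε := by linarith [hqm.2]

end Density

/-! ### Pointwise estimates on an interval -/

section OneVariable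

/-- The fundamental theorem of calculus and Cauchy–Schwarz. -/
theorem enorm_sub_sq_le_lintegral {w w' : ℝ → ℝ} (hw : ∀ t, HasDerivAt w (w' t) t)
    (hw' : Continuous w') {a b s t : ℝ} (hs : s ∈ Icc a b) (ht : t ∈ Icc a b) :
    ‖w t - w s‖ₑ ^ 2 ≤ ENNReal.ofReal (b - a) * ∫⁻ y in Ioo a b, ‖w' y‖ₑ ^ 2 := by
  have h1 : ‖w t - w s‖ₑ ≤ ∫⁻ y in Ioo a b, ‖w' y‖ₑ := by
    rw [← intervalIntegral.integral_eq_sub_of_hasDerivAt (fun y _ => hw y)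
      (hw'.intervalIntegrable s t), ← enorm_norm, intervalIntegral.norm_intervalIntegral_eq,
      enorm_norm]
    refine (enorm_integral_le_lintegral_enorm _).trans ?_
    rw [Measure.restrict_congr_set (Ioo_ae_eq_Icc (a := a) (b := b) (μ := volume))]
    refine lintegral_mono_set ?_
    exact uIoc_subset_uIcc.trans (uIcc_subset_Icc hs ht)
  refine (pow_le_pow_left' h1 2).trans ?_
  refine (sq_lintegral_le _ hw'.enorm.measurable.aemeasurable).trans_eq ?_
  rw [Measure.restrict_apply_univ, Real.volume_Ioo]

theorem enorm_sq_le_lintegral {w w' : ℝ → ℝ} (hw : ∀ t, HasDerivAt w (w' t) t)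
    (hw' : Continuous w') {a b s t : ℝ} (hs : s ∈ Icc a b) (ht : t ∈ Icc a b) :
    ‖w t‖ₑ ^ 2 ≤
      2 * (‖w s‖ₑ ^ 2 + ENNReal.ofReal (b - a) * ∫⁻ y in Ioo a b, ‖w' y‖ₑ ^ 2) := by
  have h := enorm_add_sq_le (w s) (w t - w s)
  rw [add_sub_cancel] at h
  refine h.trans ?_
  gcongr
  exact enorm_sub_sq_le_lintegral hw hw' hs ht

/-- Average `enorm_sq_le_lintegral` over `s` in the subinterval `(c, d)`. The freedom in its choice
drives the trace inequality: the mass may be measured in one place and the value taken in another.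
-/
theorem enorm_sq_le_average {w w' : ℝ → ℝ} (hw : ∀ t, HasDerivAt w (w' t) t)
    (hw' : Continuous w') {a b c d t : ℝ} (hcd : c < d) (hac : a ≤ c) (hdb : d ≤ b)
    (ht : t ∈ Icc a b) :
    ‖w t‖ₑ ^ 2 ≤ ENNReal.ofReal (2 / (d - c)) * (∫⁻ y in Ioo c d, ‖w y‖ₑ ^ 2) +
      ENNReal.ofReal (2 * (b - a)) * ∫⁻ y in Ioo a b, ‖w' y‖ₑ ^ 2 := by
  set D := ∫⁻ y in Ioo a b, ‖w' y‖ₑ ^ 2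
  have hpos : 0 < d - c := sub_pos.2 hcd
  have hwm : Measurable fun y => ‖w y‖ₑ ^ 2 := by
    have : Continuous w := continuous_iff_continuousAt.2 fun t => (hw t).continuousAt
    exact this.enorm.measurable.pow_const 2
  have h : ∫⁻ _ in Ioo c d, ‖w t‖ₑ ^ 2 ≤
      ∫⁻ y in Ioo c d, 2 * (‖w y‖ₑ ^ 2 + ENNReal.ofReal (b - a) * D) :=
    setLIntegral_mono' measurableSet_Ioo fun s hs =>
      enorm_sq_le_lintegral hw hw' ⟨hac.trans hs.1.le, hs.2.le.trans hdb⟩ ht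
  rw [setLIntegral_const, lintegral_const_mul' _ _ (by simp), lintegral_add_left hwm,
    setLIntegral_const, Real.volume_Ioo] at h
  have hinv : ENNReal.ofReal (1 / (d - c)) * ENNReal.ofReal (d - c) = 1 := by
    rw [← ENNReal.ofReal_mul (by positivity), one_div_mul_cancel hpos.ne', ENNReal.ofReal_one]
  calc ‖w t‖ₑ ^ 2
      = ENNReal.ofReal (1 / (d - c)) * (‖w t‖ₑ ^ 2 * ENNReal.ofReal (d - c)) := by
        rw [mul_comm (‖w t‖ₑ ^ 2), ← mul_assoc, hinv, one_mul]
    _ ≤ ENNReal.ofReal (1 / (d - c)) * (2 * ((∫⁻ y in Ioo c d, ‖w y‖ₑ ^ 2) +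
          ENNReal.ofReal (b - a) * D * ENNReal.ofReal (d - c))) := by gcongr
    _ = (2 * ENNReal.ofReal (1 / (d - c))) * (∫⁻ y in Ioo c d, ‖w y‖ₑ ^ 2) +
          (2 * ENNReal.ofReal (b - a)) * D *
            (ENNReal.ofReal (1 / (d - c)) * ENNReal.ofReal (d - c)) := by ring
    _ = _ := by
        rw [hinv, mul_one, ← ENNReal.ofReal_ofNat, ← ENNReal.ofReal_mul (by norm_num),
          ← ENNReal.ofReal_mul (by norm_num), mul_one_div]

end OneVariable

/-! ### Iterated integrals in the plane -/

section PlaneIntegrals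

theorem measurePreserving_planePt :
    MeasurePreserving (fun z : ℝ × ℝ => planePt z.1 z.2) volume volume :=
  (PiLp.volume_preserving_toLp (Fin 2)).comp (volume_preserving_finTwoArrow ℝ).symm

theorem measurable_planePt : Measurable fun z : ℝ × ℝ => planePt z.1 z.2 :=
  measurePreserving_planePt.measurable

theorem lintegral_plane {g : Plane → ENNReal} (hg : Measurable g) :
    ∫⁻ p, g p = ∫⁻ x, ∫⁻ y, g (planePt x y) := by
  rw [← measurePreserving_planePt.lintegral_comp hg]
  exact lintegral_prod _ (hg.comp measurable_planePt).aemeasurable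

/-- Integrals over the part of the plane between two graphs. -/
theorem lintegral_between {s : Set Plane} {E : Set ℝ} {S : ℝ → Set ℝ} (hs : MeasurableSet s)
    (hE : MeasurableSet E) (hS : ∀ x, MeasurableSet (S x))
    (h : ∀ x y, planePt x y ∈ s ↔ x ∈ E ∧ y ∈ S x) {g : Plane → ENNReal} (hg : Measurable g) :
    ∫⁻ p in s, g p = ∫⁻ x in E, ∫⁻ y in S x, g (planePt x y) := by
  rw [← lintegral_indicator hs, lintegral_plane (hg.indicator hs), ← lintegral_indicator hE]
  refine lintegral_congr fun x => ?_
  by_cases hx : x ∈ E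
  · rw [indicator_of_mem hx, ← lintegral_indicator (hS x)]
    refine lintegral_congr fun y => ?_
    by_cases hy : y ∈ S x
    · rw [indicator_of_mem hy, indicator_of_mem ((h x y).2 ⟨hx, hy⟩)]
    · rw [indicator_of_notMem hy, indicator_of_notMem fun hc => hy ((h x y).1 hc).2]
  · rw [indicator_of_notMem hx]
    refine (lintegral_congr fun y => ?_).trans lintegral_zero
    exact indicator_of_notMem (fun hc => hx ((h x y).1 hc).1) _

theorem lintegral_openRegion {g : Plane → ENNReal} (hg : Measurable g) :
    ∫⁻ p in openRegion, g p
      = ∫⁻ x in Ioo (-1) 1, ∫⁻ y in Ioo (-1) (roof x), g (planePt x y) :=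
  lintegral_between isOpen_openRegion.measurableSet measurableSet_Ioo
    (fun _ => measurableSet_Ioo)
    (fun _ _ => and_congr abs_lt Iff.rfl) hg

end PlaneIntegrals

/-! ### Trace inequality and boundary layer estimates for smooth functions -/

section Energy

/-- The density of the square of the `H¹` norm. -/
noncomputable def energy (v : Plane → ℝ) (p : Plane) : ENNReal :=
  ‖v p‖ₑ ^ 2 + ‖planeGrad v p‖ₑ ^ 2

variable {v : Plane → ℝ}

theorem hasDerivAt_vertical (hv : ContDiff ℝ 1 v) (x y : ℝ) :
    HasDerivAt (fun t => v (planePt x t)) (planeGrad v (planePt x y) 1) y := by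
  have e : ∀ t, planePt x t = planePt x 0 + t • planePt 0 1 := fun t =>
    plane_ext (by simp) (by simp)
  have h : HasDerivAt (fun t => planePt x t) (planePt 0 1) y := by
    rw [funext e]
    simpa using ((hasDerivAt_id y).smul_const (planePt 0 1)).const_add (planePt x 0)
  exact (hv.differentiable one_ne_zero _).hasFDerivAt.comp_hasDerivAt y h

theorem hasDerivAt_horizontal (hv : ContDiff ℝ 1 v) (x y : ℝ) :
    HasDerivAt (fun t => v (planePt t y)) (planeGrad v (planePt x y) 0) x := by
  have e : ∀ t, planePt t y = planePt 0 y + t • planePt 1 0 := fun t =>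
    plane_ext (by simp) (by simp)
  have h : HasDerivAt (fun t => planePt t y) (planePt 1 0) x := by
    rw [funext e]
    simpa using ((hasDerivAt_id x).smul_const (planePt 1 0)).const_add (planePt 0 y)
  exact (hv.differentiable one_ne_zero _).hasFDerivAt.comp_hasDerivAt x h

theorem continuous_planeGrad (hv : ContDiff ℝ 1 v) : Continuous (planeGrad v) := by
  have := hv.continuous_fderiv one_ne_zero
  unfold planeGrad
  fun_prop

theorem continuous_planeGrad_apply (hv : ContDiff ℝ 1 v) (i : Fin 2) :
    Continuous fun p => planeGrad v p i := by
  have := continuous_planeGrad hv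
  fun_prop

theorem measurable_energy (hv : ContDiff ℝ 1 v) : Measurable (energy v) :=
  (hv.continuous.enorm.measurable.pow_const 2).add
    ((continuous_planeGrad hv).enorm.measurable.pow_const 2)

theorem enorm_sq_le_energy (v : Plane → ℝ) (p : Plane) : ‖v p‖ₑ ^ 2 ≤ energy v p := le_self_add

theorem enorm_planeGrad_sq_le_energy (v : Plane → ℝ) (p : Plane) :
    ‖planeGrad v p‖ₑ ^ 2 ≤ energy v p := le_add_self

theorem enorm_planeGrad_one_sq_le (v : Plane → ℝ) (p : Plane) :
    ‖planeGrad v p 1‖ₑ ^ 2 ≤ ‖planeGrad v p‖ₑ ^ 2 := by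
  rw [plane_enorm_sq]; exact le_add_self

theorem enorm_planeGrad_zero_sq_le (v : Plane → ℝ) (p : Plane) :
    ‖planeGrad v p 0‖ₑ ^ 2 ≤ ‖planeGrad v p‖ₑ ^ 2 := by
  rw [plane_enorm_sq]; exact le_self_add

/-- The energy over a vertical section of the domain. -/
noncomputable def columnEnergy (v : Plane → ℝ) (x : ℝ) : ENNReal :=
  ∫⁻ y in Ioo (-1) (roof x), energy v (planePt x y)

theorem lintegral_columnEnergy (hv : ContDiff ℝ 1 v) :
    ∫⁻ x in Ioo (-1) 1, columnEnergy v x = ∫⁻ p in openRegion, energy v p :=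
  (lintegral_openRegion (measurable_energy hv)).symm

/-- Every fibre contains the unit interval `(-1, 0)`, over which one averages, and has length at
most `5/4`. The constants are `2` and `2 * (5/4) ≤ 3`. The bound is uniform up to the roof and blind
to its slope. -/
theorem enorm_sq_le_columnEnergy (hv : ContDiff ℝ 1 v) {x y : ℝ} (h1 : -1 ≤ y)
    (h2 : y ≤ roof x) : ‖v (planePt x y)‖ₑ ^ 2 ≤ 5 * columnEnergy v x := by
  have hr := roof_nonneg x
  have hr' := roof_le x
  have h := enorm_sq_le_average (fun t => hasDerivAt_vertical hv x t)
    ((continuous_planeGrad_apply hv 1).comp (by fun_prop)) (a := -1) (b := roof x) (c := -1)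
    (d := 0) (by norm_num) le_rfl hr ⟨h1, h2⟩
  refine h.trans ?_
  have e : (5 : ENNReal) * columnEnergy v x = ENNReal.ofReal 2 * columnEnergy v x +
      ENNReal.ofReal 3 * columnEnergy v x := by
    rw [← add_mul, ← ENNReal.ofReal_add (by norm_num) (by norm_num), ← ENNReal.ofReal_ofNat]
    norm_num
  rw [e]
  refine add_le_add (mul_le_mul' (ENNReal.ofReal_le_ofReal (by norm_num)) ?_)
    (mul_le_mul' (ENNReal.ofReal_le_ofReal (by linarith)) ?_)
  · exact (lintegral_mono_set (Ioo_subset_Ioo_right hr)).trans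
      (lintegral_mono fun y => enorm_sq_le_energy v _)
  · exact lintegral_mono fun y => (enorm_planeGrad_one_sq_le v _).trans
      (enorm_planeGrad_sq_le_energy v _)

theorem lintegral_horizontal_le (hv : ContDiff ℝ 1 v) {g : ℝ → ℝ} (h1 : ∀ x, -1 ≤ g x)
    (h2 : ∀ x, g x ≤ roof x) : ∫⁻ x in Icc (-1) 1, ‖v (planePt x (g x))‖ₑ ^ 2 ≤
      5 * ∫⁻ p in openRegion, energy v p := by
  rw [← lintegral_columnEnergy hv, ← lintegral_const_mul' _ _ (by simp),
    Measure.restrict_congr_set (Ioo_ae_eq_Icc (a := (-1 : ℝ)) (b := 1) (μ := volume)).symm]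
  exact lintegral_mono fun x => enorm_sq_le_columnEnergy hv (h1 x) (h2 x)

theorem lintegral_swap_planePt {g : Plane → ENNReal} (hg : Measurable g) (A B : Set ℝ) :
    ∫⁻ y in B, ∫⁻ x in A, g (planePt x y) = ∫⁻ x in A, ∫⁻ y in B, g (planePt x y) :=
  lintegral_lintegral_swap
    (hg.comp (measurable_planePt.comp measurable_swap)).aemeasurable

/-- Here the averaging is horizontal, across the full width of the rectangle, with constants `1` and
`4`. -/
theorem lintegral_side_le (hv : ContDiff ℝ 1 v) {c : ℝ} (hc : c ∈ Icc (-1) 1) :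
    ∫⁻ y in Icc (-1) 0, ‖v (planePt c y)‖ₑ ^ 2 ≤ 5 * ∫⁻ p in openRegion, energy v p := by
  have hE := measurable_energy hv
  calc ∫⁻ y in Icc (-1) 0, ‖v (planePt c y)‖ₑ ^ 2
      = ∫⁻ y in Ioo (-1) 0, ‖v (planePt c y)‖ₑ ^ 2 := by
        rw [Measure.restrict_congr_set (Ioo_ae_eq_Icc (a := (-1 : ℝ)) (b := 0) (μ := volume)).symm]
    _ ≤ ∫⁻ y in Ioo (-1) 0, 5 * ∫⁻ x in Ioo (-1) 1, energy v (planePt x y) := by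
        refine lintegral_mono fun y => ?_
        have h := enorm_sq_le_average (fun t => hasDerivAt_horizontal hv t y)
          ((continuous_planeGrad_apply hv 0).comp (by fun_prop)) (a := -1) (b := 1) (c := -1)
          (d := 1) (by norm_num) le_rfl le_rfl hc
        refine h.trans ?_
        have e : (5 : ENNReal) * (∫⁻ x in Ioo (-1) 1, energy v (planePt x y))
            = ENNReal.ofReal 1 * (∫⁻ x in Ioo (-1) 1, energy v (planePt x y)) +
              ENNReal.ofReal 4 * ∫⁻ x in Ioo (-1) 1, energy v (planePt x y) := by
          rw [← add_mul, ← ENNReal.ofReal_add (by norm_num) (by norm_num), ← ENNReal.ofReal_ofNat]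
          norm_num
        rw [e]
        refine add_le_add (mul_le_mul' (ENNReal.ofReal_le_ofReal (by norm_num)) ?_)
          (mul_le_mul' (ENNReal.ofReal_le_ofReal (by norm_num)) ?_)
        · exact lintegral_mono fun x => enorm_sq_le_energy v _
        · exact lintegral_mono fun x => (enorm_planeGrad_zero_sq_le v _).trans
            (enorm_planeGrad_sq_le_energy v _)
    _ = 5 * ∫⁻ x in Ioo (-1) 1, ∫⁻ y in Ioo (-1) 0, energy v (planePt x y) := by
        rw [lintegral_const_mul' _ _ (by simp), lintegral_swap_planePt hE]
    _ ≤ 5 * ∫⁻ p in openRegion, energy v p := by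
        rw [lintegral_openRegion hE]
        gcongr with x
        exact roof_nonneg x

/-- The energy over the vertical strip above an interval around the base of a spike. -/
noncomputable def windowEnergy (v : Plane → ℝ) (n : ℕ) : ENNReal :=
  ∫⁻ x in window n, columnEnergy v x

/-- Disjointness of the windows allows estimates for single spikes, with constants independent of
`n`, to be summed. -/
theorem tsum_windowEnergy_le (hv : ContDiff ℝ 1 v) :
    ∑' n : ℕ, windowEnergy v (n + 1) ≤ ∫⁻ p in openRegion, energy v p := by
  rw [← lintegral_columnEnergy hv]
  unfold windowEnergy
  rw [← lintegral_iUnion (s := fun n => window (n + 1)) (fun n => measurableSet_Ioo)]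
  · exact lintegral_mono_set (iUnion_subset fun n => window_subset (by omega))
  · intro n m hnm
    exact window_disjoint (by omega)

/-- Averaging horizontally over the window, of width `r / 2`, gives `(4 / r) ∬ |v|² + r ∬ |∂ₓ v|²`
over the window and depth `a`. The first double integral is at most `5 a` times the energy of the
window, and `a = r²` makes it `20 r`. The bound on a single vertical segment thus carries no
negative power of `r`. -/
theorem lintegral_below_spike_le (hv : ContDiff ℝ 1 v) {n : ℕ} (hn : 1 ≤ n) {x : ℝ}
    (hx : x ∈ window n) :
    ∫⁻ y in Ioo (-spikeHeight n) 0, ‖v (planePt x y)‖ₑ ^ 2 ≤ 21 * windowEnergy v n := by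
  have ha := spikeHeight_pos n
  have har := spikeHeight_eq n
  have ha4 := spikeHeight_le hn
  have hr2 := spikeCentre_le hn
  have hr0 : (0 : ℝ) < 1 / 2 ^ n := by positivity
  set a := spikeHeight n
  set r : ℝ := 1 / 2 ^ n with hr
  have hvm : Measurable fun p => ‖v p‖ₑ ^ 2 := hv.continuous.enorm.measurable.pow_const 2
  have hgm : Measurable fun p => ‖planeGrad v p 0‖ₑ ^ 2 :=
    (continuous_planeGrad_apply hv 0).enorm.measurable.pow_const 2
  have hv2 : ∫⁻ x' in window n, ∫⁻ y in Ioo (-a) 0, ‖v (planePt x' y)‖ₑ ^ 2 ≤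
      ENNReal.ofReal a * (5 * windowEnergy v n) := by
    unfold windowEnergy
    rw [← lintegral_const_mul' _ _ (by simp), ← lintegral_const_mul' _ _ (by simp)]
    refine lintegral_mono fun x' => ?_
    calc ∫⁻ y in Ioo (-a) 0, ‖v (planePt x' y)‖ₑ ^ 2
        ≤ ∫⁻ y in Ioo (-a) 0, 5 * columnEnergy v x' := by
          refine setLIntegral_mono' measurableSet_Ioo fun y hy => ?_
          exact enorm_sq_le_columnEnergy hv (by linarith [hy.1])
            (hy.2.le.trans (roof_nonneg _))
      _ = ENNReal.ofReal a * (5 * columnEnergy v x') := by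
          rw [setLIntegral_const, Real.volume_Ioo, mul_comm]
          simp
  have hg2 : ∫⁻ x' in window n, ∫⁻ y in Ioo (-a) 0, ‖planeGrad v (planePt x' y) 0‖ₑ ^ 2 ≤
      windowEnergy v n := by
    refine lintegral_mono fun x' => ?_
    refine (lintegral_mono_set (Ioo_subset_Ioo (show -1 ≤ -a by linarith)
      (roof_nonneg x'))).trans ?_
    exact lintegral_mono fun y => (enorm_planeGrad_zero_sq_le v _).trans
      (enorm_planeGrad_sq_le_energy v _)
  have hlen : r * (5 / 4) - r * (3 / 4) = r / 2 := by ring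
  calc ∫⁻ y in Ioo (-a) 0, ‖v (planePt x y)‖ₑ ^ 2
      ≤ ∫⁻ y in Ioo (-a) 0, (ENNReal.ofReal (2 / (r / 2)) *
          (∫⁻ x' in window n, ‖v (planePt x' y)‖ₑ ^ 2) + ENNReal.ofReal (2 * (r / 2)) *
          ∫⁻ x' in window n, ‖planeGrad v (planePt x' y) 0‖ₑ ^ 2) := by
        refine lintegral_mono fun y => ?_
        have h := enorm_sq_le_average (fun t => hasDerivAt_horizontal hv t y)
          ((continuous_planeGrad_apply hv 0).comp (by fun_prop)) (a := r * (3 / 4))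
          (b := r * (5 / 4)) (c := r * (3 / 4)) (d := r * (5 / 4)) (by linarith) le_rfl le_rfl
          ⟨hx.1.le, hx.2.le⟩
        rwa [hlen] at h
    _ = ENNReal.ofReal (2 / (r / 2)) *
          (∫⁻ x' in window n, ∫⁻ y in Ioo (-a) 0, ‖v (planePt x' y)‖ₑ ^ 2) +
        ENNReal.ofReal (2 * (r / 2)) *
          ∫⁻ x' in window n, ∫⁻ y in Ioo (-a) 0, ‖planeGrad v (planePt x' y) 0‖ₑ ^ 2 := by
        rw [lintegral_add_left, lintegral_const_mul' _ _ ENNReal.ofReal_ne_top,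
          lintegral_const_mul' _ _ ENNReal.ofReal_ne_top, lintegral_swap_planePt hvm,
          lintegral_swap_planePt hgm]
        refine Measurable.const_mul ?_ _
        exact Measurable.lintegral_prod_right'
          (f := fun z : ℝ × ℝ => ‖v (planePt z.2 z.1)‖ₑ ^ 2)
          (hvm.comp (measurable_planePt.comp measurable_swap))
    _ ≤ ENNReal.ofReal (2 / (r / 2)) * (ENNReal.ofReal a * (5 * windowEnergy v n)) +
        ENNReal.ofReal (2 * (r / 2)) * windowEnergy v n := by gcongr
    _ = ENNReal.ofReal (20 * r + r) * windowEnergy v n := by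
        have e : ENNReal.ofReal (2 / (r / 2)) * (ENNReal.ofReal a * (5 * windowEnergy v n))
            = ENNReal.ofReal (20 * r) * windowEnergy v n := by
          rw [← ENNReal.ofReal_ofNat, ← mul_assoc, ← mul_assoc,
            ← ENNReal.ofReal_mul (by positivity), ← ENNReal.ofReal_mul (by positivity), har]
          congr 2
          field_simp
          norm_num
        rw [e, ENNReal.ofReal_add (by positivity) (by positivity), add_mul]
        congr 3
        ring
    _ ≤ 21 * windowEnergy v n := by
        gcongr
        rw [← ENNReal.ofReal_ofNat]
        exact ENNReal.ofReal_le_ofReal (by linarith)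

/-- Average vertically over the depth `a` below the base, which matches the height of the spike. The
powers of `a` cancel: `(2 / a) * (2 / a) * (2 * a ^ 2) = 8` for the mass below the base, and `(2 /
a) * (4 * a) = 8` for the vertical derivative. -/
theorem lintegral_spike_le (hv : ContDiff ℝ 1 v) {n : ℕ} (hn : 1 ≤ n) :
    ENNReal.ofReal (2 / spikeHeight n) *
      ∫⁻ x in spikeBase n, ‖v (planePt x (tent n x))‖ₑ ^ 2 ≤ 200 * windowEnergy v n := by
  have ha := spikeHeight_pos n
  have ha4 := spikeHeight_le hn
  set a := spikeHeight n with hadef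
  calc ENNReal.ofReal (2 / a) * ∫⁻ x in spikeBase n, ‖v (planePt x (tent n x))‖ₑ ^ 2
      ≤ ENNReal.ofReal (2 / a) * ∫⁻ x in spikeBase n,
          (ENNReal.ofReal (2 / a) * (21 * windowEnergy v n) +
            ENNReal.ofReal (4 * a) * columnEnergy v x) := by
        refine mul_le_mul' le_rfl ?_
        refine setLIntegral_mono' (measurableSet_spikeBase n) fun x hx => ?_
        have hxw := spikeBase_subset_window hn hx
        have ht0 := tent_nonneg n x
        have ht1 := tent_le n x
        have h := enorm_sq_le_average (fun t => hasDerivAt_vertical hv x t)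
          ((continuous_planeGrad_apply hv 1).comp (by fun_prop)) (a := -a) (b := tent n x)
          (c := -a) (d := 0) (t := tent n x) (by linarith) le_rfl ht0 ⟨by linarith, le_rfl⟩
        refine h.trans (add_le_add (mul_le_mul' (le_of_eq (by ring_nf))
          (lintegral_below_spike_le hv hn hxw))
          (mul_le_mul' (ENNReal.ofReal_le_ofReal (by linarith)) ?_))
        unfold columnEnergy
        rw [roof_eq_tent hn hxw]
        refine (lintegral_mono_set (Ioo_subset_Ioo_left (show -1 ≤ -a by linarith))).trans ?_
        exact lintegral_mono fun y => (enorm_planeGrad_one_sq_le v _).trans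
          (enorm_planeGrad_sq_le_energy v _)
    _ ≤ ENNReal.ofReal (2 / a) * (ENNReal.ofReal (2 / a) * (21 * windowEnergy v n) *
          ENNReal.ofReal (2 * a ^ 2) + ENNReal.ofReal (4 * a) * windowEnergy v n) := by
        rw [lintegral_add_left measurable_const, setLIntegral_const, volume_spikeBase,
          lintegral_const_mul' _ _ ENNReal.ofReal_ne_top]
        gcongr
        exact lintegral_mono_set (spikeBase_subset_window hn)
    _ = (ENNReal.ofReal (2 / a) * ENNReal.ofReal (2 / a) * ENNReal.ofReal (2 * a ^ 2)) *
          (21 * windowEnergy v n) +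
          (ENNReal.ofReal (2 / a) * ENNReal.ofReal (4 * a)) * windowEnergy v n := by ring
    _ = ENNReal.ofReal 8 * (21 * windowEnergy v n) + ENNReal.ofReal 8 * windowEnergy v n := by
        rw [← ENNReal.ofReal_mul (by positivity), ← ENNReal.ofReal_mul (by positivity),
          ← ENNReal.ofReal_mul (by positivity)]
        congr 3
        · field_simp
          norm_num
        · field_simp
          norm_num
    -- `176 = 8 * 21 + 8`.
    _ = 176 * windowEnergy v n := by
        rw [ENNReal.ofReal_ofNat]
        ring
    _ ≤ 200 * windowEnergy v n := by
        gcongr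
        norm_num

/-- The trace inequality for smooth functions. -/
theorem lintegral_frontier_sq_le (hv : ContDiff ℝ 1 v) :
    ∫⁻ p in frontier openRegion, ‖v p‖ₑ ^ 2 ∂μH[1] ≤
      220 * ∫⁻ p in openRegion, energy v p := by
  refine (lintegral_frontier_le _).trans ?_
  set K := ∫⁻ p in openRegion, energy v p with hK
  have h1 := lintegral_horizontal_le hv (g := fun _ => -1) (fun _ => le_rfl)
    (fun x => by linarith [roof_nonneg x])
  have h2 := lintegral_horizontal_le hv (g := fun _ => 0) (fun _ => by norm_num) roof_nonneg
  have h3 := lintegral_side_le hv (c := -1) (by norm_num)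
  have h4 := lintegral_side_le hv (c := 1) (by norm_num)
  have h5 : ∑' n : ℕ, ENNReal.ofReal (2 / spikeHeight (n + 1)) *
      ∫⁻ x in spikeBase (n + 1), ‖v (planePt x (tent (n + 1) x))‖ₑ ^ 2 ≤ 200 * K := by
    refine (ENNReal.tsum_le_tsum fun n => lintegral_spike_le hv (by omega)).trans ?_
    rw [ENNReal.tsum_mul_left]
    gcongr
    exact tsum_windowEnergy_le hv
  -- Two horizontal segments, two vertical sides, and all spikes together.
  calc _ ≤ (5 * K + 5 * K) + (5 * K + 5 * K) + 200 * K := by gcongr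
    _ = 220 * K := by ring

/-- The mass of a function below the roof is controlled by the thickness of the layer. -/
theorem lintegral_layer_le (hv : ContDiff ℝ 1 v) {N : Set Plane} {ε : ℝ}
    (h : ∀ p ∈ N, p ∈ openRegion ∧ roof (p 0) - ε ≤ p 1) :
    ∫⁻ p in N, ‖v p‖ₑ ^ 2 ≤ ENNReal.ofReal ε * (5 * ∫⁻ p in openRegion, energy v p) := by
  have hvm : Measurable fun p => ‖v p‖ₑ ^ 2 := hv.continuous.enorm.measurable.pow_const 2
  -- `N` is not assumed measurable; it is enlarged to the full layer, which is measurable and has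
  -- sections of length at most `ε`.
  set N' : Set Plane := {p | p 0 ∈ Ioo (-1 : ℝ) 1 ∧
    p 1 ∈ Ioo (-1) (roof (p 0)) ∩ Icc (roof (p 0) - ε) (roof (p 0))} with hN'
  have hm : MeasurableSet N' := by
    have h0 : Measurable fun p : Plane => p 0 := by fun_prop
    have h1 : Measurable fun p : Plane => p 1 := by fun_prop
    have hr : Measurable fun p : Plane => roof (p 0) := continuous_roof_apply.measurable
    refine (measurableSet_lt measurable_const h0).inter (measurableSet_lt h0 measurable_const)
      |>.inter (((measurableSet_lt measurable_const h1).inter (measurableSet_lt h1 hr)).inter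
        ((measurableSet_le (hr.sub_const ε) h1).inter (measurableSet_le h1 hr)))
  have hsub : N ⊆ N' := fun p hp => by
    obtain ⟨⟨a, b, c⟩, d⟩ := h p hp
    exact ⟨abs_lt.1 a, ⟨b, c⟩, d, c.le⟩
  refine (lintegral_mono_set hsub).trans ?_
  rw [lintegral_between (S := fun x => Ioo (-1) (roof x) ∩ Icc (roof x - ε) (roof x)) hm
    measurableSet_Ioo (fun x => measurableSet_Ioo.inter measurableSet_Icc)
    (fun x y => Iff.rfl) hvm, ← lintegral_columnEnergy hv, ← lintegral_const_mul' _ _ (by simp),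
    ← lintegral_const_mul' _ _ (by simp)]
  refine lintegral_mono fun x => ?_
  calc ∫⁻ y in Ioo (-1) (roof x) ∩ Icc (roof x - ε) (roof x), ‖v (planePt x y)‖ₑ ^ 2
      ≤ ∫⁻ y in Ioo (-1) (roof x) ∩ Icc (roof x - ε) (roof x), 5 * columnEnergy v x :=
        setLIntegral_mono' (measurableSet_Ioo.inter measurableSet_Icc) fun y hy =>
          enorm_sq_le_columnEnergy hv hy.1.1.le hy.1.2.le
    _ ≤ ∫⁻ y in Icc (roof x - ε) (roof x), 5 * columnEnergy v x :=
        lintegral_mono_set inter_subset_right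
    _ = ENNReal.ofReal ε * (5 * columnEnergy v x) := by
        rw [setLIntegral_const, Real.volume_Icc, mul_comm]
        congr 2
        ring

/-- The `L₂` norm is controlled by the gradient and the values on the boundary. -/
theorem lintegral_sq_le_grad_add_frontier (hv : ContDiff ℝ 1 v) :
    ∫⁻ p in openRegion, ‖v p‖ₑ ^ 2 ≤ 8 * (∫⁻ p in openRegion, ‖planeGrad v p‖ₑ ^ 2) +
      4 * ∫⁻ p in frontier openRegion, ‖v p‖ₑ ^ 2 ∂μH[1] := by
  have hvm : Measurable fun p => ‖v p‖ₑ ^ 2 := hv.continuous.enorm.measurable.pow_const 2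
  have hgm : Measurable fun p => ‖planeGrad v p‖ₑ ^ 2 :=
    (continuous_planeGrad hv).enorm.measurable.pow_const 2
  -- The bottom side alone suffices: integrate up each fibre from `(x, -1)`. The fibres have length
  -- at most `2`, whence the constants `4` and `8`.
  have hbot : ∫⁻ x in Ioo (-1) 1, ‖v (planePt x (-1))‖ₑ ^ 2 ≤
      ∫⁻ p in frontier openRegion, ‖v p‖ₑ ^ 2 ∂μH[1] := by
    rw [← lintegral_hausdorff_horizontal (-1) measurableSet_Ioo fun p => ‖v p‖ₑ ^ 2]
    refine lintegral_mono_set ?_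
    rintro _ ⟨x, hx, rfl⟩
    rw [frontier_openRegion]
    refine ⟨⟨(abs_lt.2 hx).le, le_rfl, ?_⟩, fun h => lt_irrefl _ h.2.1⟩
    simp only [planePt_apply_one]
    linarith [roof_nonneg ((planePt x (-1)) 0)]
  have hmain : ∫⁻ p in openRegion, ‖v p‖ₑ ^ 2 ≤ ∫⁻ x in Ioo (-1) 1,
      (4 * ‖v (planePt x (-1))‖ₑ ^ 2 +
        8 * ∫⁻ y in Ioo (-1) (roof x), ‖planeGrad v (planePt x y)‖ₑ ^ 2) := by
    rw [lintegral_openRegion hvm]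
    refine lintegral_mono fun x => ?_
    have hr := roof_nonneg x
    have hr' := roof_le x
    set P := ∫⁻ y in Ioo (-1) (roof x), ‖planeGrad v (planePt x y)‖ₑ ^ 2
    have h2 : ENNReal.ofReal (roof x - -1) ≤ 2 := by
      rw [← ENNReal.ofReal_ofNat]
      exact ENNReal.ofReal_le_ofReal (by linarith)
    calc ∫⁻ y in Ioo (-1) (roof x), ‖v (planePt x y)‖ₑ ^ 2
        ≤ ∫⁻ y in Ioo (-1) (roof x), 2 * (‖v (planePt x (-1))‖ₑ ^ 2 + 2 * P) := by
          refine setLIntegral_mono' measurableSet_Ioo fun y hy => ?_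
          refine (enorm_sq_le_lintegral (fun t => hasDerivAt_vertical hv x t)
            ((continuous_planeGrad_apply hv 1).comp (by fun_prop)) (a := -1) (b := roof x)
            (s := -1) ⟨le_rfl, by linarith⟩ ⟨hy.1.le, hy.2.le⟩).trans ?_
          gcongr
          exact lintegral_mono fun y => enorm_planeGrad_one_sq_le v _
      _ = 2 * (‖v (planePt x (-1))‖ₑ ^ 2 + 2 * P) * ENNReal.ofReal (roof x - -1) := by
          rw [setLIntegral_const, Real.volume_Ioo]
      _ ≤ 2 * (‖v (planePt x (-1))‖ₑ ^ 2 + 2 * P) * 2 := by gcongr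
      _ = 4 * ‖v (planePt x (-1))‖ₑ ^ 2 + 8 * P := by ring
  refine hmain.trans ?_
  rw [lintegral_add_left, lintegral_const_mul' _ _ (by simp), lintegral_const_mul' _ _ (by simp),
    ← lintegral_openRegion hgm, add_comm]
  · gcongr
  · exact (hvm.comp (by fun_prop)).const_mul 4

end Energy

/-! ### Approximation by step functions -/

section StepApproximation

/-- A Poincaré inequality on squares. -/
theorem exists_const_approx {v : Plane → ℝ} (hv : ContDiff ℝ 1 v) (a c : ℝ) {l : ℝ}
    (hl : 0 < l) : ∃ m : ℝ,
    ∫⁻ x in Ioo a (a + l), ∫⁻ y in Ioo c (c + l), ‖v (planePt x y) - m‖ₑ ^ 2 ≤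
      ENNReal.ofReal (4 * l ^ 2) *
        ∫⁻ x in Ioo a (a + l), ∫⁻ y in Ioo c (c + l), ‖planeGrad v (planePt x y)‖ₑ ^ 2 := by
  have hm : Measurable fun p => ‖planeGrad v p‖ₑ ^ 2 :=
    (continuous_planeGrad hv).enorm.measurable.pow_const 2
  have hvol : ∀ b : ℝ, volume (Ioo b (b + l)) = ENNReal.ofReal l := fun b => by simp
  set A : ℝ → ENNReal := fun x => ∫⁻ y in Ioo c (c + l), ‖planeGrad v (planePt x y)‖ₑ ^ 2 with hA
  set B : ℝ → ENNReal := fun y => ∫⁻ x in Ioo a (a + l), ‖planeGrad v (planePt x y)‖ₑ ^ 2 with hB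
  have hBm : Measurable B := Measurable.lintegral_prod_right'
    (f := fun z : ℝ × ℝ => ‖planeGrad v (planePt z.2 z.1)‖ₑ ^ 2)
    (hm.comp (measurable_planePt.comp measurable_swap))
  set K := ∫⁻ x in Ioo a (a + l), A x with hK
  have hBK : ∫⁻ y in Ioo c (c + l), B y = K := lintegral_swap_planePt hm _ _
  -- Choose a horizontal line on which the gradient has at most average mass. The constant is the
  -- value at its midpoint, reached from any point of the square by a vertical move to this line and
  -- a horizontal one along it.
  obtain ⟨y', hy', hBy⟩ := exists_le_setLAverage (μ := volume) (s := Ioo c (c + l)) (f := B)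
    (by rw [hvol]; simpa using hl) (by rw [hvol]; simp) hBm.aemeasurable
  rw [setLAverage_eq, hBK, hvol] at hBy
  have hlB : ENNReal.ofReal l * B y' ≤ K := by
    rw [mul_comm]
    exact (ENNReal.le_div_iff_mul_le (Or.inl (by simpa using hl)) (Or.inl (by simp))).1 hBy
  refine ⟨v (planePt (a + l / 2) y'), ?_⟩
  have hpt : ∀ x ∈ Ioo a (a + l), ∀ y ∈ Ioo c (c + l),
      ‖v (planePt x y) - v (planePt (a + l / 2) y')‖ₑ ^ 2 ≤
        2 * (ENNReal.ofReal l * A x + ENNReal.ofReal l * B y') := by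
    intro x hx y hy
    have e : v (planePt x y) - v (planePt (a + l / 2) y') =
        (v (planePt x y) - v (planePt x y')) +
          (v (planePt x y') - v (planePt (a + l / 2) y')) := by ring
    rw [e]
    refine (enorm_add_sq_le _ _).trans ?_
    gcongr
    · refine (enorm_sub_sq_le_lintegral (fun t => hasDerivAt_vertical hv x t)
        ((continuous_planeGrad_apply hv 1).comp (by fun_prop)) (Ioo_subset_Icc_self hy')
        (Ioo_subset_Icc_self hy)).trans ?_
      rw [add_sub_cancel_left]
      gcongr
      exact lintegral_mono fun y => enorm_planeGrad_one_sq_le v _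
    · refine (enorm_sub_sq_le_lintegral (fun t => hasDerivAt_horizontal hv t y')
        ((continuous_planeGrad_apply hv 0).comp (by fun_prop)) (a := a) (b := a + l)
        (s := a + l / 2) ⟨by linarith, by linarith⟩ (Ioo_subset_Icc_self hx)).trans ?_
      rw [add_sub_cancel_left]
      gcongr
      exact lintegral_mono fun y => enorm_planeGrad_zero_sq_le v _
  calc _ ≤ ∫⁻ x in Ioo a (a + l), ∫⁻ y in Ioo c (c + l),
        2 * (ENNReal.ofReal l * A x + ENNReal.ofReal l * B y') :=
        setLIntegral_mono' measurableSet_Ioo fun x hx =>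
          setLIntegral_mono' measurableSet_Ioo fun y hy => hpt x hx y hy
    _ = ∫⁻ x in Ioo a (a + l), (2 * ENNReal.ofReal l * ENNReal.ofReal l * A x +
          2 * ENNReal.ofReal l * (ENNReal.ofReal l * B y')) := by
        refine lintegral_congr fun x => ?_
        rw [setLIntegral_const, hvol]
        ring
    _ = 2 * ENNReal.ofReal l * ENNReal.ofReal l * K +
          2 * ENNReal.ofReal l * (ENNReal.ofReal l * B y') * ENNReal.ofReal l := by
        rw [lintegral_add_right _ measurable_const, setLIntegral_const, hvol,
          lintegral_const_mul']
        exact ENNReal.mul_ne_top (ENNReal.mul_ne_top (by simp) (by simp)) (by simp)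
    _ ≤ 2 * ENNReal.ofReal l * ENNReal.ofReal l * K +
          2 * ENNReal.ofReal l * K * ENNReal.ofReal l := by gcongr
    _ = ENNReal.ofReal (4 * l ^ 2) * K := by
        rw [ENNReal.ofReal_mul (by norm_num), ENNReal.ofReal_pow hl.le, ENNReal.ofReal_ofNat]
        ring

/-- The half-open squares of a grid through the origin. -/
def gridCell (l : ℝ) (i : ℤ × ℤ) : Set Plane :=
  {p | p 0 ∈ Ico (i.1 * l) (i.1 * l + l) ∧ p 1 ∈ Ico (i.2 * l) (i.2 * l + l)}

/-- The open squares of a grid through the origin. -/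
def gridCellInterior (l : ℝ) (i : ℤ × ℤ) : Set Plane :=
  {p | p 0 ∈ Ioo (i.1 * l) (i.1 * l + l) ∧ p 1 ∈ Ioo (i.2 * l) (i.2 * l + l)}

theorem measurableSet_gridCell (l : ℝ) (i : ℤ × ℤ) : MeasurableSet (gridCell l i) := by
  have h0 : Measurable fun p : Plane => p 0 := by fun_prop
  have h1 : Measurable fun p : Plane => p 1 := by fun_prop
  exact (h0 measurableSet_Ico).inter (h1 measurableSet_Ico)

theorem measurableSet_gridCellInterior (l : ℝ) (i : ℤ × ℤ) :
    MeasurableSet (gridCellInterior l i) := by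
  have h0 : Measurable fun p : Plane => p 0 := by fun_prop
  have h1 : Measurable fun p : Plane => p 1 := by fun_prop
  exact (h0 measurableSet_Ioo).inter (h1 measurableSet_Ioo)

theorem gridCellInterior_subset (l : ℝ) (i : ℤ × ℤ) : gridCellInterior l i ⊆ gridCell l i :=
  fun _ h => ⟨Ioo_subset_Ico_self h.1, Ioo_subset_Ico_self h.2⟩

theorem mem_gridCell_iff {l : ℝ} (hl : 0 < l) {i : ℤ × ℤ} {p : Plane} :
    p ∈ gridCell l i ↔ i = (⌊p 0 / l⌋, ⌊p 1 / l⌋) := by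
  have key : ∀ (k : ℤ) (x : ℝ), x ∈ Ico (k * l) (k * l + l) ↔ k = ⌊x / l⌋ := fun k x => by
    rw [eq_comm, Int.floor_eq_iff, le_div_iff₀ hl, div_lt_iff₀ hl, add_mul, one_mul]
    rfl
  rw [Prod.ext_iff]
  exact and_congr (key _ _) (key _ _)

theorem gridCell_disjoint {l : ℝ} (hl : 0 < l) {i j : ℤ × ℤ} (h : i ≠ j) :
    Disjoint (gridCell l i) (gridCell l j) :=
  Set.disjoint_left.2 fun _ hi hj =>
    h (((mem_gridCell_iff hl).1 hi).trans ((mem_gridCell_iff hl).1 hj).symm)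

/-- Half-open cells partition the plane, whereas a cell with an edge on `x = -1` or `y = -1` lies in
the domain only without that edge. The two kinds differ by null sets, so both can be used at once.
-/
theorem exists_const_approx_gridCell {v : Plane → ℝ} (hv : ContDiff ℝ 1 v) {l : ℝ} (hl : 0 < l)
    (i : ℤ × ℤ) : ∃ m : ℝ, ∫⁻ p in gridCell l i, ‖v p - m‖ₑ ^ 2 ≤
      ENNReal.ofReal (4 * l ^ 2) * ∫⁻ p in gridCellInterior l i, energy v p := by
  obtain ⟨m, hm⟩ := exists_const_approx hv (i.1 * l) (i.2 * l) hl
  refine ⟨m, ?_⟩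
  rw [lintegral_between (g := fun p => ‖v p - m‖ₑ ^ 2) (measurableSet_gridCell l i) measurableSet_Ico
      (fun _ => measurableSet_Ico) (fun _ _ => Iff.rfl)
      ((hv.continuous.sub continuous_const).enorm.measurable.pow_const 2),
    lintegral_between (measurableSet_gridCellInterior l i) measurableSet_Ioo
      (fun _ => measurableSet_Ioo) (fun _ _ => Iff.rfl) (measurable_energy hv)]
  simp_rw [Measure.restrict_congr_set (Ioo_ae_eq_Ico (μ := volume)).symm]
  refine hm.trans ?_
  gcongr
  exact enorm_planeGrad_sq_le_energy v _

/-- Approximation in `L₂` by step functions on a fixed finite family of sets, with an error that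
is small compared to the energy. -/
theorem exists_step_approx {ε : ℝ} (hε : 0 < ε) : ∃ (s : Finset (ℤ × ℤ)) (l : ℝ),
    ∀ v : Plane → ℝ, ContDiff ℝ 1 v → ∃ m : ℤ × ℤ → ℝ,
      ∫⁻ p in openRegion, ‖v p - ∑ i ∈ s, (gridCell l i).indicator (fun _ => m i) p‖ₑ ^ 2 ≤
        ENNReal.ofReal ε * ∫⁻ p in openRegion, energy v p := by
  classical
  have huc := (isCompact_Icc (a := (-1 : ℝ)) (b := 1)).uniformContinuousOn_of_continuous
    continuous_roof.continuousOn
  obtain ⟨η, hη, hroof⟩ := Metric.uniformContinuousOn_iff.1 huc (ε / 20) (by positivity)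
  obtain ⟨M, hM⟩ := exists_nat_gt (max 1 (max (1 / η) (20 / ε)))
  have hM1 : (1 : ℝ) < M := (le_max_left _ _).trans_lt hM
  have hM2 : 1 / η < M := ((le_max_left _ _).trans (le_max_right _ _)).trans_lt hM
  have hM3 : 20 / ε < M := ((le_max_right _ _).trans (le_max_right _ _)).trans_lt hM
  have hM0 : (0 : ℝ) < M := by linarith
  -- With the reciprocal of an integer as side length, `x = ± 1` and `y = -1` are grid lines, and
  -- cells that meet the domain can leave it only through the roof.
  set l : ℝ := 1 / M with hl
  have hl0 : 0 < l := by positivity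
  have hl1 : l < 1 := by rw [hl, div_lt_one hM0]; exact hM1
  have hlη : l < η := by rw [hl, one_div_lt hM0 hη]; exact hM2
  have hlε : l < ε / 20 := by
    rw [hl, one_div_lt hM0 (by positivity), one_div_div]; exact hM3
  have hMl : (M : ℝ) * l = 1 := by rw [hl]; field_simp
  let s : Finset (ℤ × ℤ) := (Finset.Icc (-(M : ℤ)) M ×ˢ Finset.Icc (-(M : ℤ)) M).filter
    fun i => gridCellInterior l i ⊆ openRegion
  -- In the cell of a point lying more than `ε / 10` below the roof, the height rises by less than
  -- `ε / 20` and the roof falls by less than `ε / 20`; the whole open cell then stays in the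
  -- domain.
  have hcover : ∀ p ∈ openRegion \ ⋃ i ∈ s, gridCell l i,
      p ∈ openRegion ∧ roof (p 0) - ε / 10 ≤ p 1 := by
    rintro p ⟨hp, hps⟩
    refine ⟨hp, not_lt.1 fun hlt => hps ?_⟩
    obtain ⟨h0, h1, h2⟩ := hp
    have h2' := h2.trans_le (roof_le _)
    rw [abs_lt] at h0
    set i : ℤ × ℤ := (⌊p 0 / l⌋, ⌊p 1 / l⌋) with hi
    have hmem : p ∈ gridCell l i := (mem_gridCell_iff hl0).2 rfl
    obtain ⟨⟨a0, b0⟩, a1, b1⟩ := id hmem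
    have low : ∀ (k : ℤ) (x : ℝ), -1 < x → x < k * l + l → -(M : ℤ) ≤ k := by
      intro k x hx hk
      have : (-(M : ℤ) : ℝ) - 1 < k := by
        push_cast
        by_contra! hc
        have : (k : ℝ) * l ≤ (-(M : ℝ) - 1) * l := mul_le_mul_of_nonneg_right hc hl0.le
        nlinarith
      have : (-(M : ℤ) - 1 : ℤ) < k := by exact_mod_cast this
      omega
    have high : ∀ (k : ℤ) (x : ℝ), x < 1 → k * l ≤ x → k < (M : ℤ) := by
      intro k x hx hk
      have : (k : ℝ) < (M : ℝ) := by
        by_contra! hc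
        have : (M : ℝ) * l ≤ k * l := mul_le_mul_of_nonneg_right hc hl0.le
        linarith
      exact_mod_cast this
    have lowl : ∀ k : ℤ, -(M : ℤ) ≤ k → -1 ≤ (k : ℝ) * l := by
      intro k hk
      have hk' : (-(M : ℝ)) ≤ k := by exact_mod_cast hk
      nlinarith
    have highl : ∀ k : ℤ, k < (M : ℤ) → (k : ℝ) * l + l ≤ 1 := by
      intro k hk
      have hk' : (k : ℝ) + 1 ≤ M := by exact_mod_cast hk
      nlinarith
    have i0 := low i.1 _ h0.1 b0
    have i1 := low i.2 _ h1 b1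
    have j0 := high i.1 _ h0.2 a0
    have j1 := high i.2 (p 1) (by linarith) a1
    refine mem_iUnion₂.2 ⟨i, ?_, hmem⟩
    refine Finset.mem_filter.2 ⟨Finset.mem_product.2
      ⟨Finset.mem_Icc.2 ⟨i0, j0.le⟩, Finset.mem_Icc.2 ⟨i1, j1.le⟩⟩, ?_⟩
    rintro q ⟨⟨c0, d0⟩, c1, d1⟩
    have k0 := lowl _ i0
    have k1 := lowl _ i1
    have k2 := highl _ j0
    refine ⟨abs_lt.2 ⟨by linarith, by linarith⟩, by linarith, ?_⟩
    have hd : dist (q 0) (p 0) < η := by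
      rw [Real.dist_eq, abs_lt]
      constructor <;> linarith
    have := hroof (q 0) ⟨by linarith, by linarith⟩ (p 0) ⟨h0.1.le, h0.2.le⟩ hd
    rw [Real.dist_eq, abs_lt] at this
    linarith
  refine ⟨s, l, fun v hv => ?_⟩
  choose m hm using exists_const_approx_gridCell hv hl0
  refine ⟨m, ?_⟩
  set K := ∫⁻ p in openRegion, energy v p with hK
  set w : Plane → ℝ := fun p => ∑ i ∈ s, (gridCell l i).indicator (fun _ => m i) p with hw
  have hw_cell : ∀ i ∈ s, ∀ p ∈ gridCell l i, w p = m i := by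
    intro i hi p hp
    rw [hw]
    simp only
    rw [Finset.sum_eq_single_of_mem i hi, indicator_of_mem hp]
    intro j _ hj
    exact indicator_of_notMem (Set.disjoint_left.1 (gridCell_disjoint hl0 hj.symm) hp) _
  set N := openRegion \ ⋃ i ∈ s, gridCell l i with hN
  have hNm : MeasurableSet N := isOpen_openRegion.measurableSet.diff
    (s.measurableSet_biUnion fun i _ => measurableSet_gridCell l i)
  have hw_rest : ∀ p ∈ N, w p = 0 := by
    intro p hp
    refine Finset.sum_eq_zero fun i hi => indicator_of_notMem (fun h => hp.2 ?_) _
    exact mem_iUnion₂.2 ⟨i, hi, h⟩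
  have hsub : openRegion ⊆ N ∪ ⋃ i : s, gridCell l i := fun p hp => by
    by_cases h : p ∈ ⋃ i ∈ s, gridCell l i
    · obtain ⟨i, hi, hpi⟩ := mem_iUnion₂.1 h
      exact Or.inr (mem_iUnion.2 ⟨⟨i, hi⟩, hpi⟩)
    · exact Or.inl ⟨hp, h⟩
  have hcells : ∑' i : s, ∫⁻ p in gridCellInterior l i, energy v p ≤ K := by
    rw [← lintegral_iUnion (s := fun i : s => gridCellInterior l i)
      (fun i => measurableSet_gridCellInterior l i)]
    · exact lintegral_mono_set (iUnion_subset fun i => (Finset.mem_filter.1 i.2).2)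
    · intro i j hij
      exact (gridCell_disjoint hl0 (Subtype.coe_injective.ne hij)).mono
        (gridCellInterior_subset l _) (gridCellInterior_subset l _)
  calc ∫⁻ p in openRegion, ‖v p - w p‖ₑ ^ 2
      ≤ (∫⁻ p in N, ‖v p - w p‖ₑ ^ 2) + ∑' i : s, ∫⁻ p in gridCell l i, ‖v p - w p‖ₑ ^ 2 :=
        (lintegral_mono_set hsub).trans ((lintegral_union_le _ _ _).trans
          (add_le_add le_rfl (lintegral_iUnion_le _ _)))
    _ ≤ ENNReal.ofReal (ε / 10) * (5 * K) + ∑' i : s,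
          ENNReal.ofReal (4 * l ^ 2) * ∫⁻ p in gridCellInterior l i, energy v p := by
        refine add_le_add ?_ (ENNReal.tsum_le_tsum fun i => ?_)
        · refine le_trans (le_of_eq ?_) (lintegral_layer_le hv hcover)
          exact setLIntegral_congr_fun hNm fun p hp => by simp only [hw_rest p hp, sub_zero]
        · refine le_trans (le_of_eq ?_) (hm i)
          exact setLIntegral_congr_fun (measurableSet_gridCell l i) fun p hp => by
            simp only [hw_cell i i.2 p hp]
    -- `4 * l ^ 2 ≤ ε / 2` because `l < 1` and `l < ε / 20`; the layer contributes the other half,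
    -- `5 * (ε / 10)`.
    _ ≤ ENNReal.ofReal (ε / 10) * (5 * K) + ENNReal.ofReal (ε / 2) * K := by
        rw [ENNReal.tsum_mul_left]
        gcongr
        nlinarith
    _ = ENNReal.ofReal ε * K := by
        rw [← ENNReal.ofReal_ofNat, ← mul_assoc, ← ENNReal.ofReal_mul (by positivity), ← add_mul,
          ← ENNReal.ofReal_add (by positivity) (by positivity)]
        congr 2
        ring

end StepApproximation

/-! ### Smooth representatives, the trace operator and coercivity -/

section SobolevSpace

theorem Lp_enorm_sq {α E : Type*} [MeasurableSpace α] [NormedAddCommGroup E] {μ : Measure α}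
    (f : Lp E 2 μ) : ‖f‖ₑ ^ 2 = ∫⁻ x, ‖f x‖ₑ ^ 2 ∂μ := by
  rw [Lp.enorm_def, eLpNorm_two_sq]

theorem enorm_sq_le_enorm_sq_iff {E F : Type*} [NormedAddCommGroup E] [NormedAddCommGroup F]
    {c : ℝ} (hc : 0 ≤ c) {x : E} {y : F} :
    ‖x‖ₑ ^ 2 ≤ ENNReal.ofReal c * ‖y‖ₑ ^ 2 ↔ ‖x‖ ^ 2 ≤ c * ‖y‖ ^ 2 := by
  rw [← ofReal_norm, ← ofReal_norm, ← ENNReal.ofReal_pow (norm_nonneg _),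
    ← ENNReal.ofReal_pow (norm_nonneg _), ← ENNReal.ofReal_mul hc,
    ENNReal.ofReal_le_ofReal_iff (by positivity)]

/-- The gradient as a bounded operator. -/
noncomputable def gradCLM (Ω : Set Plane) : H1 Ω →L[ℝ] L2Field Ω :=
  (WithLp.sndL 2 ℝ (L2 Ω) (L2Field Ω)).comp (sobolevSubmodule Ω).subtypeL

@[simp] theorem gradCLM_apply {Ω : Set Plane} (u : H1 Ω) : gradCLM Ω u = u.grad := rfl

@[simp] theorem embedding_apply {Ω : Set Plane} (u : H1 Ω) : H1.embedding Ω u = u.fn := rfl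

theorem H1_norm_sq {Ω : Set Plane} (u : H1 Ω) : ‖u‖ ^ 2 = ‖u.fn‖ ^ 2 + ‖u.grad‖ ^ 2 :=
  WithLp.prod_norm_sq_eq_of_L2 u.1

theorem H1_enorm_sq {Ω : Set Plane} (u : H1 Ω) : ‖u‖ₑ ^ 2 = ‖u.fn‖ₑ ^ 2 + ‖u.grad‖ₑ ^ 2 := by
  rw [← ofReal_norm, ← ofReal_norm, ← ofReal_norm, ← ENNReal.ofReal_pow (norm_nonneg _),
    ← ENNReal.ofReal_pow (norm_nonneg _), ← ENNReal.ofReal_pow (norm_nonneg _), H1_norm_sq,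
    ENNReal.ofReal_add (by positivity) (by positivity)]

theorem memLp_of_continuousOn {E : Type*} [NormedAddCommGroup E] [SecondCountableTopology E]
    {f : Plane → E} {K s : Set Plane}
    (hK : IsCompact K) (hf : ContinuousOn f K) (hs : MeasurableSet s) (hsK : s ⊆ K)
    {μ : Measure Plane} (hμ : μ s < ⊤) : MemLp f 2 (μ.restrict s) := by
  have : IsFiniteMeasure (μ.restrict s) := ⟨by rwa [Measure.restrict_apply_univ]⟩
  obtain ⟨C, hC⟩ := hK.exists_bound_of_continuousOn hf
  refine MemLp.of_bound ((hf.mono hsK).aestronglyMeasurable hs) C ?_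
  exact (ae_restrict_iff' hs).2 (Eventually.of_forall fun x hx => hC x (hsK hx))

theorem volume_openRegion_lt_top : volume openRegion < ⊤ := isBounded_openRegion.measure_lt_top

theorem frontier_subset_closedRegion : frontier openRegion ⊆ closedRegion := by
  rw [frontier_openRegion]; exact sdiff_subset

instance : IsFiniteMeasure (bdryMeasure openRegion) :=
  ⟨by rw [Measure.restrict_apply_univ]; exact hausdorffMeasure_frontier_lt_top⟩

theorem memLp_bdry {f : Plane → ℝ} (hf : ContinuousOn f closedRegion) :
    MemLp f 2 (bdryMeasure openRegion) :=
  memLp_of_continuousOn isCompact_closedRegion hf isClosed_frontier.measurableSet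
    frontier_subset_closedRegion hausdorffMeasure_frontier_lt_top

theorem inner_planeGrad {v : Plane → ℝ} (p e : Plane) :
    ⟪planeGrad v p, e⟫_ℝ = fderiv ℝ v p e := by
  have he : e = e 0 • planePt 1 0 + e 1 • planePt 0 1 := plane_ext (by simp) (by simp)
  conv_rhs => rw [he, map_add, map_smul, map_smul]
  conv_lhs => rw [← planePt_eta e, inner_planePt]
  rfl

/-- Smooth functions of the plane define elements of `H¹`. -/
theorem exists_H1_of_contDiff {v : Plane → ℝ} (hv : ContDiff ℝ 1 v) :
    ∃ u : H1 openRegion, u.fn =ᵐ[volume.restrict openRegion] v ∧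
      u.grad =ᵐ[volume.restrict openRegion] planeGrad v := by
  have hΩ := isOpen_openRegion.measurableSet
  have h1 : MemLp v 2 (volume.restrict openRegion) :=
    memLp_of_continuousOn isCompact_closedRegion hv.continuous.continuousOn hΩ
      openRegion_subset_closedRegion volume_openRegion_lt_top
  have h2 : MemLp (planeGrad v) 2 (volume.restrict openRegion) :=
    memLp_of_continuousOn isCompact_closedRegion (continuous_planeGrad hv).continuousOn hΩ
      openRegion_subset_closedRegion volume_openRegion_lt_top
  refine ⟨⟨WithLp.toLp 2 (h1.toLp v, h2.toLp (planeGrad v)), ?_⟩, h1.coeFn_toLp, h2.coeFn_toLp⟩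
  intro η hη e
  have hd := (hη.1.continuous_fderiv (by simp)).clm_apply (continuous_const (y := e))
  have hvd := (hv.continuous_fderiv one_ne_zero).clm_apply (continuous_const (y := e))
  -- The support of `η` lies in the domain, so both integrals extend to the plane, where integration
  -- by parts has no boundary term.
  have e1 : ∫ x in openRegion, h1.toLp v x * fderiv ℝ η x e = ∫ x, v x * fderiv ℝ η x e := by
    refine Eq.trans ?_ (setIntegral_eq_integral_of_forall_compl_eq_zero (s := openRegion) ?_)
    · exact integral_congr_ae (h1.coeFn_toLp.mono fun x hx => by simp only [hx])
    · intro x hx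
      have : fderiv ℝ η x = 0 := by
        by_contra hne
        exact hx (hη.2.2 (support_fderiv_subset ℝ hne))
      simp [this]
  have e2 : ∫ x in openRegion, ⟪h2.toLp (planeGrad v) x, e⟫_ℝ * η x =
      ∫ x, fderiv ℝ v x e * η x := by
    refine Eq.trans ?_ (setIntegral_eq_integral_of_forall_compl_eq_zero (s := openRegion) ?_)
    · exact integral_congr_ae (h2.coeFn_toLp.mono fun x hx => by simp only [hx, inner_planeGrad])
    · intro x hx
      have : η x = 0 := by
        by_contra hne
        exact hx (hη.2.2 (subset_tsupport _ hne))
      simp [this]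
  change ∫ x in openRegion, h1.toLp v x * fderiv ℝ η x e =
    -∫ x in openRegion, ⟪h2.toLp (planeGrad v) x, e⟫_ℝ * η x
  rw [e1, e2]
  refine integral_mul_fderiv_eq_neg_fderiv_mul_of_integrable ?_ ?_ ?_
    (fun x _ => hv.differentiable one_ne_zero x)
    (fun x _ => hη.1.differentiable (by simp) x)
  · exact (hvd.mul hη.1.continuous).integrable_of_hasCompactSupport hη.2.1.mul_left
  · exact (hv.continuous.mul hd).integrable_of_hasCompactSupport
      (hη.2.1.fderiv_apply ℝ e).mul_left
  · exact (hv.continuous.mul hη.1.continuous).integrable_of_hasCompactSupport hη.2.1.mul_left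

/-- `u` is the element of `H¹` given by the smooth function `v`. -/
def IsSmoothRep (u : H1 openRegion) (v : Plane → ℝ) : Prop :=
  ContDiff ℝ ∞ v ∧ u.fn =ᵐ[volume.restrict openRegion] v ∧
    u.grad =ᵐ[volume.restrict openRegion] planeGrad v

theorem IsSmoothRep.contDiff_one {u : H1 openRegion} {v : Plane → ℝ} (h : IsSmoothRep u v) :
    ContDiff ℝ 1 v := h.1.of_le (by simp)

theorem IsSmoothRep.isContRep {u : H1 openRegion} {v : Plane → ℝ} (h : IsSmoothRep u v) :
    u.IsContRep v := ⟨h.1.continuous.continuousOn, h.2.1⟩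

theorem IsSmoothRep.fn_enorm_sq {u : H1 openRegion} {v : Plane → ℝ} (h : IsSmoothRep u v) :
    ‖u.fn‖ₑ ^ 2 = ∫⁻ p in openRegion, ‖v p‖ₑ ^ 2 := by
  rw [Lp_enorm_sq]
  exact lintegral_congr_ae (h.2.1.mono fun x hx => by simp only [hx])

theorem IsSmoothRep.grad_enorm_sq {u : H1 openRegion} {v : Plane → ℝ} (h : IsSmoothRep u v) :
    ‖u.grad‖ₑ ^ 2 = ∫⁻ p in openRegion, ‖planeGrad v p‖ₑ ^ 2 := by
  rw [Lp_enorm_sq]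
  exact lintegral_congr_ae (h.2.2.mono fun x hx => by simp only [hx])

theorem IsSmoothRep.enorm_sq {u : H1 openRegion} {v : Plane → ℝ} (h : IsSmoothRep u v) :
    ‖u‖ₑ ^ 2 = ∫⁻ p in openRegion, energy v p := by
  unfold energy
  rw [H1_enorm_sq, h.fn_enorm_sq, h.grad_enorm_sq, lintegral_add_left]
  exact h.1.continuous.enorm.measurable.pow_const 2

/-- Density of smooth functions. -/
theorem exists_smooth_seq (u : H1 openRegion) : ∃ (U : ℕ → H1 openRegion) (v : ℕ → Plane → ℝ),
    (∀ k, IsSmoothRep (U k) (v k)) ∧ Tendsto U atTop (𝓝 u) ∧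
    ∀ f, u.IsContRep f → ∀ p ∈ closedRegion, Tendsto (fun k => v k p) atTop (𝓝 (f p)) := by
  obtain ⟨v, hv, h1, h2, h3⟩ := exists_smooth_approx u
  choose U hU1 hU2 using fun k => exists_H1_of_contDiff ((hv k).of_le (by simp : (1 : WithTop ℕ∞) ≤ ∞))
  refine ⟨U, v, fun k => ⟨hv k, hU1 k, hU2 k⟩, ?_, h3⟩
  have hfn : ∀ k, ‖(U k).fn - u.fn‖ₑ ^ 2 = ∫⁻ p in openRegion, ‖v k p - u.fn p‖ₑ ^ 2 := fun k => by
    rw [Lp_enorm_sq]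
    refine lintegral_congr_ae ?_
    filter_upwards [hU1 k, Lp.coeFn_sub (U k).fn u.fn] with p hp hp'
    rw [hp', Pi.sub_apply, hp]
  have hgr : ∀ k, ‖(U k).grad - u.grad‖ₑ ^ 2 =
      ∫⁻ p in openRegion, ‖planeGrad (v k) p - u.grad p‖ₑ ^ 2 := fun k => by
    rw [Lp_enorm_sq]
    refine lintegral_congr_ae ?_
    filter_upwards [hU2 k, Lp.coeFn_sub (U k).grad u.grad] with p hp hp'
    rw [hp', Pi.sub_apply, hp]
  have hsum : Tendsto (fun k => ‖U k - u‖ₑ ^ 2) atTop (𝓝 0) := by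
    have := h1.add h2
    rw [add_zero] at this
    refine this.congr fun k => ?_
    rw [← hfn, ← hgr]
    exact (H1_enorm_sq (U k - u)).symm
  rw [tendsto_iff_norm_sub_tendsto_zero]
  have h4 : Tendsto (fun k => ‖U k - u‖ ^ 2) atTop (𝓝 0) := by
    have := (ENNReal.tendsto_toReal ENNReal.zero_ne_top).comp hsum
    simpa [Function.comp_def] using this
  have := h4.sqrt
  simpa using this

/-- The trace inequality for functions that are continuous up to the boundary. -/
theorem lintegral_bdry_le {u : H1 openRegion} {f : Plane → ℝ} (h : u.IsContRep f) :
    ∫⁻ p, ‖f p‖ₑ ^ 2 ∂(bdryMeasure openRegion) ≤ ENNReal.ofReal 220 * ‖u‖ₑ ^ 2 := by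
  obtain ⟨U, v, hUv, hU, hp⟩ := exists_smooth_seq u
  have hΓ := isClosed_frontier (s := openRegion)
  -- Pointwise convergence of the smooth approximations on the boundary and Fatou's lemma carry the
  -- inequality over to `f`.
  have h1 : ∀ p ∈ frontier openRegion, ‖f p‖ₑ ^ 2 = liminf (fun k => ‖v k p‖ₑ ^ 2) atTop := by
    intro p hp'
    have h2 := hp f h p (frontier_subset_closedRegion hp')
    have h3 := ((ENNReal.continuous_pow 2).tendsto _).comp ((continuous_enorm.tendsto _).comp h2)
    exact h3.liminf_eq.symm
  have h4 : Tendsto (fun k => ENNReal.ofReal 220 * ‖U k‖ₑ ^ 2) atTop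
      (𝓝 (ENNReal.ofReal 220 * ‖u‖ₑ ^ 2)) :=
    ENNReal.Tendsto.const_mul (((ENNReal.continuous_pow 2).tendsto _).comp
      ((continuous_enorm.tendsto _).comp hU)) (Or.inr ENNReal.ofReal_ne_top)
  calc ∫⁻ p, ‖f p‖ₑ ^ 2 ∂(bdryMeasure openRegion)
      = ∫⁻ p, liminf (fun k => ‖v k p‖ₑ ^ 2) atTop ∂(bdryMeasure openRegion) :=
        setLIntegral_congr_fun hΓ.measurableSet h1
    _ ≤ liminf (fun k => ∫⁻ p, ‖v k p‖ₑ ^ 2 ∂(bdryMeasure openRegion)) atTop :=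
        lintegral_liminf_le fun k => (hUv k).1.continuous.enorm.measurable.pow_const 2
    _ ≤ liminf (fun k => ENNReal.ofReal 220 * ‖U k‖ₑ ^ 2) atTop := by
        refine liminf_le_liminf (Eventually.of_forall fun k => ?_)
        rw [(hUv k).enorm_sq, ENNReal.ofReal_ofNat]
        exact lintegral_frontier_sq_le (hUv k).contDiff_one
    _ = ENNReal.ofReal 220 * ‖u‖ₑ ^ 2 := h4.liminf_eq

theorem norm_bdry_le {u : H1 openRegion} {f : Plane → ℝ} (h : u.IsContRep f)
    {Φ : L2Bdry openRegion} (hΦ : Φ =ᵐ[bdryMeasure openRegion] f) : ‖Φ‖ ≤ 15 * ‖u‖ := by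
  have h1 : ‖Φ‖ₑ ^ 2 ≤ ENNReal.ofReal 220 * ‖u‖ₑ ^ 2 := by
    rw [Lp_enorm_sq]
    refine (le_of_eq ?_).trans (lintegral_bdry_le h)
    exact lintegral_congr_ae (hΦ.mono fun x hx => by simp only [hx])
  rw [enorm_sq_le_enorm_sq_iff (by norm_num)] at h1
  refine (sq_le_sq₀ (norm_nonneg _) (by positivity)).1 ?_
  -- `15² = 225 ≥ 220`.
  nlinarith [sq_nonneg ‖u‖]

/-! ### Traces -/

theorem RoughDtN.H1.IsContRep.sub {u u' : H1 openRegion} {f f' : Plane → ℝ} (h : u.IsContRep f)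
    (h' : u'.IsContRep f') : (u - u').IsContRep fun p => f p - f' p := by
  refine ⟨h.1.sub h'.1, ?_⟩
  filter_upwards [h.2, h'.2, Lp.coeFn_sub u.fn u'.fn] with p h1 h2 h3
  rw [← h1, ← h2, ← Pi.sub_apply, ← h3]
  rfl

theorem RoughDtN.H1.IsContRep.add {u u' : H1 openRegion} {f f' : Plane → ℝ} (h : u.IsContRep f)
    (h' : u'.IsContRep f') : (u + u').IsContRep fun p => f p + f' p := by
  refine ⟨h.1.add h'.1, ?_⟩
  filter_upwards [h.2, h'.2, Lp.coeFn_add u.fn u'.fn] with p h1 h2 h3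
  rw [← h1, ← h2, ← Pi.add_apply, ← h3]
  rfl

theorem RoughDtN.H1.IsContRep.const_smul {u : H1 openRegion} {f : Plane → ℝ} (h : u.IsContRep f) (c : ℝ) :
    (c • u).IsContRep fun p => c * f p := by
  refine ⟨continuousOn_const.mul h.1, ?_⟩
  filter_upwards [h.2, Lp.coeFn_smul c u.fn] with p h1 h2
  rw [← h1, ← smul_eq_mul, ← Pi.smul_apply, ← h2]
  rfl

theorem RoughDtN.IsTrace.add {u u' : H1 openRegion} {φ φ' : L2Bdry openRegion} (h : IsTrace u φ)
    (h' : IsTrace u' φ') : IsTrace (u + u') (φ + φ') := by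
  obtain ⟨U, f, Φ, h1, h2, h3, h4⟩ := h
  obtain ⟨U', f', Φ', h1', h2', h3', h4'⟩ := h'
  refine ⟨fun n => U n + U' n, fun n p => f n p + f' n p, fun n => Φ n + Φ' n,
    fun n => (h1 n).add (h1' n), fun n => ?_, h3.add h3', h4.add h4'⟩
  filter_upwards [h2 n, h2' n, Lp.coeFn_add (Φ n) (Φ' n)] with p e1 e2 e3
  rw [e3, Pi.add_apply, e1, e2]

theorem RoughDtN.IsTrace.const_smul {u : H1 openRegion} {φ : L2Bdry openRegion} (h : IsTrace u φ) (c : ℝ) :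
    IsTrace (c • u) (c • φ) := by
  obtain ⟨U, f, Φ, h1, h2, h3, h4⟩ := h
  refine ⟨fun n => c • U n, fun n p => c * f n p, fun n => c • Φ n,
    fun n => (h1 n).const_smul c, fun n => ?_, h3.const_smul c, h4.const_smul c⟩
  filter_upwards [h2 n, Lp.coeFn_smul c (Φ n)] with p e1 e2
  rw [e2, Pi.smul_apply, e1, smul_eq_mul]

theorem RoughDtN.IsTrace.norm_le {u : H1 openRegion} {φ : L2Bdry openRegion} (h : IsTrace u φ) :
    ‖φ‖ ≤ 15 * ‖u‖ := by
  obtain ⟨U, f, Φ, h1, h2, h3, h4⟩ := h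
  exact le_of_tendsto_of_tendsto' h4.norm (h3.norm.const_mul 15) fun n => norm_bdry_le (h1 n) (h2 n)

/-- By linearity `φ - φ'` is a trace of `0`, and the norm bound leaves only zero. -/
theorem RoughDtN.IsTrace.unique {u : H1 openRegion} {φ φ' : L2Bdry openRegion} (h : IsTrace u φ)
    (h' : IsTrace u φ') : φ = φ' := by
  have h1 := (h.add (h'.const_smul (-1))).norm_le
  rw [neg_one_smul, neg_one_smul, add_neg_cancel, norm_zero, mul_zero, ← sub_eq_add_neg] at h1
  exact sub_eq_zero.1 (norm_le_zero_iff.1 h1)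

theorem isTrace_of_isContRep {u : H1 openRegion} {f : Plane → ℝ} (h : u.IsContRep f)
    {Φ : L2Bdry openRegion} (hΦ : Φ =ᵐ[bdryMeasure openRegion] f) : IsTrace u Φ :=
  ⟨fun _ => u, fun _ => f, fun _ => Φ, fun _ => h, fun _ => hΦ, tendsto_const_nhds,
    tendsto_const_nhds⟩

/-- The trace inequality for differences makes the boundary values of a smooth approximating
sequence Cauchy. -/
theorem exists_isTrace (u : H1 openRegion) : ∃ φ : L2Bdry openRegion, IsTrace u φ := by
  obtain ⟨U, v, hUv, hU, -⟩ := exists_smooth_seq u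
  have hm : ∀ k, MemLp (v k) 2 (bdryMeasure openRegion) := fun k =>
    memLp_bdry (hUv k).1.continuous.continuousOn
  set Φ : ℕ → L2Bdry openRegion := fun k => (hm k).toLp (v k)
  have hΦ : ∀ k, Φ k =ᵐ[bdryMeasure openRegion] v k := fun k => (hm k).coeFn_toLp
  have hb : ∀ k j, ‖Φ k - Φ j‖ ≤ 15 * ‖U k - U j‖ := fun k j => by
    refine norm_bdry_le ((hUv k).isContRep.sub (hUv j).isContRep) ?_
    filter_upwards [hΦ k, hΦ j, Lp.coeFn_sub (Φ k) (Φ j)] with p e1 e2 e3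
    rw [e3, Pi.sub_apply, e1, e2]
  have hC : CauchySeq Φ := by
    have hUC := hU.cauchySeq
    rw [Metric.cauchySeq_iff] at hUC ⊢
    intro ε hε
    obtain ⟨N, hN⟩ := hUC (ε / 15) (by positivity)
    refine ⟨N, fun m hm n hn => ?_⟩
    have h1 := hN m hm n hn
    rw [dist_eq_norm] at h1 ⊢
    exact (hb m n).trans_lt (by linarith)
  obtain ⟨φ, hφ⟩ := cauchySeq_tendsto_of_complete hC
  exact ⟨φ, U, v, Φ, fun k => (hUv k).isContRep, hΦ, hU, hφ⟩

theorem existsUnique_isTrace (u : H1 openRegion) : ∃! φ : L2Bdry openRegion, IsTrace u φ := by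
  obtain ⟨φ, hφ⟩ := exists_isTrace u
  exact ⟨φ, hφ, fun _ h => h.unique hφ⟩

/-- The trace operator. -/
noncomputable def traceCLM : H1 openRegion →L[ℝ] L2Bdry openRegion :=
  LinearMap.mkContinuous
    { toFun := fun u => (exists_isTrace u).choose
      map_add' := fun u u' => (exists_isTrace (u + u')).choose_spec.unique
        ((exists_isTrace u).choose_spec.add (exists_isTrace u').choose_spec)
      map_smul' := fun c u => (exists_isTrace (c • u)).choose_spec.unique
        ((exists_isTrace u).choose_spec.const_smul c) }
    15 fun u => (exists_isTrace u).choose_spec.norm_le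

theorem isTrace_traceCLM (u : H1 openRegion) : IsTrace u (traceCLM u) :=
  (exists_isTrace u).choose_spec

theorem RoughDtN.IsTrace.eq_traceCLM {u : H1 openRegion} {φ : L2Bdry openRegion} (h : IsTrace u φ) :
    φ = traceCLM u := h.unique (isTrace_traceCLM u)

theorem traceCLM_ae_eq {u : H1 openRegion} {f : Plane → ℝ} (h : u.IsContRep f) :
    traceCLM u =ᵐ[bdryMeasure openRegion] f := by
  have hm : MemLp f 2 (bdryMeasure openRegion) := memLp_bdry (by
    have := h.1; rwa [closure_openRegion] at this)
  have h1 : IsTrace u (hm.toLp f) := isTrace_of_isContRep h hm.coeFn_toLp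
  rw [← h1.eq_traceCLM]
  exact hm.coeFn_toLp

theorem IsSmoothRep.traceCLM_enorm_sq {u : H1 openRegion} {v : Plane → ℝ} (h : IsSmoothRep u v) :
    ‖traceCLM u‖ₑ ^ 2 = ∫⁻ p in frontier openRegion, ‖v p‖ₑ ^ 2 ∂μH[1] := by
  rw [Lp_enorm_sq]
  exact lintegral_congr_ae ((traceCLM_ae_eq h.isContRep).mono fun x hx => by simp only [hx])

/-- The norm of `H¹` is controlled by the gradient and the trace. -/
theorem H1_norm_sq_le (u : H1 openRegion) :
    ‖u‖ ^ 2 ≤ 9 * (‖gradCLM openRegion u‖ ^ 2 + ‖traceCLM u‖ ^ 2) := by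
  obtain ⟨U, v, hUv, hU, -⟩ := exists_smooth_seq u
  have hc : Continuous fun u : H1 openRegion =>
      9 * (‖gradCLM openRegion u‖ ^ 2 + ‖traceCLM u‖ ^ 2) := by fun_prop
  refine le_of_tendsto_of_tendsto' (hU.norm.pow 2) ((hc.tendsto u).comp hU) fun k => ?_
  have h1 := lintegral_sq_le_grad_add_frontier (hUv k).contDiff_one
  rw [← (hUv k).fn_enorm_sq, ← (hUv k).grad_enorm_sq, ← (hUv k).traceCLM_enorm_sq] at h1
  have h2 : ‖(U k).fn‖ ^ 2 ≤ 8 * ‖(U k).grad‖ ^ 2 + 4 * ‖traceCLM (U k)‖ ^ 2 := by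
    have e8 : (8 : ENNReal) = ENNReal.ofReal 8 := by simp
    have e4 : (4 : ENNReal) = ENNReal.ofReal 4 := by simp
    rw [← ofReal_norm, ← ofReal_norm, ← ofReal_norm, ← ENNReal.ofReal_pow (norm_nonneg _),
      ← ENNReal.ofReal_pow (norm_nonneg _), ← ENNReal.ofReal_pow (norm_nonneg _), e8, e4, ← ENNReal.ofReal_mul (by norm_num),
      ← ENNReal.ofReal_mul (by norm_num), ← ENNReal.ofReal_add (by positivity) (by positivity),
      ENNReal.ofReal_le_ofReal_iff (by positivity)] at h1
    exact h1
  simp only [Function.comp_apply, gradCLM_apply]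
  rw [H1_norm_sq]
  -- The gradient enters with factor `1 + 8` and the trace with factor `4`.
  nlinarith [sq_nonneg ‖traceCLM (U k)‖]

/-- The range of the trace is dense. -/
theorem eq_zero_of_inner_traceCLM (f : L2Bdry openRegion)
    (h : ∀ u, ⟪f, traceCLM u⟫_ℝ = 0) : f = 0 := by
  rw [Lp.eq_zero_iff_ae_eq_zero]
  -- Every test function of the plane restricts to a trace, so `f` is orthogonal to all of them.
  refine ae_eq_zero_of_integral_contDiff_smul_eq_zero
    ((Lp.memLp f).locallyIntegrable (by norm_num)) fun η hη _ => ?_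
  obtain ⟨u, hu1, hu2⟩ := exists_H1_of_contDiff (hη.of_le (by simp : (1 : WithTop ℕ∞) ≤ ∞))
  have hu : IsSmoothRep u η := ⟨hη, hu1, hu2⟩
  have h0 := h u
  rw [L2.inner_def] at h0
  rw [← h0]
  refine integral_congr_ae ?_
  filter_upwards [traceCLM_ae_eq hu.isContRep] with p hp
  rw [hp]
  simp

end SobolevSpace

/-! ### The Dirichlet-to-Neumann relation in form terms -/

section DirichletToNeumann

/-- For a fixed test function and direction the condition equates two continuous functionals, namely
`L₂` inner products. This gives the completeness of `H¹`, which Lax–Milgram needs. -/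
theorem isClosed_sobolevSubmodule (Ω : Set Plane) :
    IsClosed (sobolevSubmodule Ω : Set (WithLp 2 (L2 Ω × L2Field Ω))) := by
  have h : ∀ η, IsTest Ω η → ∀ e : Plane, IsClosed {w : WithLp 2 (L2 Ω × L2Field Ω) |
      ∫ x in Ω, w.fst x * fderiv ℝ η x e = -∫ x in Ω, ⟪w.snd x, e⟫_ℝ * η x} := by
    intro η hη e
    have ha : MemLp (fun x => fderiv ℝ η x e) 2 (volume.restrict Ω) :=
      ((hη.1.continuous_fderiv (by simp)).clm_apply
        continuous_const).memLp_of_hasCompactSupport (hη.2.1.fderiv_apply ℝ e)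
    have hb : MemLp (fun x => η x • e) 2 (volume.restrict Ω) :=
      (hη.1.continuous.smul continuous_const).memLp_of_hasCompactSupport hη.2.1.smul_right
    have e1 : ∀ w : WithLp 2 (L2 Ω × L2Field Ω),
        ∫ x in Ω, w.fst x * fderiv ℝ η x e = ⟪ha.toLp _, w.fst⟫_ℝ := fun w => by
      rw [L2.inner_def]
      refine integral_congr_ae (ha.coeFn_toLp.mono fun x hx => ?_)
      simp [hx]
    have e2 : ∀ w : WithLp 2 (L2 Ω × L2Field Ω),
        ∫ x in Ω, ⟪w.snd x, e⟫_ℝ * η x = ⟪hb.toLp _, w.snd⟫_ℝ := fun w => by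
      rw [L2.inner_def]
      refine integral_congr_ae (hb.coeFn_toLp.mono fun x hx => ?_)
      simp only [hx, real_inner_smul_left, real_inner_comm, mul_comm]
    simp only [e1, e2]
    refine isClosed_eq ?_ ?_
    · exact continuous_const.inner (WithLp.fstL 2 ℝ (L2 Ω) (L2Field Ω)).continuous
    · exact (continuous_const.inner (WithLp.sndL 2 ℝ (L2 Ω) (L2Field Ω)).continuous).neg
  convert isClosed_iInter fun η => isClosed_iInter fun hη => isClosed_iInter fun e => h η hη e
  ext w
  simp only [mem_iInter]
  rfl

instance (Ω : Set Plane) : CompleteSpace (H1 Ω) :=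
  (isClosed_sobolevSubmodule Ω).completeSpace_coe

theorem RoughDtN.IsTest.fderiv_apply {Ω : Set Plane} {η : Plane → ℝ} (hη : IsTest Ω η)
    (e : Plane) : IsTest Ω fun x => fderiv ℝ η x e := by
  refine ⟨(hη.1.fderiv_right (by simp)).clm_apply contDiff_const, hη.2.1.fderiv_apply ℝ e, ?_⟩
  refine (closure_mono ?_).trans ((tsupport_fderiv_subset ℝ).trans hη.2.2)
  intro x hx h0
  exact hx (by simp [h0])

theorem laplacian_plane {η : Plane → ℝ} (hη : ContDiff ℝ ∞ η) (x : Plane) :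
    Laplacian.laplacian η x =
      fderiv ℝ (fun y => fderiv ℝ η y (planePt 1 0)) x (planePt 1 0) +
      fderiv ℝ (fun y => fderiv ℝ η y (planePt 0 1)) x (planePt 0 1) := by
  have h0 : EuclideanSpace.basisFun (Fin 2) ℝ 0 = planePt 1 0 := plane_ext (by simp) (by simp)
  have h1 : EuclideanSpace.basisFun (Fin 2) ℝ 1 = planePt 0 1 := plane_ext (by simp) (by simp)
  have hd : DifferentiableAt ℝ (fderiv ℝ η) x :=
    (hη.fderiv_right (m := ∞) (by simp)).differentiable (by simp) x
  rw [InnerProductSpace.laplacian_eq_iteratedFDeriv_orthonormalBasis η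
    (EuclideanSpace.basisFun (Fin 2) ℝ)]
  simp only [Fin.sum_univ_two, h0, h1, iteratedFDeriv_two_apply]
  simp [fderiv_clm_apply hd (differentiableAt_const _)]

/-- The weak gradient is tested with the first partial derivatives of `η`. Harmonicity thereby
becomes orthogonality to the gradients of test functions. -/
theorem inner_grad_eq {u w : H1 openRegion} {η : Plane → ℝ} (hη : IsTest openRegion η)
    (hw : IsSmoothRep w η) :
    ⟪u.grad, w.grad⟫_ℝ = -∫ x in openRegion, u.fn x * Laplacian.laplacian η x := by
  have e1 := u.2 _ (hη.fderiv_apply (planePt 1 0)) (planePt 1 0)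
  have e2 := u.2 _ (hη.fderiv_apply (planePt 0 1)) (planePt 0 1)
  simp only [laplacian_plane hη.1, mul_add]
  rw [integral_add ((hη.fderiv_apply _).integrable_fderiv _ _)
    ((hη.fderiv_apply _).integrable_fderiv _ _), e1, e2, ← neg_add, neg_neg,
    ← integral_add ((hη.fderiv_apply _).integrable_inner _ _)
    ((hη.fderiv_apply _).integrable_inner _ _), L2.inner_def]
  refine integral_congr_ae (hw.2.2.mono fun x hx => ?_)
  simp only [hx]
  rw [real_inner_comm, ← planePt_eta (u.grad x), inner_planeGrad]
  have : planePt (u.grad x 0) (u.grad x 1) =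
    u.grad x 0 • planePt 1 0 + u.grad x 1 • planePt 0 1 := plane_ext (by simp) (by simp)
  rw [this, map_add, map_smul, map_smul]
  simp [planePt, PiLp.inner_apply]

theorem integral_zero_L2_mul (f : Plane → ℝ) :
    ∫ x in openRegion, (0 : L2 openRegion) x * f x = 0 := by
  refine integral_eq_zero_of_ae ?_
  filter_upwards [Lp.coeFn_zero ℝ 2 (volume.restrict openRegion)] with x hx
  rw [hx]; simp

/-- `HasNormalDerivative` brings its own Laplacian; for a harmonic function it must be zero, and the
volume term in Green's formula disappears. -/
theorem eq_zero_of_distribLaplacian {u : H1 openRegion} {h : L2 openRegion}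
    (h0 : HasDistribLaplacian u 0) (h1 : HasDistribLaplacian u h) : h = 0 := by
  rw [Lp.eq_zero_iff_ae_eq_zero]
  have hz : ∀ᵐ x ∂volume.restrict openRegion, x ∈ openRegion → h x = 0 := by
    refine isOpen_openRegion.ae_eq_zero_of_integral_contDiff_smul_eq_zero
      (((Lp.memLp h).locallyIntegrable (by norm_num)).locallyIntegrableOn _)
      fun η hη hc hs => ?_
    have e0 := h0 η ⟨hη, hc, hs⟩
    have e1 := h1 η ⟨hη, hc, hs⟩
    rw [e1] at e0
    simp only [smul_eq_mul, mul_comm (η _)]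
    rw [e0, integral_zero_L2_mul]
  filter_upwards [hz, ae_restrict_mem isOpen_openRegion.measurableSet] with x h h'
  exact h h'

theorem inner_traceCLM {v : H1 openRegion} {f : Plane → ℝ} (h : v.IsContRep f)
    (ψ : L2Bdry openRegion) :
    ⟪ψ, traceCLM v⟫_ℝ = ∫ x, ψ x * f x ∂(bdryMeasure openRegion) := by
  rw [L2.inner_def]
  refine integral_congr_ae ((traceCLM_ae_eq h).mono fun x hx => ?_)
  simp [hx, mul_comm]

theorem traceCLM_eq_zero_of_isTest {w : H1 openRegion} {η : Plane → ℝ}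
    (hη : IsTest openRegion η) (hw : IsSmoothRep w η) : traceCLM w = 0 := by
  rw [Lp.eq_zero_iff_ae_eq_zero]
  filter_upwards [traceCLM_ae_eq hw.isContRep,
    ae_restrict_mem isClosed_frontier.measurableSet] with x hx hxΓ
  rw [hx, Pi.zero_apply]
  rw [frontier_openRegion] at hxΓ
  exact image_eq_zero_of_notMem_tsupport fun h => hxΓ.2 (hη.2.2 h)

/-- The Dirichlet-to-Neumann relation is the one associated with the Dirichlet form. -/
theorem dtnRel_iff (φ ψ : L2Bdry openRegion) : DtNRel openRegion φ ψ ↔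
    ∃ u, traceCLM u = φ ∧
      ∀ v, ⟪gradCLM openRegion u, gradCLM openRegion v⟫_ℝ = ⟪ψ, traceCLM v⟫_ℝ := by
  constructor
  · rintro ⟨u, hΔ, htr, h, hh, hG⟩
    refine ⟨u, htr.eq_traceCLM.symm, fun v => ?_⟩
    rw [eq_zero_of_distribLaplacian hΔ hh] at hG
    -- Green's formula is given only for `v` continuous up to the boundary; density and continuity
    -- of both sides extend it to `H¹`.
    obtain ⟨U, f, hUf, hU, -⟩ := exists_smooth_seq v
    have h1 : ∀ k, ⟪gradCLM openRegion u, gradCLM openRegion (U k)⟫_ℝ =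
        ⟪ψ, traceCLM (U k)⟫_ℝ := fun k => by
      rw [inner_traceCLM (hUf k).isContRep, ← hG _ _ (hUf k).isContRep, integral_zero_L2_mul,
        zero_add, L2.inner_def]
      rfl
    have h2 := (tendsto_const_nhds (x := gradCLM openRegion u)).inner (𝕜 := ℝ)
      (((gradCLM openRegion).continuous.tendsto v).comp hU)
    have h3 := (tendsto_const_nhds (x := ψ)).inner (𝕜 := ℝ) ((traceCLM.continuous.tendsto v).comp hU)
    exact tendsto_nhds_unique (h2.congr h1) h3
  · rintro ⟨u, rfl, hu⟩
    -- Test functions have trace zero, so the form identity makes `u` harmonic.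
    have hΔ : HasDistribLaplacian u 0 := by
      intro η hη
      obtain ⟨w, hw1, hw2⟩ := exists_H1_of_contDiff (hη.1.of_le (by simp : (1 : WithTop ℕ∞) ≤ ∞))
      have hw : IsSmoothRep w η := ⟨hη.1, hw1, hw2⟩
      have h1 := hu w
      rw [traceCLM_eq_zero_of_isTest hη hw, inner_zero_right, gradCLM_apply, gradCLM_apply,
        inner_grad_eq hη hw, neg_eq_zero] at h1
      rw [h1, integral_zero_L2_mul]
    refine ⟨u, hΔ, isTrace_traceCLM u, 0, hΔ, fun v f hf => ?_⟩
    rw [integral_zero_L2_mul, zero_add, ← inner_traceCLM hf, ← hu v, L2.inner_def]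
    rfl

end DirichletToNeumann

/-! ### Compactness of `H¹` in `L₂` -/

section CompactEmbedding

/-- An operator that can be approximated in finite-dimensional subspaces is compact. -/
theorem isCompactOperator_of_exists_finiteDimensional {V H : Type*} [NormedAddCommGroup V]
    [NormedSpace ℝ V] [NormedAddCommGroup H] [InnerProductSpace ℝ H] [CompleteSpace H]
    (E : V →L[ℝ] H)
    (h : ∀ ε : ℝ, 0 < ε → ∃ (W : Submodule ℝ H) (_ : FiniteDimensional ℝ W),
      ∀ u, ‖E u - W.starProjection (E u)‖ ≤ ε * ‖u‖) : IsCompactOperator E := by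
  choose W hW hE using fun n : ℕ => h (1 / ((n : ℝ) + 1)) Nat.one_div_pos_of_nat
  -- The finite-rank operators obtained by projecting `E` converge to it in operator norm.
  refine isCompactOperator_of_tendsto (l := atTop)
    (F := fun n => (W n).starProjection.comp E) ?_ (Eventually.of_forall fun n => ?_)
  · rw [tendsto_iff_norm_sub_tendsto_zero]
    refine squeeze_zero (fun _ => norm_nonneg _) (fun n => ?_)
      tendsto_one_div_add_atTop_nhds_zero_nat
    refine ContinuousLinearMap.opNorm_le_bound _ (by positivity) fun u => ?_
    rw [← norm_neg]
    simpa using hE n u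
  · have := FiniteDimensional.proper ℝ (W n)
    exact (isCompactOperator_of_locallyCompactSpace_dom
      ((W n).orthogonalProjectionOnto.comp E)).clm_comp (W n).subtypeL

theorem Lp_coeFn_finset_sum {α ι : Type*} [MeasurableSpace α] {μ : Measure α} (s : Finset ι)
    (f : ι → Lp ℝ 2 μ) : (∑ i ∈ s, f i : Lp ℝ 2 μ) =ᵐ[μ] fun x => ∑ i ∈ s, f i x := by
  classical
  induction s using Finset.induction_on with
  | empty =>
    filter_upwards [Lp.coeFn_zero ℝ 2 μ] with x hx
    rw [Finset.sum_empty, hx]; simp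
  | insert i s hi ih =>
    rw [Finset.sum_insert hi]
    filter_upwards [ih, Lp.coeFn_add (f i) (∑ j ∈ s, f j)] with x h1 h2
    rw [h2, Pi.add_apply, h1, Finset.sum_insert hi]

/-- The grid cells in `exists_step_approx` depend only on the tolerance, so their indicators span a
space independent of `u`. The projection is the best approximation and is no worse than the step
function; density reduces everything to smooth `u`. -/
theorem isCompactOperator_embedding : IsCompactOperator (H1.embedding openRegion) := by
  refine isCompactOperator_of_exists_finiteDimensional _ fun ε hε => ?_
  obtain ⟨s, l, hs⟩ := exists_step_approx (ε := ε ^ 2) (by positivity)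
  have : IsFiniteMeasure (volume.restrict openRegion) :=
    ⟨by rw [Measure.restrict_apply_univ]; exact volume_openRegion_lt_top⟩
  set b : ℤ × ℤ → L2 openRegion := fun i =>
    indicatorConstLp 2 (measurableSet_gridCell l i) (measure_ne_top _ _) (1 : ℝ) with hb
  set W : Submodule ℝ (L2 openRegion) := Submodule.span ℝ (b '' s) with hWdef
  have hW : FiniteDimensional ℝ W := FiniteDimensional.span_of_finite ℝ (s.finite_toSet.image b)
  refine ⟨W, hW, fun u => ?_⟩
  obtain ⟨U, v, hUv, hU, -⟩ := exists_smooth_seq u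
  have hc : Continuous fun u : H1 openRegion =>
      ‖H1.embedding openRegion u - W.starProjection (H1.embedding openRegion u)‖ := by fun_prop
  refine le_of_tendsto_of_tendsto' ((hc.tendsto u).comp hU) (hU.norm.const_mul ε) fun k => ?_
  obtain ⟨m, hm⟩ := hs (v k) (hUv k).contDiff_one
  set w : L2 openRegion := ∑ i ∈ s, m i • b i with hw
  have hwW : w ∈ W := Submodule.sum_mem _ fun i hi =>
    Submodule.smul_mem _ _ (Submodule.subset_span ⟨i, hi, rfl⟩)
  have hwae : w =ᵐ[volume.restrict openRegion]
      fun p => ∑ i ∈ s, (gridCell l i).indicator (fun _ => m i) p := by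
    have h1 : ∀ i ∈ s, ∀ᵐ p ∂volume.restrict openRegion,
        (m i • b i) p = (gridCell l i).indicator (fun _ => m i) p := fun i _ => by
      filter_upwards [Lp.coeFn_smul (m i) (b i), indicatorConstLp_coeFn (p := 2)
        (hs := measurableSet_gridCell l i) (hμs := measure_ne_top (volume.restrict openRegion) _)
        (c := (1 : ℝ))] with p h2 h3
      rw [h2, Pi.smul_apply, hb]
      simp only [h3, indicator, smul_eq_mul]
      split_ifs <;> simp
    have h2 := (ae_ball_iff (Finset.countable_toSet s)).2 h1
    filter_upwards [Lp_coeFn_finset_sum s fun i => m i • b i, h2] with p h3 h4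
    rw [hw, h3]
    exact Finset.sum_congr rfl h4
  have h1 : ‖(U k).fn - w‖ₑ ^ 2 ≤ ENNReal.ofReal (ε ^ 2) * ‖U k‖ₑ ^ 2 := by
    rw [(hUv k).enorm_sq, Lp_enorm_sq]
    refine (le_of_eq (lintegral_congr_ae ?_)).trans hm
    filter_upwards [(hUv k).2.1, hwae, Lp.coeFn_sub (U k).fn w] with p h3 h4 h5
    rw [h5, Pi.sub_apply, h3, h4]
  rw [enorm_sq_le_enorm_sq_iff (by positivity), ← mul_pow] at h1
  have h2 : ‖(U k).fn - w‖ ≤ ε * ‖U k‖ :=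
    (sq_le_sq₀ (norm_nonneg _) (by positivity)).1 h1
  refine le_trans ?_ h2
  simp only [Function.comp_apply, embedding_apply]
  rw [W.starProjection_minimal]
  exact ciInf_le ⟨0, by rintro _ ⟨_, rfl⟩; exact norm_nonneg _⟩ (⟨w, hwW⟩ : W)

end CompactEmbedding

/-! ### Noncompactness of the trace -/

section TraceNotCompact

/-- By Pythagoras the images have mutual distance at least `√c`, so no subsequence is Cauchy. -/
theorem not_isCompactOperator_of_orthogonal {V H : Type*} [NormedAddCommGroup V]
    [NormedSpace ℝ V] [NormedAddCommGroup H] [InnerProductSpace ℝ H] (T : V →L[ℝ] H)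
    {u : ℕ → V} {C c : ℝ} (hc : 0 < c) (hu : ∀ n, ‖u n‖ ≤ C) (hT : ∀ n, c ≤ ‖T (u n)‖ ^ 2)
    (ho : ∀ n m, n ≠ m → ⟪T (u n), T (u m)⟫_ℝ = 0) : ¬ IsCompactOperator T := by
  intro h
  obtain ⟨K, hK, hTK⟩ := h.image_closedBall_subset_compact C
  obtain ⟨φ, -, g, hg, hlim⟩ := hK.tendsto_subseq (x := fun n => T (u n)) fun n =>
    hTK ⟨u n, by simpa using hu n, rfl⟩
  have hC := Metric.cauchySeq_iff.1 hlim.cauchySeq (√c) (Real.sqrt_pos.2 hc)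
  obtain ⟨N, hN⟩ := hC
  have h1 := hN N le_rfl (N + 1) (Nat.le_succ N)
  simp only [Function.comp_apply, dist_eq_norm] at h1
  have h2 := norm_sub_sq_real (T (u (g N))) (T (u (g (N + 1))))
  rw [ho _ _ (hg (Nat.lt_succ_self N)).ne] at h2
  have h3 : ‖T (u (g N)) - T (u (g (N + 1)))‖ ^ 2 < c := by
    rw [← Real.sq_sqrt hc.le]
    gcongr
  have h4 := hT (g N)
  nlinarith [sq_nonneg ‖T (u (g (N + 1)))‖]

theorem contDiff_mul_plane {f g : ℝ → ℝ} (hf : ContDiff ℝ ∞ f) (hg : ContDiff ℝ ∞ g) :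
    ContDiff ℝ ∞ fun p : Plane => f (p 0) * g (p 1) :=
  (hf.comp (by fun_prop)).mul (hg.comp (by fun_prop))

theorem planeGrad_mul {f g : ℝ → ℝ} (hf : ContDiff ℝ ∞ f) (hg : ContDiff ℝ ∞ g) (p : Plane) :
    planeGrad (fun p : Plane => f (p 0) * g (p 1)) p =
      planePt (deriv f (p 0) * g (p 1)) (f (p 0) * deriv g (p 1)) := by
  have hv : ContDiff ℝ 1 fun p : Plane => f (p 0) * g (p 1) :=
    (contDiff_mul_plane hf hg).of_le (by simp)
  have h0 := hasDerivAt_horizontal hv (p 0) (p 1)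
  have h1 := hasDerivAt_vertical hv (p 0) (p 1)
  rw [planePt_eta] at h0 h1
  simp only [planePt_apply_zero, planePt_apply_one] at h0 h1
  have e0 := (hf.differentiable (by simp) (p 0)).hasDerivAt.mul_const (g (p 1))
  have e1 := (hg.differentiable (by simp) (p 1)).hasDerivAt.const_mul (f (p 0))
  refine plane_ext ?_ ?_
  · rw [planePt_apply_zero, h0.unique e0]
  · rw [planePt_apply_one, h1.unique e1]

/-- A smooth cut-off function of the base of a spike. -/
theorem exists_spike_bump {n : ℕ} (hn : 1 ≤ n) : ∃ f : ℝ → ℝ, ContDiff ℝ ∞ f ∧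
    (∀ x ∈ spikeBase n, f x = 1 ∧ deriv f x = 0) ∧
    ∀ x, x ∉ window n → f x = 0 ∧ deriv f x = 0 := by
  have h0 : (0 : ℝ) < 1 / 2 ^ n := by positivity
  -- With `r = 2^(-n)`, the radii `r / 6` and `r / 5` lie between the bound `r / 8` for the
  -- half-width of the base and the half-width `r / 4` of the window.
  let f : ContDiffBump (1 / 2 ^ n : ℝ) := ⟨1 / 2 ^ n / 6, 1 / 2 ^ n / 5, by positivity, by linarith⟩
  refine ⟨f, f.contDiff, fun x hx => ?_, fun x hx => ?_⟩
  · have h1 : x ∈ Metric.ball (1 / 2 ^ n : ℝ) f.rIn := by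
      rw [Metric.mem_ball, Real.dist_eq]
      refine (mem_spikeBase.1 hx).trans_lt ((spikeHeight_sq_le hn).trans_lt ?_)
      change 1 / 2 ^ n / 8 < 1 / 2 ^ n / 6
      linarith
    have h2 := f.eventuallyEq_one_of_mem_ball h1
    exact ⟨h2.self_of_nhds, by rw [h2.deriv_eq]; exact deriv_const _ _⟩
  · have h1 : x ∉ tsupport f := by
      rw [f.tsupport_eq, Metric.mem_closedBall, Real.dist_eq]
      change ¬ |x - 1 / 2 ^ n| ≤ 1 / 2 ^ n / 5
      intro h
      rw [abs_le] at h
      exact hx ⟨by linarith, by linarith⟩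
    have h2 := notMem_tsupport_iff_eventuallyEq.1 h1
    exact ⟨h2.self_of_nhds, by rw [h2.deriv_eq]; exact deriv_const _ _⟩

/-- A smooth function that rises from `0` to `1` in the unit interval. -/
theorem exists_smooth_rise : ∃ (g : ℝ → ℝ) (M : ℝ), ContDiff ℝ ∞ g ∧
    (∀ t ≤ 0, g t = 0 ∧ deriv g t = 0) ∧ (∀ t, 1 / 2 ≤ t → g t = 1) ∧ (∀ t, |g t| ≤ 1) ∧
    ∀ t ∈ Icc (0 : ℝ) 1, |deriv g t| ≤ M := by
  -- The rise takes place for `t` between `1/4` and `1/2`, so the function vanishes in a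
  -- neighbourhood of `t ≤ 0`.
  have hg : ContDiff ℝ ∞ fun t : ℝ => Real.smoothTransition (4 * t - 1) :=
    Real.smoothTransition.contDiff.comp (by fun_prop)
  obtain ⟨M, hM⟩ := isCompact_Icc.exists_bound_of_continuousOn
    (hg.continuous_deriv (by simp)).continuousOn (s := Icc (0 : ℝ) 1)
  refine ⟨_, M, hg, fun t ht => ?_, fun t ht => ?_, fun t => ?_, hM⟩
  · have h : (fun t : ℝ => Real.smoothTransition (4 * t - 1)) =ᶠ[𝓝 t] fun _ => 0 := by
      filter_upwards [Iio_mem_nhds (show t < 1 / 4 by linarith)] with s hs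
      rw [mem_Iio] at hs
      exact Real.smoothTransition.zero_of_nonpos (by linarith)
    exact ⟨h.self_of_nhds, by rw [h.deriv_eq]; exact deriv_const _ _⟩
  · exact Real.smoothTransition.one_of_one_le (by linarith)
  · rw [abs_of_nonneg (Real.smoothTransition.nonneg _)]
    exact Real.smoothTransition.le_one _

theorem enorm_sq_eq_ofReal (x : ℝ) : ‖x‖ₑ ^ 2 = ENNReal.ofReal (x ^ 2) := by
  rw [← ofReal_norm, ← ENNReal.ofReal_pow (norm_nonneg _), Real.norm_eq_abs, sq_abs]

theorem volume_spikeBase_prod (n : ℕ) :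
    volume {p : Plane | p 0 ∈ spikeBase n ∧ p 1 ∈ Icc 0 (spikeHeight n)} =
      ENNReal.ofReal (2 * spikeHeight n ^ 3) := by
  have hm : MeasurableSet {p : Plane | p 0 ∈ spikeBase n ∧ p 1 ∈ Icc 0 (spikeHeight n)} := by
    have h0 : Measurable fun p : Plane => p 0 := by fun_prop
    have h1 : Measurable fun p : Plane => p 1 := by fun_prop
    exact (h0 (measurableSet_spikeBase n)).inter (h1 measurableSet_Icc)
  have := lintegral_between hm (measurableSet_spikeBase n)
    (fun _ => measurableSet_Icc (a := 0) (b := spikeHeight n))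
    (fun x y => by simp) (measurable_const (a := (1 : ENNReal)))
  rw [setLIntegral_one] at this
  rw [this]
  simp only [one_mul, Real.volume_Icc, lintegral_const, Measure.restrict_apply_univ,
    volume_spikeBase]
  rw [← ENNReal.ofReal_mul (by have := spikeHeight_pos n; linarith)]
  congr 1
  ring

/-- A bounded sequence of smooth functions, each supported in one spike, with traces that do not
become small. -/
theorem exists_spike_functions : ∃ C : ℝ, 0 ≤ C ∧ ∀ n, 1 ≤ n →
    ∃ (u : H1 openRegion) (v : Plane → ℝ), IsSmoothRep u v ∧ ‖u‖ ^ 2 ≤ C ∧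
      1 / 2 ≤ ‖traceCLM u‖ ^ 2 ∧ ∀ p, p 0 ∉ window n → v p = 0 := by
  obtain ⟨ψ, M, hψ, hψ0, hψ1, hψb, hM⟩ := exists_smooth_rise
  refine ⟨2 * (1 + M ^ 2), by positivity, fun n hn => ?_⟩
  obtain ⟨f, hf, hf1, hf0⟩ := exists_spike_bump hn
  set a := spikeHeight n with ha
  have ha0 : 0 < a := spikeHeight_pos n
  have ha1 : a ≤ 1 / 4 := spikeHeight_le hn
  -- The amplitude is `a^(-1/2)`, so that `c² a = 1`; this normalises both the energy and the
  -- boundary mass.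
  set c : ℝ := 2 ^ n with hcdef
  have hca : c ^ 2 * a = 1 := by
    rw [ha, spikeHeight_eq, ← mul_pow, hcdef, mul_one_div_cancel (by positivity), one_pow]
  set g : ℝ → ℝ := fun y => c * ψ (a⁻¹ * y) with hgdef
  have hg : ContDiff ℝ ∞ g := contDiff_const.mul (hψ.comp (by fun_prop))
  have hg' : ∀ y, deriv g y = c * (a⁻¹ * deriv ψ (a⁻¹ * y)) := fun y => by
    have h1 : HasDerivAt (fun y : ℝ => a⁻¹ * y) a⁻¹ y := by
      simpa using (hasDerivAt_id y).const_mul a⁻¹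
    have h2 := ((hψ.differentiable (by simp) (a⁻¹ * y)).hasDerivAt.comp y h1).const_mul c
    rw [mul_comm a⁻¹ (deriv _ _)]
    exact h2.deriv
  have hg0 : ∀ y ≤ 0, g y = 0 ∧ deriv g y = 0 := fun y hy => by
    have h := hψ0 (a⁻¹ * y) (mul_nonpos_of_nonneg_of_nonpos (by positivity) hy)
    rw [hg', hgdef]
    simp [h.1, h.2]
  set v : Plane → ℝ := fun p => f (p 0) * g (p 1) with hvdef
  have hv : ContDiff ℝ ∞ v := contDiff_mul_plane hf hg
  obtain ⟨u, hu1, hu2⟩ := exists_H1_of_contDiff (hv.of_le (by simp : (1 : WithTop ℕ∞) ≤ ∞))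
  have hu : IsSmoothRep u v := ⟨hv, hu1, hu2⟩
  have hE : ∀ p, energy v p = ENNReal.ofReal ((f (p 0) * g (p 1)) ^ 2 +
      ((deriv f (p 0) * g (p 1)) ^ 2 + (f (p 0) * deriv g (p 1)) ^ 2)) := fun p => by
    rw [energy, planeGrad_mul hf hg, plane_enorm_sq, planePt_apply_zero, planePt_apply_one,
      enorm_sq_eq_ofReal, enorm_sq_eq_ofReal, enorm_sq_eq_ofReal,
      ← ENNReal.ofReal_add (by positivity) (by positivity),
      ← ENNReal.ofReal_add (by positivity) (by positivity)]
  set S : Set Plane := {p | p 0 ∈ spikeBase n ∧ p 1 ∈ Icc 0 a} with hS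
  set K : ℝ := c ^ 2 * (1 + M ^ 2 / a ^ 2) with hK
  -- Within the domain the function lives on the spike alone: it vanishes for `y ≤ 0`, and above
  -- that level the window contains only the spike. There the cut-off is constant and only the
  -- vertical derivative, of size `c / a`, remains.
  have hES : ∀ p ∈ openRegion, energy v p ≤ S.indicator (fun _ => ENNReal.ofReal K) p := by
    intro p hp
    by_cases hpS : p ∈ S
    · rw [indicator_of_mem hpS, hE, (hf1 _ hpS.1).1, (hf1 _ hpS.1).2, hg']
      refine ENNReal.ofReal_le_ofReal ?_
      have ht : a⁻¹ * p 1 ∈ Icc (0 : ℝ) 1 :=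
        ⟨mul_nonneg (by positivity) hpS.2.1, by
          rw [inv_mul_le_iff₀ ha0, mul_one]; exact hpS.2.2⟩
      have h1 : ψ (a⁻¹ * p 1) ^ 2 ≤ 1 := (sq_le_one_iff_abs_le_one _).2 (hψb _)
      have h2 : deriv ψ (a⁻¹ * p 1) ^ 2 ≤ M ^ 2 := by
        rw [← sq_abs (deriv ψ _)]
        exact pow_le_pow_left₀ (abs_nonneg _) (hM _ ht) 2
      have e : (1 * g (p 1)) ^ 2 + ((0 * g (p 1)) ^ 2 +
          (1 * (c * (a⁻¹ * deriv ψ (a⁻¹ * p 1)))) ^ 2) =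
          c ^ 2 * (ψ (a⁻¹ * p 1) ^ 2 + deriv ψ (a⁻¹ * p 1) ^ 2 / a ^ 2) := by
        rw [hgdef]; ring
      rw [e, hK]
      gcongr
    · rw [indicator_of_notMem hpS, hE, nonpos_iff_eq_zero, ENNReal.ofReal_eq_zero]
      rcases le_or_gt (p 1) 0 with hy | hy
      · rw [(hg0 _ hy).1, (hg0 _ hy).2]; simp
      · by_cases hx : p 0 ∈ window n
        · exfalso
          have h1 := hp.2.2
          rw [roof_eq_tent hn hx] at h1
          have h2 := (lt_tent_iff hy.le).1 h1
          exact hpS ⟨mem_spikeBase.2 (h2.le.trans (sub_le_self _ (by positivity))), hy.le,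
            h1.le.trans (tent_le _ _)⟩
        · rw [(hf0 _ hx).1, (hf0 _ hx).2]; simp
  have hSm : MeasurableSet S := by
    have h0 : Measurable fun p : Plane => p 0 := by fun_prop
    have h1 : Measurable fun p : Plane => p 1 := by fun_prop
    exact (h0 (measurableSet_spikeBase n)).inter (h1 measurableSet_Icc)
  refine ⟨u, v, hu, ?_, ?_, fun p hp => by rw [hvdef]; simp [(hf0 _ hp).1]⟩
  · have h1 : ‖u‖ₑ ^ 2 ≤ ENNReal.ofReal (2 * (1 + M ^ 2)) := by
      calc ‖u‖ₑ ^ 2 = ∫⁻ p in openRegion, energy v p := hu.enorm_sq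
        _ ≤ ∫⁻ p in openRegion, S.indicator (fun _ => ENNReal.ofReal K) p :=
            setLIntegral_mono' isOpen_openRegion.measurableSet hES
        _ ≤ ∫⁻ p, S.indicator (fun _ => ENNReal.ofReal K) p := setLIntegral_le_lintegral _ _
        _ = ENNReal.ofReal K * ENNReal.ofReal (2 * a ^ 3) := by
            rw [lintegral_indicator hSm, lintegral_const, Measure.restrict_apply_univ,
              volume_spikeBase_prod]
        _ ≤ ENNReal.ofReal (2 * (1 + M ^ 2)) := by
            rw [← ENNReal.ofReal_mul (by positivity)]
            refine ENNReal.ofReal_le_ofReal ?_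
            have : K * (2 * a ^ 3) = c ^ 2 * a * (2 * (a ^ 2 + M ^ 2)) := by
              rw [hK]; field_simp
            rw [this, hca]
            nlinarith
    rw [← ofReal_norm, ← ENNReal.ofReal_pow (norm_nonneg _),
      ENNReal.ofReal_le_ofReal_iff (by positivity)] at h1
    exact h1
  -- Over the inner half of the right half of the base the tent is at least `a / 2`, where the
  -- function has risen to `c`. Length factor, amplitude squared and width give `(1 / a) * c² * (a²
  -- / 2) = 1 / 2`.
  · set E : Set ℝ := Icc (1 / 2 ^ n) (1 / 2 ^ n + a ^ 2 / 2)
    have hEabs : ∀ x ∈ E, |x - 1 / 2 ^ n| ≤ a ^ 2 / 2 := fun x hx => by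
      rw [abs_le]; constructor <;> nlinarith [hx.1, hx.2]
    have hEb : ∀ x ∈ E, |x - 1 / 2 ^ n| ≤ a ^ 2 := fun x hx =>
      (hEabs x hx).trans (by nlinarith)
    have hsub : (fun x => planePt x (tent n x)) '' E ⊆ frontier openRegion := by
      rintro _ ⟨x, hx, rfl⟩
      have hw := mem_window_of_abs_le hn (hEb x hx)
      rw [frontier_openRegion]
      have ht := tent_nonneg n x
      refine ⟨⟨(abs_lt.2 (window_subset hn hw)).le, ?_, ?_⟩, fun h => ?_⟩
      · simp only [planePt_apply_one]; linarith
      · simp only [planePt_apply_one, planePt_apply_zero, roof_eq_tent hn hw, le_refl]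
      · have := h.2.2
        simp only [planePt_apply_one, planePt_apply_zero, roof_eq_tent hn hw, lt_irrefl] at this
    have hval : ∀ x ∈ E, ‖v (planePt x (tent n x))‖ₑ ^ 2 = ENNReal.ofReal (c ^ 2) := by
      intro x hx
      have ht : 1 / 2 ≤ a⁻¹ * tent n x := by
        rw [tent_eq (hEb x hx), le_inv_mul_iff₀ ha0]
        have h1 : |x - 1 / 2 ^ n| / a ≤ a / 2 := by
          rw [div_le_iff₀ ha0]; nlinarith [hEabs x hx]
        linarith
      have e : v (planePt x (tent n x)) = c := by
        simp only [hvdef, hgdef, planePt_apply_zero, planePt_apply_one,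
          (hf1 x (mem_spikeBase.2 (hEb x hx))).1, hψ1 _ ht, one_mul, mul_one]
      rw [e, enorm_sq_eq_ofReal]
    have h1 : ENNReal.ofReal (1 / 2) ≤ ‖traceCLM u‖ₑ ^ 2 := by
      calc ENNReal.ofReal (1 / 2)
          = ENNReal.ofReal (1 / a) * (ENNReal.ofReal (c ^ 2) * ENNReal.ofReal (a ^ 2 / 2)) := by
            rw [← ENNReal.ofReal_mul (by positivity), ← ENNReal.ofReal_mul (by positivity)]
            congr 1
            field_simp
            rw [mul_comm, hca]
        _ ≤ ENNReal.ofReal (sideFactor n) *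
              (ENNReal.ofReal (c ^ 2) * ENNReal.ofReal (a ^ 2 / 2)) := by
            gcongr
            exact le_sideFactor n
        _ = ENNReal.ofReal (sideFactor n) * ∫⁻ x in E, ‖v (planePt x (tent n x))‖ₑ ^ 2 := by
            rw [setLIntegral_congr_fun measurableSet_Icc hval, lintegral_const,
              Measure.restrict_apply_univ, Real.volume_Icc, add_sub_cancel_left]
        _ = ∫⁻ p in (fun x => planePt x (tent n x)) '' E, ‖v p‖ₑ ^ 2 ∂μH[1] := by
            rw [lintegral_spike_right n measurableSet_Icc
              (Icc_subset_Icc_right (by nlinarith))]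
        _ ≤ ∫⁻ p in frontier openRegion, ‖v p‖ₑ ^ 2 ∂μH[1] := lintegral_mono_set hsub
        _ = ‖traceCLM u‖ₑ ^ 2 := hu.traceCLM_enorm_sq.symm
    rw [← ofReal_norm, ← ENNReal.ofReal_pow (norm_nonneg _),
      ENNReal.ofReal_le_ofReal_iff (by positivity)] at h1
    exact h1

/-- The functions are supported over disjoint windows, so the products of different traces vanish
almost everywhere. -/
theorem not_isCompactOperator_traceCLM : ¬ IsCompactOperator traceCLM := by
  obtain ⟨C, hC, h⟩ := exists_spike_functions
  choose u v huv hu hT hv using fun n : ℕ => h (n + 1) (Nat.le_add_left 1 n)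
  refine not_isCompactOperator_of_orthogonal traceCLM (u := u) (C := √C) (c := 1 / 2)
    (by norm_num) (fun n => Real.le_sqrt_of_sq_le (hu n)) hT fun n m hnm => ?_
  rw [L2.inner_def]
  refine integral_eq_zero_of_ae ?_
  filter_upwards [traceCLM_ae_eq (huv n).isContRep, traceCLM_ae_eq (huv m).isContRep]
    with p h1 h2
  rw [h1, h2]
  by_cases hp : p 0 ∈ window (n + 1)
  · rw [hv m p (Set.disjoint_left.1 (window_disjoint (by omega)) hp)]; simp
  · rw [hv n p hp]; simp

end TraceNotCompact

/-! ### Conclusions for the domain -/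

theorem trace_inequality {u : H1 openRegion} {f : Plane → ℝ} (h : u.IsContRep f) :
    ∫ x in frontier openRegion, |f x| ^ 2 ∂μH[1] ≤
      225 * ((∫ x in openRegion, ‖u.grad x‖ ^ 2) + ∫ x in openRegion, |u.fn x| ^ 2) := by
  have h1 : ∫ x in frontier openRegion, |f x| ^ 2 ∂μH[1] = ‖traceCLM u‖ ^ 2 := by
    rw [← real_inner_self_eq_norm_sq, L2.inner_def]
    refine integral_congr_ae ((traceCLM_ae_eq h).mono fun x hx => ?_)
    simp only [hx, real_inner_self_eq_norm_sq, Real.norm_eq_abs]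
  have h2 : ∫ x in openRegion, ‖u.grad x‖ ^ 2 = ‖u.grad‖ ^ 2 := by
    rw [← real_inner_self_eq_norm_sq, L2.inner_def]
    simp only [real_inner_self_eq_norm_sq]
  have h3 : ∫ x in openRegion, |u.fn x| ^ 2 = ‖u.fn‖ ^ 2 := by
    rw [← real_inner_self_eq_norm_sq, L2.inner_def]
    simp only [real_inner_self_eq_norm_sq, Real.norm_eq_abs]
  rw [h1, h2, h3, add_comm, ← H1_norm_sq]
  have h4 := pow_le_pow_left₀ (norm_nonneg _) (isTrace_traceCLM u).norm_le 2
  rw [mul_pow] at h4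
  linarith

/-- The abstract form operator is applied with the gradient as `T` and the trace as `j`; a compact
resolvent would make the trace compact. -/
theorem exists_dtnOperator : ∃ D₀ : L2Bdry openRegion →ₗ.[ℝ] L2Bdry openRegion,
    IsDtNOperator openRegion D₀ ∧ IsSelfAdjoint D₀ ∧
    (∀ φ : D₀.domain, 0 ≤ ⟪D₀ φ, (φ : L2Bdry openRegion)⟫_ℝ) ∧ ¬ HasCompactResolvent D₀ := by
  obtain ⟨A, h1, h2, h3, h4⟩ := exists_form_operator (gradCLM openRegion) traceCLM
    (c := 9) (by norm_num) H1_norm_sq_le eq_zero_of_inner_traceCLM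
  exact ⟨A, fun φ ψ => (h1 φ ψ).trans (dtnRel_iff φ ψ).symm, h2, h3,
    fun h => not_isCompactOperator_traceCLM (h4 h)⟩

theorem mainTheorem12 :
    -- the domain: bounded, open, connected, continuous boundary of finite length
    Bornology.IsBounded spikyDomain ∧
    IsOpen spikyDomain ∧
    IsConnected spikyDomain ∧
    HasContinuousBoundary spikyDomain ∧
    μH[1] (frontier spikyDomain) < ⊤ ∧
    -- the trace inequality
    (∃ c : ℝ, 0 < c ∧ ∀ (u : H1 spikyDomain) (f : Plane → ℝ),
      u.IsContRep f →
        ∫ x in frontier spikyDomain, |f x| ^ 2 ∂μH[1] ≤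
          c * ((∫ x in spikyDomain, ‖u.grad x‖ ^ 2) +
            ∫ x in spikyDomain, |u.fn x| ^ 2)) ∧
    -- every element of `H¹(Ω)` has a unique trace
    (∀ u : H1 spikyDomain,
      ∃! φ : L2Bdry spikyDomain, IsTrace u φ) ∧
    -- `H¹(Ω)` is compactly embedded in `L₂(Ω)`
    IsCompactOperator (H1.embedding spikyDomain) ∧
    -- the trace is a bounded operator that is not compact
    (∃ Tr : H1 spikyDomain →L[ℝ] L2Bdry spikyDomain,
      (∀ u, IsTrace u (Tr u)) ∧ ¬ IsCompactOperator Tr) ∧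
    -- the Dirichlet-to-Neumann operator is a positive self-adjoint operator without
    -- compact resolvent
    (∃ D₀ : L2Bdry spikyDomain →ₗ.[ℝ] L2Bdry spikyDomain,
      IsDtNOperator spikyDomain D₀ ∧
      IsSelfAdjoint D₀ ∧
      (∀ φ : D₀.domain, 0 ≤ ⟪D₀ φ, (φ : L2Bdry spikyDomain)⟫_ℝ) ∧
      ¬ HasCompactResolvent D₀) := by
  rw [spikyDomain_eq]
  exact ⟨isBounded_openRegion, isOpen_openRegion, isConnected_openRegion,
    hasContinuousBoundary_openRegion, hausdorffMeasure_frontier_lt_top,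
    ⟨225, by norm_num, fun _ _ => trace_inequality⟩, existsUnique_isTrace,
    isCompactOperator_embedding, ⟨traceCLM, isTrace_traceCLM, not_isCompactOperator_traceCLM⟩,
    exists_dtnOperator⟩
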